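/- Let $n\ge 1$ and let $\mathbb H^n$ be $\mathbb R^{2n}\times\mathbb R$, with points $g=(z,t)$, $z=(x,y)$, and group law $(x,y,t)(x',y',t')=\bigl(x+x',\,y+y',\,t+t'+\tfrac12(\langle x,y'\rangle-\langle x',y\rangle)\bigr)$. Put $L_g(g')=gg'$, $\delta_\lambda(z,t)=(\lambda z,\lambda^2t)$ and $Q=2n+2$; $|E|$ denotes Lebesgue measure. Let $X_i=\partial_{x_i}-\frac{y_i}{2}\partial_t$ and $X_{n+i}=\partial_{y_i}+\frac{x_i}{2}\partial_t$ for $i=1,\dots,n$, and for measurable $E\subset\mathbb H^n$ let $$P_H(E;\mathbb H^n)=\sup\Bigl\{\int_E\sum_{j=1}^{2n}X_j\zeta_j\,dz\,dt\;:\;\zeta_1,\dots,\zeta_{2n}\in C^1_0(\mathbb H^n),\ \sum_{j=1}^{2n}\zeta_j^2\le1\Bigr\}\in[0,\infty],$$ where $C^1_0(\mathbb H^n)$ is the set of compactly supported real $C^1$ functions. Let $\mathbb H^n_\pm=\{(z,t):\pm t>0\}$ and $B(0,R)=\{z\in\mathbb R^{2n}:|z|<R\}$. Let $\mathcal E$ be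 the collection of all bounded open sets $E\subset\mathbb H^n$ that are equal to the interior of their closure and satisfy: (i) $|E\cap\mathbb H^n_+|=|E\cap\mathbb H^n_-|$; (ii) there are $R>0$ and functions $u,v:\overline B(0,R)\to[0,\infty)$ in $C^2(B(0,R))\cap C(\overline B(0,R))$, vanishing on $\partial B(0,R)$, such that $\partial E\cap\mathbb H^n_+=\{(z,t)\in\mathbb H^n_+:|z|<R,\ t=u(z)\}$ and $\partial E\cap\mathbb H^n_-=\{(z,t)\in\mathbb H^n_-:|z|<R,\ t=-v(z)\}$; (iii) $u$ and $v$ have no common zero in $B(0,R)$. Let $\tilde{\mathcal E}$ be the class of the sets $\delta_\lambda(L_g(E))$ with $E\in\mathcal E$, $\lambda>0$ and $g\in\mathbb H^n$. Then $$|E|^{\frac{Q-1}{Q}}\le C_Q\,P_H(E;\mathbb H^n)\qquad\text{for all }E\in\tilde{\mathcal E},$$ where $$C_Q=\frac{(Q-1)\,\Gamma\left(\frac Q2\right)^{\frac2Q}}{Q^{\frac{Q-1}{Q}}\,(Q-2)\,\Gamma\left(\frac{Q+1}{2}\right)^{\frac1Q}\,\pi^{\frac{Q-1}{2Q}}}.$$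 Moreover, a set $E$ belongs to $\tilde{\mathcal E}$ and satisfies equality if and only if $E=L_g(\delta_\lambda(E_o))$ for some $\lambda>0$ and $g\in\mathbb H^n$, where $$E_o=\{(z,t):|z|<1,\ |t|<u_o(z)\},\qquad u_o(z)=\frac\pi8+\frac{|z|}{4}\sqrt{1-|z|^2}-\frac14\arcsin|z|.$$ -/

import Mathlib

open MeasureTheory

noncomputable section

namespace Heisenberg

/-- The horizontal layer `ℝ²ⁿ` with its Euclidean norm. A point `z = (x, y)` has coordinates
`x i = z (Sum.inl i)` and `y i = z (Sum.inr i)`. -/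
abbrev Plane (n : ℕ) : Type := EuclideanSpace ℝ (Fin n ⊕ Fin n)

/-- The underlying manifold `ℝ²ⁿ⁺¹ = ℝ²ⁿ × ℝ` of the Heisenberg group, with points `(z, t)`.
It carries the product topology, and `volume` is Lebesgue measure `dz dt`. -/
abbrev Point (n : ℕ) : Type := Plane n × ℝ

/-- The homogeneous dimension `Q = 2n + 2`. -/
def homDim (n : ℕ) : ℕ := 2 * n + 2

/-- The group law
`(x, y, t) (x', y', t') = (x + x', y + y', t + t' + (⟨x, y'⟩ - ⟨x', y⟩) / 2)`;
`leftTranslation g` is the map `L_g`. -/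
def leftTranslation {n : ℕ} (g g' : Point n) : Point n :=
  (g.1 + g'.1,
    g.2 + g'.2 + (1 / 2) * ((∑ i, g.1 (Sum.inl i) * g'.1 (Sum.inr i)) -
      ∑ i, g'.1 (Sum.inl i) * g.1 (Sum.inr i)))

/-- The non-isotropic dilation `δ_lam (z, t) = (lam z, lam² t)`. -/
def dilation {n : ℕ} (lam : ℝ) (g : Point n) : Point n :=
  (lam • g.1, lam ^ 2 * g.2)

/-- The `∂/∂t`-coefficient of the horizontal left-invariant fields:
`X_i = ∂/∂x_i - (y_i / 2) ∂/∂t` and `X_{n+i} = ∂/∂y_i + (x_i / 2) ∂/∂t`. -/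
def verticalCoeff {n : ℕ} (z : Plane n) : Fin n ⊕ Fin n → ℝ
  | Sum.inl i => -(z (Sum.inr i)) / 2
  | Sum.inr i => z (Sum.inl i) / 2

/-- The left-invariant vector field `X_j` at the point `g`. -/
def horizontalField {n : ℕ} (j : Fin n ⊕ Fin n) (g : Point n) : Point n :=
  (EuclideanSpace.single j 1, verticalCoeff g.1 j)

/-- The horizontal divergence `div_H ζ = ∑ X_j ζ_j` of `ζ = ∑ ζ_j X_j`. -/
def divH {n : ℕ} (ζ : Fin n ⊕ Fin n → Point n → ℝ) (g : Point n) : ℝ :=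
  ∑ j, fderiv ℝ (ζ j) g (horizontalField j g)

/-- The components of the compactly supported horizontal `C¹` fields `ζ = ∑ ζ_j X_j` with
`∑ ζ_j² ≤ 1` everywhere. -/
def testFields (n : ℕ) : Set (Fin n ⊕ Fin n → Point n → ℝ) :=
  {ζ | (∀ j, ContDiff ℝ 1 (ζ j)) ∧ (∀ j, HasCompactSupport (ζ j)) ∧
    ∀ g, ∑ j, ζ j g ^ 2 ≤ 1}

/-- The `H`-perimeter `P_H(E; ℍⁿ)`: the supremum of `∫_E div_H ζ` over the test fields, with
values in `[0, ∞]`. (The zero field is a test field, so cutting off negative values of the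
integrals does not change the supremum.) -/
def perimeterH {n : ℕ} (E : Set (Point n)) : ENNReal :=
  ⨆ ζ ∈ testFields n, ENNReal.ofReal (∫ g in E, divH ζ g)

/-- The open half-space `ℍⁿ₊ = {t > 0}`. -/
def upperHalf (n : ℕ) : Set (Point n) := {g | 0 < g.2}

/-- The open half-space `ℍⁿ₋ = {t < 0}`. -/
def lowerHalf (n : ℕ) : Set (Point n) := {g | g.2 < 0}

/-- The conditions on one of the two functions that describe the boundary: it is nonnegative and
continuous on the closed ball, `C²` in the open ball, and zero on the sphere. -/
structure IsProfile {n : ℕ} (R : ℝ) (u : Plane n → ℝ) : Prop where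
  nonneg : ∀ z ∈ Metric.closedBall (0 : Plane n) R, 0 ≤ u z
  contDiffOn : ContDiffOn ℝ 2 u (Metric.ball (0 : Plane n) R)
  continuousOn : ContinuousOn u (Metric.closedBall (0 : Plane n) R)
  eq_zero : ∀ z ∈ Metric.sphere (0 : Plane n) R, u z = 0

/-- The class `𝓔`. Its members are bounded domains, lying locally on one side of their boundary:
bounded open sets equal to the interior of their closure. Connectedness follows from the other
conditions. -/
structure IsAdmissible {n : ℕ} (E : Set (Point n)) : Prop where
  isOpen : IsOpen E
  isBounded : Bornology.IsBounded E
  interior_closure : interior (closure E) = E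
  volume_eq : volume (E ∩ upperHalf n) = volume (E ∩ lowerHalf n)
  exists_profiles : ∃ R : ℝ, 0 < R ∧ ∃ u v : Plane n → ℝ, IsProfile R u ∧ IsProfile R v ∧
    frontier E ∩ upperHalf n =
      {g | g ∈ upperHalf n ∧ g.1 ∈ Metric.ball (0 : Plane n) R ∧ g.2 = u g.1} ∧
    frontier E ∩ lowerHalf n =
      {g | g ∈ lowerHalf n ∧ g.1 ∈ Metric.ball (0 : Plane n) R ∧ g.2 = -v g.1} ∧
    {z ∈ Metric.ball (0 : Plane n) R | u z = 0} ∩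
      {z ∈ Metric.ball (0 : Plane n) R | v z = 0} = ∅

/-- The class `𝓔̃` of the sets `δ_lam (L_g F)` with `F ∈ 𝓔`, `lam > 0` and `g ∈ ℍⁿ`. -/
def admissibleOrbit (n : ℕ) : Set (Set (Point n)) :=
  {E | ∃ F : Set (Point n), IsAdmissible F ∧ ∃ lam : ℝ, 0 < lam ∧ ∃ g : Point n,
    E = dilation lam '' (leftTranslation g '' F)}

/-- The profile `u_o(z) = π/8 + (|z|/4) √(1 - |z|²) - (1/4) arcsin |z|`, for `|z| ≤ 1`. -/
def profile {n : ℕ} (z : Plane n) : ℝ :=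
  Real.pi / 8 + ‖z‖ / 4 * Real.sqrt (1 - ‖z‖ ^ 2) - 1 / 4 * Real.arcsin ‖z‖

/-- The set `E_o`, bounded by the graphs `t = ± u_o(z)` over the unit ball. -/
def isoperimetricSet (n : ℕ) : Set (Point n) :=
  {g | ‖g.1‖ < 1 ∧ |g.2| < profile g.1}

/-- The constant `C_Q`. -/
def isoConst (Q : ℝ) : ℝ :=
  ((Q - 1) * Real.Gamma (Q / 2) ^ (2 / Q)) /
    (Q ^ ((Q - 1) / Q) * (Q - 2) * Real.Gamma ((Q + 1) / 2) ^ (1 / Q) *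
      Real.pi ^ ((Q - 1) / (2 * Q)))

end Heisenberg

end

open MeasureTheory

noncomputable section

namespace Heisenberg

/-! The proof is a calibration. Dilations multiply |E|^((Q-1)/Q) and P_H by the same power and left
translations preserve both, so E may be taken to be the region between the graphs of -v and u over
the unit ball (`IsLens 1 u v E`). Write J(x, y) = (-y, x). The flux density of a horizontal field Z
through the graph of b is ⟨Z, Jz/2 - ∇b⟩. Use Z = z + aJz on the upper graph and Z = z - aJz on the
lower one, with a = √((1-|z|²)/|z|²), which makes both unit fields.

The radial part z has divergence 2n and contributes 2n|E|. The rotational part aJz is divergence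
free in the plane, so its pairings with ∇u and ∇v integrate to zero (`integral_fderiv_cutField`);
the two graphs together leave the number D = ∫ |z| √(1-|z|²) over the unit ball (`discFlux`), which
does not depend on u or v. Interpolating between the graphs and truncating near 0 and the sphere
gives P_H(E) ≥ 2n|E| + D (`IsLens.ofReal_le_perimeterH`, `IsLens.calibration`). Because (Q-1)D =
(Q-2)|E_o|, the right side times C_Q is the tangent line at |E_o| of the concave function V ↦
V^((Q-1)/Q), and the inequality follows (`rpow_le_isoConst_mul`).

In the equality case the affine bound is attained, so no perturbation of the calibrating fields can
increase the flux. Hence the horizontal normals of the two graphs are parallel to z ± aJz, and this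
is a first order equation for u and for v along circular arcs from the origin to the unit sphere
(`IsLens.fderiv_leafTangent`). Integrating it back from the sphere, where u and v vanish, gives u =
v = u_o (`eq_profile_of_fderiv_leafTangent`).

Conversely, Cauchy-Schwarz on the graphs of ±u_o, approached from inside because ∇u_o blows up at
the sphere, gives P_H(E_o) ≤ ∫ |z|/√(1-|z|²). Polar coordinates and Wallis integrals identify this
with 2n|E_o| + D and evaluate |E_o| by Gamma functions. -/

/-! ### The complex structure of the horizontal layer -/

/-- The complex structure `J (x, y) = (-y, x)`. -/
def rotJ (n : ℕ) : Plane n →L[ℝ] Plane n :=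
  LinearMap.toContinuousLinearMap
    { toFun := fun z => WithLp.toLp 2 (fun j => 2 * verticalCoeff z j)
      map_add' := fun z w => by
        ext j; cases j <;> simp [verticalCoeff] <;> ring
      map_smul' := fun c z => by
        ext j; cases j <;> simp [verticalCoeff] <;> ring }

theorem rotJ_apply {n : ℕ} (z : Plane n) (j : Fin n ⊕ Fin n) :
    rotJ n z j = 2 * verticalCoeff z j := rfl

attribute [irreducible] rotJ

@[simp] theorem rotJ_inl {n : ℕ} (z : Plane n) (i : Fin n) :
    rotJ n z (Sum.inl i) = -z (Sum.inr i) := by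
  rw [rotJ_apply]; simp [verticalCoeff]; ring

@[simp] theorem rotJ_inr {n : ℕ} (z : Plane n) (i : Fin n) :
    rotJ n z (Sum.inr i) = z (Sum.inl i) := by
  rw [rotJ_apply]; simp [verticalCoeff]; ring

theorem verticalCoeff_eq {n : ℕ} (z : Plane n) (j : Fin n ⊕ Fin n) :
    verticalCoeff z j = rotJ n z j / 2 := by rw [rotJ_apply]; ring

theorem inner_eq_sum {n : ℕ} (z w : Plane n) : inner ℝ z w = ∑ j, z j * w j := by
  simp [PiLp.inner_apply, mul_comm]

@[simp] theorem rotJ_rotJ {n : ℕ} (z : Plane n) : rotJ n (rotJ n z) = -z := by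
  ext j; cases j <;> simp

theorem inner_rotJ_left {n : ℕ} (z w : Plane n) :
    inner ℝ (rotJ n z) w = -inner ℝ z (rotJ n w) := by
  simp only [inner_eq_sum, Fintype.sum_sum_type, rotJ_inl, rotJ_inr, neg_mul, mul_neg,
    Finset.sum_neg_distrib]
  ring

@[simp] theorem inner_self_rotJ {n : ℕ} (z : Plane n) : inner ℝ z (rotJ n z) = 0 := by
  have := inner_rotJ_left z z
  rw [real_inner_comm] at this; linarith

@[simp] theorem inner_rotJ_self {n : ℕ} (z : Plane n) : inner ℝ (rotJ n z) z = 0 := by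
  rw [real_inner_comm]; simp

@[simp] theorem inner_rotJ_rotJ {n : ℕ} (z w : Plane n) :
    inner ℝ (rotJ n z) (rotJ n w) = inner ℝ z w := by
  rw [inner_rotJ_left]; simp

@[simp] theorem norm_rotJ {n : ℕ} (z : Plane n) : ‖rotJ n z‖ = ‖z‖ := by
  have : ‖rotJ n z‖ ^ 2 = ‖z‖ ^ 2 := by
    rw [← real_inner_self_eq_norm_sq, ← real_inner_self_eq_norm_sq, inner_rotJ_rotJ]
  exact (sq_eq_sq₀ (norm_nonneg _) (norm_nonneg _)).1 this

/-- The coordinate vectors of the horizontal layer. -/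
abbrev basisVec {n : ℕ} (j : Fin n ⊕ Fin n) : Plane n := EuclideanSpace.single j 1

@[simp] theorem rotJ_basisVec_self {n : ℕ} (j : Fin n ⊕ Fin n) :
    rotJ n (basisVec j) j = 0 := by
  cases j <;> simp

theorem sum_smul_basisVec {n : ℕ} (z : Plane n) : ∑ j, z j • basisVec j = z := by
  ext i; cases i <;> simp [Pi.single_apply]

theorem sum_mul_clm_basisVec {n : ℕ} (z : Plane n) (l : Plane n →L[ℝ] ℝ) :
    ∑ j, z j * l (basisVec j) = l z := by
  conv_rhs => rw [← sum_smul_basisVec z]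
  simp [map_sum]

/-! ### The divergence theorem on subgraphs -/

theorem integral_fderiv_apply_eq_zero {n : ℕ} {f : Plane n → ℝ} (hf : ContDiff ℝ 1 f)
    (hc : HasCompactSupport f) (e : Plane n) : ∫ z, fderiv ℝ f z e = 0 := by
  have h := integral_mul_fderiv_eq_neg_fderiv_mul_of_integrable (𝕜 := ℝ) (μ := volume)
    (f := fun _ : Plane n => (1 : ℝ)) (g := f) (v := e) (by simp) (by
      simp only [one_mul]
      exact Continuous.integrable_of_hasCompactSupport
        ((hf.continuous_fderiv one_ne_zero).clm_apply continuous_const)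
        (hc.fderiv_apply (𝕜 := ℝ) e)) (by
      simpa using hf.continuous.integrable_of_hasCompactSupport hc)
      (fun _ _ => differentiableAt_const _) (fun _ _ => hf.differentiable one_ne_zero _)
  simpa using h

/-- The vertical shear along the graph of `b`. -/
def graphShear {n : ℕ} {b : Plane n → ℝ} (hb : Continuous b) : Point n ≃ₜ Point n where
  toFun g := (g.1, g.2 + b g.1)
  invFun g := (g.1, g.2 - b g.1)
  left_inv g := by simp
  right_inv g := by simp
  continuous_toFun := by fun_prop
  continuous_invFun := by fun_prop

theorem measurableSet_subgraph {n : ℕ} {b : Plane n → ℝ} (hb : Continuous b) :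
    MeasurableSet {g : Point n | g.2 ≤ b g.1} :=
  measurableSet_le measurable_snd (hb.measurable.comp measurable_fst)

theorem setIntegral_subgraph {n : ℕ} {F : Point n → ℝ} (hF : Integrable F) {b : Plane n → ℝ}
    (hb : Continuous b) :
    ∫ g in {g : Point n | g.2 ≤ b g.1}, F g = ∫ z, ∫ s in Set.Iic 0, F (z, s + b z) := by
  rw [← integral_indicator (measurableSet_subgraph hb), Measure.volume_eq_prod,
    integral_prod]
  · refine integral_congr_ae (Filter.Eventually.of_forall fun z => ?_)
    simp only
    rw [← integral_indicator measurableSet_Iic]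
    rw [← integral_add_right_eq_self _ (b z)]
    refine integral_congr_ae (Filter.Eventually.of_forall fun s => ?_)
    by_cases h : s ≤ 0 <;> simp [Set.indicator, h]
  · exact hF.indicator (measurableSet_subgraph hb)

/-- Shearing the graph flat replaces `f` by `η (z, s) = f (z, s + b z)` and splits the derivative
along `(e, c)` as ∂_e η + (c - ∂_e b) ∂_s η. The first term integrates to zero over every horizontal
slice; the second integrates over s ≤ 0 to the value of `f` on the graph. -/
theorem setIntegral_subgraph_fderiv {n : ℕ} {f : Point n → ℝ} (hf : ContDiff ℝ 1 f)
    (hc : HasCompactSupport f) {b : Plane n → ℝ} (hb : ContDiff ℝ 1 b) (e : Plane n)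
    {c : Plane n → ℝ} (hcc : Continuous c) :
    ∫ g in {g : Point n | g.2 ≤ b g.1}, fderiv ℝ f g (e, c g.1) =
      ∫ z, f (z, b z) * (c z - fderiv ℝ b z e) := by
  set η : Point n → ℝ := fun g => f (g.1, g.2 + b g.1) with hη
  have hηC : ContDiff ℝ 1 η := by
    have : ContDiff ℝ 1 (fun g : Point n => (g.1, g.2 + b g.1)) := by fun_prop
    exact hf.comp this
  have hηc : HasCompactSupport η := hc.comp_homeomorph (graphShear hb.continuous)
  have hS : ∀ g : Point n, ∀ w : Point n,
      fderiv ℝ η g w = fderiv ℝ f (g.1, g.2 + b g.1) (w.1, w.2 + fderiv ℝ b g.1 w.1) := by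
    intro g w
    have h1 : HasFDerivAt (fun g : Point n => (g.1, g.2 + b g.1))
        ((ContinuousLinearMap.fst ℝ _ _).prod ((ContinuousLinearMap.snd ℝ _ _) +
          (fderiv ℝ b g.1).comp (ContinuousLinearMap.fst ℝ _ _))) g := by
      have h2 := (hb.differentiable one_ne_zero g.1).hasFDerivAt.comp g
        (hasFDerivAt_fst (𝕜 := ℝ) (p := g))
      exact hasFDerivAt_fst.prodMk (hasFDerivAt_snd.add h2)
    have h3 := ((hf.differentiable one_ne_zero (g.1, g.2 + b g.1)).hasFDerivAt.comp g h1).fderiv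
    have h4 : fderiv ℝ η g = _ := h3
    rw [h4]; rfl
  have hfd : Continuous (fderiv ℝ f) := hf.continuous_fderiv one_ne_zero
  have hηd : Continuous (fderiv ℝ η) := hηC.continuous_fderiv one_ne_zero
  have hint : Integrable (fun g : Point n => fderiv ℝ f g (e, c g.1)) := by
    refine Continuous.integrable_of_hasCompactSupport (hfd.clm_apply (by fun_prop)) ?_
    refine (hc.fderiv (𝕜 := ℝ)).mono ?_
    intro g hg h0
    simp at hg
    simp [h0] at hg
  rw [setIntegral_subgraph hint hb.continuous]
  have hEint : Integrable (fun g : Point n => fderiv ℝ η g (e, 0)) :=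
    Continuous.integrable_of_hasCompactSupport (hηd.clm_apply continuous_const)
      (hηc.fderiv_apply (𝕜 := ℝ) _)
  have hTint : Integrable (fun g : Point n => fderiv ℝ η g (0, 1)) :=
    Continuous.integrable_of_hasCompactSupport (hηd.clm_apply continuous_const)
      (hηc.fderiv_apply (𝕜 := ℝ) _)
  have hslice : ∀ (z : Plane n), Continuous (fun s : ℝ => ((z, s) : Point n)) := by
    intro z; fun_prop
  have hcl : ∀ z : Plane n, Topology.IsClosedEmbedding (fun s : ℝ => ((z, s) : Point n)) :=
    fun z => Topology.IsClosedEmbedding.of_continuous_injective_isClosedMap (hslice z)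
      (fun a b h => by simpa using h) (by
        intro C hC
        have : (fun s : ℝ => ((z, s) : Point n)) '' C = {z} ×ˢ C := by
          ext ⟨p, q⟩; simp [eq_comm, and_comm]
        rw [this]; exact isClosed_singleton.prod hC)
  have hsint : ∀ (w : Point n) (z : Plane n),
      Integrable (fun s : ℝ => fderiv ℝ η (z, s) w) := fun w z =>
    Continuous.integrable_of_hasCompactSupport
      ((hηd.clm_apply continuous_const).comp (hslice z))
      ((hηc.fderiv_apply (𝕜 := ℝ) w).comp_isClosedEmbedding (hcl z))
  have hline : ∀ z, ∫ s in Set.Iic 0, fderiv ℝ η (z, s) (0, 1) = f (z, b z) := by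
    intro z
    have h1 : ∀ s : ℝ, HasDerivAt (fun s : ℝ => η (z, s)) (fderiv ℝ η (z, s) (0, 1)) s := by
      intro s
      have := (hηC.differentiable one_ne_zero (z, s)).hasFDerivAt.comp_hasDerivAt s
        ((hasDerivAt_const s z).prodMk (hasDerivAt_id s))
      exact this
    have h2 := HasCompactSupport.integral_Iic_deriv_eq (f := fun s : ℝ => η (z, s))
      (hηC.comp (by fun_prop)) (hηc.comp_isClosedEmbedding (hcl z)) 0
    simp only [(h1 _).deriv] at h2
    rw [h2]; simp [hη]
  have key : ∀ z, ∫ s in Set.Iic 0, fderiv ℝ f (z, s + b z) (e, c z) =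
      (∫ s in Set.Iic 0, fderiv ℝ η (z, s) (e, 0)) + f (z, b z) * (c z - fderiv ℝ b z e) := by
    intro z
    rw [← hline z, ← integral_mul_const, ← integral_add]
    · refine integral_congr_ae (Filter.Eventually.of_forall fun s => ?_)
      simp only [hS]
      rw [mul_comm, ← smul_eq_mul, ← map_smul, ← map_add]
      congr 1
      simp
    · exact (hsint _ z).integrableOn
    · exact ((hsint _ z).integrableOn).mul_const _
  simp only [key]
  have hrestr : Integrable (fun g : Point n => fderiv ℝ η g (e, 0))
      ((volume : Measure (Plane n)).prod (volume.restrict (Set.Iic (0:ℝ)))) := by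
    have := hEint.integrableOn (s := Set.univ ×ˢ Set.Iic (0:ℝ))
    rwa [IntegrableOn, Measure.volume_eq_prod, ← Measure.prod_restrict,
      Measure.restrict_univ] at this
  rw [integral_add]
  · rw [integral_integral_swap (f := fun z s => fderiv ℝ η (z, s) (e, 0)) hrestr]
    have : ∀ s : ℝ, ∫ z, fderiv ℝ η (z, s) (e, 0) = 0 := by
      intro s
      have hcl' : Topology.IsClosedEmbedding (fun z : Plane n => ((z, s) : Point n)) :=
        Topology.IsClosedEmbedding.of_continuous_injective_isClosedMap (by fun_prop)
        (fun a b h => by simpa using h) (by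
          intro C hC
          have : (fun z : Plane n => ((z, s) : Point n)) '' C = C ×ˢ {s} := by
            ext ⟨p, q⟩; simp [eq_comm]
          rw [this]; exact hC.prod isClosed_singleton)
      have h2 := integral_fderiv_apply_eq_zero (f := fun z : Plane n => η (z, s))
        (hηC.comp (by fun_prop)) (hηc.comp_isClosedEmbedding hcl') e
      refine Eq.trans (integral_congr_ae (Filter.Eventually.of_forall fun z => ?_)) h2
      have h3 := HasFDerivAt.fderiv (HasFDerivAt.comp (f := fun z : Plane n => ((z, s) : Point n)) z
        (hηC.differentiable one_ne_zero (z, s)).hasFDerivAt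
        ((hasFDerivAt_id z).prodMk (hasFDerivAt_const s z)))
      have h4 : fderiv ℝ (fun z : Plane n => η (z, s)) z = _ := h3
      simp only [h4]
      rfl
    simp [this]
  · exact hrestr.integral_prod_left
  · refine Continuous.integrable_of_hasCompactSupport ?_ ?_
    · have := hf.continuous
      have := hb.continuous
      have := hb.continuous_fderiv one_ne_zero
      fun_prop
    · have hcl2 : Topology.IsClosedEmbedding (fun z : Plane n => ((z, b z) : Point n)) :=
        Topology.IsClosedEmbedding.of_continuous_injective_isClosedMap
          (continuous_id.prodMk hb.continuous) (fun a b h => by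
            simp only [Prod.mk.injEq] at h; exact h.1) (by
          intro C hC
          have : (fun z : Plane n => ((z, b z) : Point n)) '' C =
              {g : Point n | g.1 ∈ C ∧ g.2 = b g.1} := by
            ext ⟨p, q⟩
            simp only [Set.mem_image, Prod.mk.injEq, Set.mem_ofPred_eq]
            constructor
            · rintro ⟨x, hx, rfl, rfl⟩; exact ⟨hx, rfl⟩
            · rintro ⟨h1, h2⟩; exact ⟨p, h1, rfl, h2.symm⟩
          rw [this]
          exact (hC.preimage continuous_fst).inter
            (isClosed_eq continuous_snd (hb.continuous.comp continuous_fst)))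
      exact (hc.comp_isClosedEmbedding hcl2).mul_right

theorem integrable_divH {n : ℕ} {ζ : Fin n ⊕ Fin n → Point n → ℝ}
    (hζ : ∀ j, ContDiff ℝ 1 (ζ j)) (hc : ∀ j, HasCompactSupport (ζ j)) (j : Fin n ⊕ Fin n) :
    Integrable (fun g => fderiv ℝ (ζ j) g (horizontalField j g)) := by
  have hfd : Continuous (fderiv ℝ (ζ j)) := (hζ j).continuous_fderiv one_ne_zero
  have hh : Continuous (fun g : Point n => horizontalField j g) := by
    unfold horizontalField
    simp only [verticalCoeff_eq]
    fun_prop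
  refine Continuous.integrable_of_hasCompactSupport (hfd.clm_apply hh) ?_
  refine ((hc j).fderiv (𝕜 := ℝ)).mono ?_
  intro g hg h0
  simp at hg
  simp [h0] at hg

theorem integrable_divH' {n : ℕ} {ζ : Fin n ⊕ Fin n → Point n → ℝ}
    (hζ : ∀ j, ContDiff ℝ 1 (ζ j)) (hc : ∀ j, HasCompactSupport (ζ j)) :
    Integrable (divH ζ) :=
  integrable_finsetSum _ fun j _ => integrable_divH hζ hc j

theorem integrable_comp_graph {n : ℕ} {f : Point n → ℝ} (hf : Continuous f)
    (hc : HasCompactSupport f) {b : Plane n → ℝ} (hb : Continuous b) {k : Plane n → ℝ}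
    (hk : Continuous k) : Integrable (fun z => f (z, b z) * k z) := by
  refine Continuous.integrable_of_hasCompactSupport (by fun_prop) ?_
  have hK : IsCompact (Prod.fst '' tsupport f) := hc.isCompact.image continuous_fst
  refine HasCompactSupport.intro hK ?_
  intro z hz
  have : f (z, b z) = 0 := by
    by_contra h
    exact hz ⟨(z, b z), subset_tsupport _ h, rfl⟩
  simp [this]

/-- The vertical coefficient of X_j is (Jz)_j / 2, so the graph of `b` has the unnormalised
horizontal normal Jz/2 - ∇b. -/
theorem setIntegral_subgraph_divH {n : ℕ} {ζ : Fin n ⊕ Fin n → Point n → ℝ}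
    (hζ : ∀ j, ContDiff ℝ 1 (ζ j)) (hc : ∀ j, HasCompactSupport (ζ j)) {b : Plane n → ℝ}
    (hb : ContDiff ℝ 1 b) :
    ∫ g in {g : Point n | g.2 ≤ b g.1}, divH ζ g =
      ∫ z, ∑ j, ζ j (z, b z) * (rotJ n z j / 2 - fderiv ℝ b z (basisVec j)) := by
  unfold divH
  rw [integral_finsetSum _ fun j _ => (integrable_divH hζ hc j).integrableOn,
    integral_finsetSum]
  · refine Finset.sum_congr rfl fun j _ => ?_
    have := setIntegral_subgraph_fderiv (hζ j) (hc j) hb (basisVec j)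
      (c := fun z => rotJ n z j / 2) (by fun_prop)
    rw [← this]
    refine integral_congr_ae (Filter.Eventually.of_forall fun g => ?_)
    simp only [horizontalField, verticalCoeff_eq]
  · intro j _
    have := hb.continuous_fderiv one_ne_zero
    exact integrable_comp_graph (hζ j).continuous (hc j) hb.continuous (by fun_prop)

/-! ### Left translations and dilations -/

theorem leftTranslation_eq {n : ℕ} (g g' : Point n) :
    leftTranslation g g' =
      (g.1 + g'.1, g.2 + g'.2 + 1 / 2 * inner ℝ (rotJ n g.1) g'.1) := by
  unfold leftTranslation
  simp only [inner_eq_sum, Fintype.sum_sum_type, rotJ_inl, rotJ_inr, neg_mul,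
    Finset.sum_neg_distrib]
  ext1
  · rfl
  · simp only
    congr 2
    rw [sub_eq_add_neg, add_comm]
    congr 2
    exact Finset.sum_congr rfl fun i _ => mul_comm _ _

/-- Left translation as a homeomorphism. -/
def leftHomeo {n : ℕ} (g : Point n) : Point n ≃ₜ Point n where
  toFun := leftTranslation g
  invFun := leftTranslation (-g)
  left_inv g' := by
    simp only [leftTranslation_eq]
    ext1
    · simp
    · simp [inner_add_right, map_neg]; ring
  right_inv g' := by
    simp only [leftTranslation_eq]
    ext1
    · simp
    · simp [inner_add_right, map_neg]; ring
  continuous_toFun := by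
    simp only [funext (leftTranslation_eq g)]; fun_prop
  continuous_invFun := by
    simp only [funext (leftTranslation_eq (-g))]; fun_prop

@[simp] theorem leftHomeo_apply {n : ℕ} (g g' : Point n) :
    leftHomeo g g' = leftTranslation g g' := rfl

/-- Dilation as a homeomorphism. -/
def dilationHomeo {n : ℕ} (lam : ℝ) (h : lam ≠ 0) : Point n ≃ₜ Point n where
  toFun := dilation lam
  invFun := dilation lam⁻¹
  left_inv g := by
    simp only [dilation]
    ext1
    · simp [smul_smul, h]
    · simp only; field_simp
  right_inv g := by
    simp only [dilation]
    ext1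
    · simp [smul_smul, h]
    · simp only; field_simp
  continuous_toFun := by unfold dilation; fun_prop
  continuous_invFun := by unfold dilation; fun_prop

@[simp] theorem dilationHomeo_apply {n : ℕ} (lam : ℝ) (h : lam ≠ 0) (g : Point n) :
    dilationHomeo lam h g = dilation lam g := rfl

theorem dilation_leftTranslation {n : ℕ} (lam : ℝ) (g g' : Point n) :
    dilation lam (leftTranslation g g') =
      leftTranslation (dilation lam g) (dilation lam g') := by
  simp only [leftTranslation_eq, dilation, smul_add, map_smul, real_inner_smul_left,
    real_inner_smul_right]
  ext1
  · rfl
  · simp only; ring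

/-- Composition with `Φ` sends test fields to test fields and multiplies the horizontal divergence
by `l`, while the change of variables costs `k`. Applied to a map and to its inverse, this gives the
exact behaviour under translations and dilations. -/
theorem perimeterH_image_le {n : ℕ} (Φ : Point n ≃ₜ Point n) (hΦ : ContDiff ℝ 1 Φ) {k l : ℝ}
    (hk : 0 < k) (hl : 0 < l)
    (hμ : (volume : Measure (Point n)) = ENNReal.ofReal k • volume.map Φ)
    (hX : ∀ j g, fderiv ℝ Φ g (horizontalField j g) = l • horizontalField j (Φ g))
    (E : Set (Point n)) :
    perimeterH (Φ '' E) ≤ ENNReal.ofReal (k / l) * perimeterH E := by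
  refine iSup₂_le fun ζ hζ => ?_
  have hdiv : ∀ g, divH (fun j => ζ j ∘ Φ) g = l * divH ζ (Φ g) := by
    intro g
    unfold divH
    rw [Finset.mul_sum]
    refine Finset.sum_congr rfl fun j _ => ?_
    rw [fderiv_comp g ((hζ.1 j).differentiable one_ne_zero _) (hΦ.differentiable one_ne_zero _)]
    rw [ContinuousLinearMap.comp_apply, hX, map_smul, smul_eq_mul]
  have hmem : (fun j => ζ j ∘ Φ) ∈ testFields n :=
    ⟨fun j => (hζ.1 j).comp hΦ, fun j => (hζ.2.1 j).comp_homeomorph Φ, fun g => hζ.2.2 (Φ g)⟩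
  have hint : ∫ g in Φ '' E, divH ζ g = k / l * ∫ g in E, divH (fun j => ζ j ∘ Φ) g := by
    conv_lhs => rw [hμ]
    rw [Measure.restrict_smul, integral_smul_measure,
      Φ.measurableEmbedding.setIntegral_map, Φ.injective.preimage_image]
    simp only [hdiv]
    rw [integral_const_mul, ENNReal.toReal_ofReal hk.le, smul_eq_mul]
    field_simp
  rw [hint, ENNReal.ofReal_mul (by positivity)]
  gcongr
  exact le_iSup₂ (f := fun ζ (_ : ζ ∈ testFields n) =>
    ENNReal.ofReal (∫ g in E, divH ζ g)) _ hmem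

theorem volume_image_eq {n : ℕ} (Φ : Point n ≃ₜ Point n) {k : ℝ}
    (hμ : (volume : Measure (Point n)) = ENNReal.ofReal k • volume.map Φ) (E : Set (Point n)) :
    volume (Φ '' E) = ENNReal.ofReal k * volume E := by
  conv_lhs => rw [hμ]
  rw [Measure.smul_apply, smul_eq_mul, Φ.measurableEmbedding.map_apply,
    Φ.injective.preimage_image]

theorem volume_map_leftTranslation {n : ℕ} (g : Point n) :
    (volume : Measure (Point n)) = ENNReal.ofReal 1 • volume.map (leftHomeo g) := by
  have h1 : MeasurePreserving (fun z : Plane n => g.1 + z) volume volume :=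
    measurePreserving_add_left _ _
  have h2 := h1.skew_product (μc := (volume : Measure ℝ)) (μd := volume)
    (g := fun z t => g.2 + t + 1 / 2 * inner ℝ (rotJ n g.1) z) (by fun_prop)
    (Filter.Eventually.of_forall fun z => by
      have : (fun t : ℝ => g.2 + t + 1 / 2 * inner ℝ (rotJ n g.1) z) =
        fun t => (g.2 + 1 / 2 * inner ℝ (rotJ n g.1) z) + t := by ext t; ring
      rw [this]
      exact map_add_left_eq_self _ _)
  have h3 : (leftHomeo g : Point n → Point n) =
      fun p => (g.1 + p.1, g.2 + p.2 + 1 / 2 * inner ℝ (rotJ n g.1) p.1) := by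
    ext1 p; exact leftTranslation_eq g p
  rw [h3, ENNReal.ofReal_one, one_smul]
  exact h2.map_eq.symm

theorem volume_map_dilation {n : ℕ} {lam : ℝ} (h : 0 < lam) :
    (volume : Measure (Point n)) =
      ENNReal.ofReal (lam ^ homDim n) • volume.map (dilationHomeo lam h.ne') := by
  have h3 : (dilationHomeo lam h.ne' : Point n → Point n) =
      Prod.map (fun z => lam • z) (fun t => lam ^ 2 • t) := by
    ext1 p; rfl
  rw [h3, Measure.volume_eq_prod, ← Measure.map_prod_map _ _ (by fun_prop) (by fun_prop),
    Measure.map_addHaar_smul _ h.ne', Measure.map_addHaar_smul _ (by positivity),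
    Measure.prod_smul_left, Measure.prod_smul_right, smul_smul, smul_smul]
  rw [← ENNReal.ofReal_mul (by positivity), ← ENNReal.ofReal_mul (by positivity)]
  have : lam ^ homDim n * |(lam ^ Module.finrank ℝ (Plane n))⁻¹| *
      |((lam ^ 2) ^ Module.finrank ℝ ℝ)⁻¹| = 1 := by
    rw [abs_of_pos (by positivity), abs_of_pos (by positivity)]
    simp [homDim, pow_add, pow_mul, mul_comm 2 n, ← two_mul]
    field_simp
  rw [this]; simp

theorem fderiv_leftTranslation {n : ℕ} (g p : Point n) (w : Point n) :
    fderiv ℝ (leftHomeo g) p w = (w.1, w.2 + 1 / 2 * inner ℝ (rotJ n g.1) w.1) := by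
  have h3 : (leftHomeo g : Point n → Point n) =
      fun p => (g.1 + p.1, g.2 + p.2 + 1 / 2 * inner ℝ (rotJ n g.1) p.1) := by
    ext1 p; exact leftTranslation_eq g p
  have h : HasFDerivAt (leftHomeo g)
      ((ContinuousLinearMap.fst ℝ (Plane n) ℝ).prod (ContinuousLinearMap.snd ℝ (Plane n) ℝ +
        (1 / 2 : ℝ) • (innerSL ℝ (rotJ n g.1)).comp (ContinuousLinearMap.fst ℝ (Plane n) ℝ))) p := by
    rw [h3]
    refine (hasFDerivAt_fst.const_add _).prodMk ((hasFDerivAt_snd.const_add _).add ?_)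
    exact (((innerSL ℝ (rotJ n g.1)).hasFDerivAt).comp p hasFDerivAt_fst).const_mul _
  rw [h.fderiv]; simp

theorem contDiff_leftTranslation {n : ℕ} (g : Point n) : ContDiff ℝ 1 (leftHomeo g) := by
  have h3 : (leftHomeo g : Point n → Point n) =
      fun p => (g.1 + p.1, g.2 + p.2 + 1 / 2 * inner ℝ (rotJ n g.1) p.1) := by
    ext1 p; exact leftTranslation_eq g p
  rw [h3]
  have := (innerSL ℝ (rotJ n g.1)).contDiff (n := 1)
  exact (contDiff_const.add contDiff_fst).prodMk ((contDiff_const.add contDiff_snd).add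
    (contDiff_const.mul (this.comp contDiff_fst)))

theorem inner_basisVec {n : ℕ} (z : Plane n) (j : Fin n ⊕ Fin n) :
    inner ℝ z (basisVec j) = z j := by
  simp [EuclideanSpace.inner_single_right]

theorem perimeterH_leftTranslation {n : ℕ} (g : Point n) (E : Set (Point n)) :
    perimeterH (leftTranslation g '' E) = perimeterH E := by
  have key : ∀ (g : Point n) (E : Set (Point n)),
      perimeterH (leftHomeo g '' E) ≤ perimeterH E := by
    intro g E
    have := perimeterH_image_le (leftHomeo g) (contDiff_leftTranslation g) one_pos one_pos
      (volume_map_leftTranslation g) (fun j p => by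
        rw [fderiv_leftTranslation]
        simp only [horizontalField, verticalCoeff_eq, leftHomeo_apply, leftTranslation_eq, one_smul]
        ext1
        · rfl
        · simp only [map_add]
          rw [inner_basisVec]; simp; ring) E
    simpa using this
  refine le_antisymm (key g E) ?_
  have := key (-g) (leftHomeo g '' E)
  rwa [show leftHomeo (-g) '' (leftHomeo g '' E) = E from by
    exact (leftHomeo g).symm_image_image E] at this

theorem volume_leftTranslation {n : ℕ} (g : Point n) (E : Set (Point n)) :
    volume (leftTranslation g '' E) = volume E := by
  have := volume_image_eq (leftHomeo g) (volume_map_leftTranslation g) E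
  rwa [ENNReal.ofReal_one, one_mul] at this

theorem volume_dilation {n : ℕ} {lam : ℝ} (h : 0 < lam) (E : Set (Point n)) :
    volume (dilation lam '' E) = ENNReal.ofReal (lam ^ homDim n) * volume E :=
  volume_image_eq (dilationHomeo lam h.ne') (volume_map_dilation h) E

theorem dilation_inv_image {n : ℕ} {lam : ℝ} (h : 0 < lam) (E : Set (Point n)) :
    dilation lam⁻¹ '' (dilation lam '' E) = E := by
  exact (dilationHomeo lam h.ne').symm_image_image E

/-- Volume scales by lam^Q and each X_j by lam, which leaves the exponent Q - 1 = 2n + 1. -/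
theorem perimeterH_dilation {n : ℕ} {lam : ℝ} (h : 0 < lam) (E : Set (Point n)) :
    perimeterH (dilation lam '' E) =
      ENNReal.ofReal (lam ^ (2 * n + 1)) * perimeterH E := by
  have key : ∀ {lam : ℝ} (_ : 0 < lam) (E : Set (Point n)),
      perimeterH (dilation lam '' E) ≤ ENNReal.ofReal (lam ^ (2 * n + 1)) * perimeterH E := by
    intro lam h E
    have hd : ∀ p w : Point n, fderiv ℝ (dilationHomeo lam h.ne') p w = (lam • w.1, lam ^ 2 * w.2) := by
      intro p w
      have : HasFDerivAt (dilationHomeo lam h.ne')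
          ((lam • ContinuousLinearMap.fst ℝ (Plane n) ℝ).prod
            (lam ^ 2 • ContinuousLinearMap.snd ℝ (Plane n) ℝ)) p :=
        (hasFDerivAt_fst.const_smul lam).prodMk (hasFDerivAt_snd.const_mul (lam ^ 2))
      rw [this.fderiv]; rfl
    have := perimeterH_image_le (dilationHomeo lam h.ne')
      (by
        have : (dilationHomeo lam h.ne' : Point n → Point n) =
          fun p => (lam • p.1, lam ^ 2 * p.2) := rfl
        rw [this]; fun_prop) (pow_pos h (homDim n)) h
      (volume_map_dilation h) (fun j p => by
        rw [hd]
        simp only [horizontalField, verticalCoeff_eq, dilationHomeo_apply, dilation, map_smul]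
        ext1
        · rfl
        · simp; ring) E
    have e : lam ^ homDim n / lam = lam ^ (2 * n + 1) := by
      rw [show homDim n = 2 * n + 1 + 1 from rfl, pow_succ]; field_simp
    rwa [e] at this
  refine le_antisymm (key h E) ?_
  have h2 := key (inv_pos.2 h) (dilation lam '' E)
  rw [dilation_inv_image h] at h2
  calc ENNReal.ofReal (lam ^ (2 * n + 1)) * perimeterH E
      ≤ ENNReal.ofReal (lam ^ (2 * n + 1)) * (ENNReal.ofReal (lam⁻¹ ^ (2 * n + 1)) *
          perimeterH (dilation lam '' E)) := by gcongr
    _ = perimeterH (dilation lam '' E) := by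
      rw [← mul_assoc, ← ENNReal.ofReal_mul (by positivity), inv_pow,
        mul_inv_cancel₀ (by positivity)]
      simp

/-! ### Admissible sets are regions between two graphs -/

/-- The region between the graphs of `-v` and `u` over the ball of radius `R`. -/
structure IsLens {n : ℕ} (R : ℝ) (u v : Plane n → ℝ) (E : Set (Point n)) : Prop where
  isOpen : IsOpen E
  interior_closure : interior (closure E) = E
  fst : IsProfile R u
  snd : IsProfile R v
  add_pos : ∀ z ∈ Metric.ball (0 : Plane n) R, 0 < u z + v z
  upper : E ∩ upperHalf n = {g | g.1 ∈ Metric.ball (0 : Plane n) R ∧ 0 < g.2 ∧ g.2 < u g.1}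
  lower : E ∩ lowerHalf n = {g | g.1 ∈ Metric.ball (0 : Plane n) R ∧ g.2 < 0 ∧ -v g.1 < g.2}

/-- Off the frontier, the open sets `E` and (closure E)ᶜ separate any set meeting both. Applied to
vertical lines and horizontal discs, this is how the description of ∂E becomes a description of E.
-/
theorem subset_of_disjoint_frontier {X : Type*} [TopologicalSpace X] {E S : Set X}
    (hE : IsOpen E) (hS : IsPreconnected S) (hd : ∀ x ∈ S, x ∉ frontier E)
    (hne : (S ∩ E).Nonempty) : S ⊆ E := by
  refine hS.subset_left_of_subset_union hE isClosed_closure.isOpen_compl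
    (Set.disjoint_compl_right_iff_subset.2 subset_closure) ?_ hne
  intro x hx
  by_cases h : x ∈ E
  · exact Or.inl h
  · right
    intro hc
    exact hd x hx ⟨hc, by rwa [hE.interior_eq]⟩

theorem vertical_isPreconnected {n : ℕ} (z : Plane n) {I : Set ℝ} (hI : I.OrdConnected) :
    IsPreconnected ((fun t : ℝ => ((z, t) : Point n)) '' I) :=
  hI.isPreconnected.image _ (by fun_prop)

/-- A point of E above the graph, or outside the cylinder, would carry an upward ray inside E,
against boundedness. Conversely each point (z, u z) with u z > 0 is a limit of points of E; these
lie below the graph, and E spreads from them along vertical segments and a horizontal disc, none of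
which meets ∂E. -/
theorem inter_upperHalf_eq {n : ℕ} {E : Set (Point n)} (hE : IsOpen E)
    (hb : Bornology.IsBounded E) {R : ℝ} {u : Plane n → ℝ} (hu : IsProfile R u)
    (hf : frontier E ∩ upperHalf n =
      {g | g ∈ upperHalf n ∧ g.1 ∈ Metric.ball (0 : Plane n) R ∧ g.2 = u g.1}) :
    E ∩ upperHalf n = {g | g.1 ∈ Metric.ball (0 : Plane n) R ∧ 0 < g.2 ∧ g.2 < u g.1} := by
  have hfr : ∀ z : Plane n, ∀ t : ℝ, 0 < t → ((z, t) ∈ frontier E ↔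
      z ∈ Metric.ball (0 : Plane n) R ∧ t = u z) := by
    intro z t ht
    have := Set.ext_iff.1 hf (z, t)
    simp only [Set.mem_inter_iff, upperHalf, Set.mem_ofPred_eq, ht, and_true, true_and] at this
    exact this
  obtain ⟨M, hM⟩ := hb.subset_closedBall (0 : Point n)
  have hMt : ∀ g ∈ E, g.2 ≤ M := by
    intro g hg
    have := hM hg
    rw [mem_closedBall_zero_iff] at this
    exact (le_abs_self _).trans ((norm_snd_le g).trans this)
  have hup : ∀ z : Plane n, ∀ t : ℝ, 0 < t → (z, t) ∈ E → z ∈ Metric.ball (0 : Plane n) R ∧ t < u z := by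
    intro z t ht hE'
    by_contra hcon
    have hsub := subset_of_disjoint_frontier hE (vertical_isPreconnected z (I := Set.Ici t)
      Set.ordConnected_Ici) (by
        rintro _ ⟨s, hs, rfl⟩ hsf
        have hts : t ≤ s := hs
        rw [hfr z s (ht.trans_le hts)] at hsf
        -- The ray can meet ∂E only at height u z ≥ t; since t < u z is excluded, that height is t
        -- itself, whereas (z, t) lies in the open set E.
        have h2 : t = u z := by
          refine le_antisymm (hsf.2 ▸ hts) ?_
          by_contra h3
          exact hcon ⟨hsf.1, not_le.1 h3⟩
        have h4 := (hfr z t ht).2 ⟨hsf.1, h2⟩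
        rw [hE.frontier_eq] at h4
        exact h4.2 hE') ⟨(z, t), ⟨t, Set.self_mem_Ici, rfl⟩, hE'⟩
    have h5 := hMt _ (hsub ⟨max t (M + 1), Set.mem_Ici.2 (le_max_left _ _), rfl⟩)
    have := le_max_right t (M + 1)
    simp only at h5
    linarith
  ext ⟨z, t⟩
  simp only [Set.mem_inter_iff, upperHalf, Set.mem_ofPred_eq]
  constructor
  · rintro ⟨h1, h2⟩
    exact ⟨(hup z t h2 h1).1, h2, (hup z t h2 h1).2⟩
  rintro ⟨hz, ht, htu⟩
  refine ⟨?_, ht⟩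
  have hvert : ∀ y ∈ Metric.ball (0 : Plane n) R, ∀ s : ℝ, 0 < s → s < u y → (y, s) ∈ E →
      ∀ r : ℝ, 0 < r → r < u y → (y, r) ∈ E := by
    intro y hy s hs hsu hsE r hr hru
    refine subset_of_disjoint_frontier hE (vertical_isPreconnected y (I := Set.Ioo 0 (u y))
      Set.ordConnected_Ioo) ?_ ⟨(y, s), ⟨s, ⟨hs, hsu⟩, rfl⟩, hsE⟩ ⟨r, ⟨hr, hru⟩, rfl⟩
    rintro _ ⟨a, ha, rfl⟩ haf
    rw [hfr y a ha.1] at haf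
    exact ha.2.ne haf.2
  have hupos : 0 < u z := ht.trans htu
  -- Half the height: near z the disc at height c stays strictly below the graph, so it links the
  -- vertical segment over a nearby y to the one over z.
  set c := u z / 2 with hc
  have hcpos : 0 < c := by positivity
  have hcont : ContinuousAt u z :=
    hu.continuousOn.continuousAt (Filter.mem_of_superset (Metric.isOpen_ball.mem_nhds hz)
      Metric.ball_subset_closedBall)
  obtain ⟨ε, hε, hεu⟩ : ∃ ε > 0, ∀ y ∈ Metric.ball z ε,
      y ∈ Metric.ball (0 : Plane n) R ∧ c < u y :=
    Metric.eventually_nhds_iff_ball.1 (Filter.Eventually.and (Metric.isOpen_ball.mem_nhds hz)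
      (hcont.eventually (lt_mem_nhds (by rw [hc]; linarith))))
  have hfz : (z, u z) ∈ closure E :=
    frontier_subset_closure ((hfr z (u z) hupos).2 ⟨hz, rfl⟩)
  have hnb : Metric.ball z ε ×ˢ Set.Ioi c ∈ nhds ((z, u z) : Point n) :=
    prod_mem_nhds (Metric.ball_mem_nhds z hε) (Ioi_mem_nhds (by rw [hc]; linarith))
  obtain ⟨⟨y, s⟩, ⟨hy, hs⟩, hyE⟩ := mem_closure_iff_nhds.1 hfz _ hnb
  have hs' : c < s := hs
  have h1 := hup y s (hcpos.trans hs') hyE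
  have h2 : (y, c) ∈ E :=
    hvert y h1.1 s (hcpos.trans hs') h1.2 hyE c hcpos (hs'.trans h1.2)
  have h3 : (z, c) ∈ E := by
    refine subset_of_disjoint_frontier (S := (fun y => ((y, c) : Point n)) '' Metric.ball z ε)
      hE (((convex_ball z ε).isPreconnected).image _ (by fun_prop)) ?_
      ⟨(y, c), ⟨y, hy, rfl⟩, h2⟩ ⟨z, Metric.mem_ball_self hε, rfl⟩
    rintro _ ⟨x, hx, rfl⟩ hxf
    rw [hfr x c hcpos] at hxf
    exact (hεu x hx).2.ne hxf.2
  exact hvert z hz c hcpos (by rw [hc]; linarith) h3 t ht htu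

/-- The reflection `(z, t) ↦ (z, -t)`. -/
def reflectHomeo (n : ℕ) : Point n ≃ₜ Point n :=
  (Homeomorph.refl _).prodCongr (Homeomorph.neg ℝ)

@[simp] theorem reflectHomeo_apply {n : ℕ} (g : Point n) : reflectHomeo n g = (g.1, -g.2) := rfl

theorem IsAdmissible.exists_isLens {n : ℕ} {E : Set (Point n)} (h : IsAdmissible E) :
    ∃ R : ℝ, 0 < R ∧ ∃ u v : Plane n → ℝ, IsLens R u v E := by
  obtain ⟨R, hR, u, v, hu, hv, hfu, hfv, huv⟩ := h.exists_profiles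
  refine ⟨R, hR, u, v, h.isOpen, h.interior_closure, hu, hv, ?_,
    inter_upperHalf_eq h.isOpen h.isBounded hu hfu, ?_⟩
  · intro z hz
    have h1 := hu.nonneg z (Metric.ball_subset_closedBall hz)
    have h2 := hv.nonneg z (Metric.ball_subset_closedBall hz)
    by_contra hcon
    have : z ∈ (∅ : Set (Plane n)) := huv ▸ ⟨⟨hz, by linarith⟩, ⟨hz, by linarith⟩⟩
    exact this
  -- The lower half is the upper half of the reflected set, with v in place of u.
  · have hb : Bornology.IsBounded (reflectHomeo n ⁻¹' E) := by
      obtain ⟨M, hM⟩ := h.isBounded.subset_closedBall (0 : Point n)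
      refine (Metric.isBounded_closedBall (x := (0 : Point n)) (r := M)).subset ?_
      intro g hg
      have := hM hg
      rw [mem_closedBall_zero_iff] at this ⊢
      simpa [Prod.norm_def] using this
    have key := inter_upperHalf_eq (h.isOpen.preimage (reflectHomeo n).continuous) hb hv (by
      rw [← (reflectHomeo n).preimage_frontier]
      ext g
      have := Set.ext_iff.1 hfv (reflectHomeo n g)
      simp only [Set.mem_inter_iff, lowerHalf, Set.mem_ofPred_eq, reflectHomeo_apply,
        neg_lt_zero, neg_inj] at this
      simpa [upperHalf] using this)
    ext g
    have := Set.ext_iff.1 key (reflectHomeo n g)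
    simp only [Set.mem_inter_iff, Set.mem_preimage, upperHalf, Set.mem_ofPred_eq,
      reflectHomeo_apply, neg_neg, Left.neg_pos_iff] at this
    simp only [lowerHalf, Set.mem_inter_iff, Set.mem_ofPred_eq, this]
    rw [neg_lt]

theorem IsProfile.dilate {n : ℕ} {R : ℝ} (hR : 0 < R) {u : Plane n → ℝ} (hu : IsProfile R u) :
    IsProfile 1 (fun z => R⁻¹ ^ 2 * u (R • z)) := by
  have hmaps : ∀ z ∈ Metric.ball (0 : Plane n) 1, R • z ∈ Metric.ball (0 : Plane n) R := by
    intro z hz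
    rw [mem_ball_zero_iff] at hz ⊢
    rw [norm_smul, Real.norm_of_nonneg hR.le]
    nlinarith
  have hmaps' : ∀ z ∈ Metric.closedBall (0 : Plane n) 1,
      R • z ∈ Metric.closedBall (0 : Plane n) R := by
    intro z hz
    rw [mem_closedBall_zero_iff] at hz ⊢
    rw [norm_smul, Real.norm_of_nonneg hR.le]
    nlinarith
  refine ⟨fun z hz => mul_nonneg (by positivity) (hu.nonneg _ (hmaps' z hz)),
    contDiffOn_const.mul (hu.contDiffOn.comp (by fun_prop) hmaps),
    continuousOn_const.mul (hu.continuousOn.comp (by fun_prop) hmaps'), fun z hz => ?_⟩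
  rw [hu.eq_zero, mul_zero]
  rw [mem_sphere_zero_iff_norm] at hz ⊢
  rw [norm_smul, Real.norm_of_nonneg hR.le, hz, mul_one]

theorem IsLens.dilate {n : ℕ} {R : ℝ} (hR : 0 < R) {u v : Plane n → ℝ} {E : Set (Point n)}
    (h : IsLens R u v E) :
    IsLens 1 (fun z => R⁻¹ ^ 2 * u (R • z)) (fun z => R⁻¹ ^ 2 * v (R • z))
      (dilation R⁻¹ '' E) := by
  have hR' : R⁻¹ ≠ 0 := by positivity
  have himg : dilation R⁻¹ '' E = dilationHomeo R⁻¹ hR' '' E := rfl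
  have hmem : ∀ g : Point n, g ∈ dilation R⁻¹ '' E ↔ (R • g.1, R ^ 2 * g.2) ∈ E := by
    intro g
    rw [himg, Homeomorph.image_eq_preimage_symm, Set.mem_preimage]
    have : (dilationHomeo R⁻¹ hR').symm g = dilation R⁻¹⁻¹ g := rfl
    rw [this, inv_inv]; rfl
  have hball : ∀ z : Plane n, R • z ∈ Metric.ball (0 : Plane n) R ↔
      z ∈ Metric.ball (0 : Plane n) 1 := by
    intro z
    rw [mem_ball_zero_iff, mem_ball_zero_iff, norm_smul, Real.norm_of_nonneg hR.le,
      mul_lt_iff_lt_one_right hR]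
  have hR2 : 0 < R ^ 2 := by positivity
  refine ⟨?_, ?_, h.fst.dilate hR, h.snd.dilate hR, ?_, ?_, ?_⟩
  · rw [himg]; exact (Homeomorph.isOpen_image _).2 h.isOpen
  · rw [himg, ← Homeomorph.image_closure, ← Homeomorph.image_interior, h.interior_closure]
  · intro z hz
    have := h.add_pos _ ((hball z).2 hz)
    rw [← mul_add]
    positivity
  · ext g
    have := Set.ext_iff.1 h.upper (R • g.1, R ^ 2 * g.2)
    simp only [Set.mem_inter_iff, upperHalf, Set.mem_ofPred_eq, hball,
      mul_pos_iff_of_pos_left hR2] at this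
    simp only [Set.mem_inter_iff, hmem, upperHalf, Set.mem_ofPred_eq, this]
    rw [inv_pow, ← div_eq_inv_mul, lt_div_iff₀' hR2]
  · ext g
    have := Set.ext_iff.1 h.lower (R • g.1, R ^ 2 * g.2)
    simp only [Set.mem_inter_iff, lowerHalf, Set.mem_ofPred_eq, hball] at this
    simp only [Set.mem_inter_iff, hmem, lowerHalf, Set.mem_ofPred_eq]
    rw [inv_pow, ← div_eq_inv_mul, ← neg_div, div_lt_iff₀' hR2]
    have hneg : R ^ 2 * g.2 < 0 ↔ g.2 < 0 := by
      constructor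
      · intro h3; by_contra h4; nlinarith
      · intro h3; nlinarith
    rwa [hneg] at this

/-- The hyperplane t = 0 has dense complement, so the two open halves of an open set determine its
closure, and the interior of the closure gives the set back. This settles the points at height zero,
which the profiles do not describe. -/
theorem eq_of_inter_halves_eq {n : ℕ} {E F : Set (Point n)} (hE : IsOpen E)
    (hE' : interior (closure E) = E) (hF : IsOpen F) (hF' : interior (closure F) = F)
    (hu : E ∩ upperHalf n = F ∩ upperHalf n) (hl : E ∩ lowerHalf n = F ∩ lowerHalf n) :
    E = F := by
  have hd : Dense {g : Point n | g.2 ≠ 0} := by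
    have : {g : Point n | g.2 ≠ 0} = Set.univ ×ˢ ({0}ᶜ : Set ℝ) := by ext g; simp
    rw [this]
    exact dense_univ.prod (dense_compl_singleton 0)
  have hsplit : ∀ A : Set (Point n),
      A ∩ {g : Point n | g.2 ≠ 0} = (A ∩ upperHalf n) ∪ (A ∩ lowerHalf n) := by
    intro A
    rw [← Set.inter_union_distrib_left]
    congr 1
    ext g
    simp [upperHalf, lowerHalf, or_comm]
  have hcl : ∀ A : Set (Point n), IsOpen A →
      closure A = closure ((A ∩ upperHalf n) ∪ (A ∩ lowerHalf n)) := by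
    intro A hA
    rw [← hsplit]
    refine subset_antisymm (closure_minimal ?_ isClosed_closure)
      (closure_mono Set.inter_subset_left)
    exact hd.open_subset_closure_inter hA
  rw [← hE', ← hF', hcl E hE, hcl F hF, hu, hl]

/-! ### Lower bounds for the perimeter of a region between two graphs -/

theorem contDiff_of_contDiffAt_tsupport {V W : Type*} [NormedAddCommGroup V] [NormedSpace ℝ V]
    [NormedAddCommGroup W] [NormedSpace ℝ W] {f : V → W} {k : WithTop ℕ∞}
    (h : ∀ x ∈ tsupport f, ContDiffAt ℝ k f x) : ContDiff ℝ k f := by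
  refine contDiff_iff_contDiffAt.2 fun x => ?_
  by_cases hx : x ∈ tsupport f
  · exact h x hx
  · exact contDiffAt_const.congr_of_eventuallyEq (notMem_tsupport_iff_eventuallyEq.1 hx)

theorem integrable_graph_pairing {n : ℕ} {Z : Point n → Plane n} (hZ : ContDiff ℝ 1 Z)
    (hc : HasCompactSupport Z) {b : Plane n → ℝ} (hb : ContDiff ℝ 1 b) :
    Integrable fun z =>
      inner ℝ (Z (z, b z)) (rotJ n z) / 2 - fderiv ℝ b z (Z (z, b z)) := by
  have hbd := hb.continuous_fderiv one_ne_zero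
  have hbc := hb.continuous
  have hZc := hZ.continuous
  refine Continuous.integrable_of_hasCompactSupport (by fun_prop) ?_
  refine HasCompactSupport.intro (hc.isCompact.image continuous_fst) fun z hz => ?_
  have : Z (z, b z) = 0 := by
    by_contra h
    exact hz ⟨(z, b z), subset_tsupport _ h, rfl⟩
  simp [this]

theorem contDiff_component {n : ℕ} {V : Type*} [NormedAddCommGroup V] [NormedSpace ℝ V]
    {Z : V → Plane n} (hZ : ContDiff ℝ 1 Z) (j : Fin n ⊕ Fin n) :
    ContDiff ℝ 1 fun g => Z g j :=
  (contDiff_euclidean.1 hZ) j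

theorem hasCompactSupport_component {n : ℕ} {V : Type*} [TopologicalSpace V]
    {Z : V → Plane n} (hZ : HasCompactSupport Z) (j : Fin n ⊕ Fin n) :
    HasCompactSupport fun g => Z g j :=
  hZ.comp_left (g := fun w : Plane n => w j) rfl

theorem setIntegral_subgraph_divH_vec {n : ℕ} {Z : Point n → Plane n} (hZ : ContDiff ℝ 1 Z)
    (hc : HasCompactSupport Z) {b : Plane n → ℝ} (hb : ContDiff ℝ 1 b) :
    ∫ g in {g : Point n | g.2 ≤ b g.1}, divH (fun j g => Z g j) g =
      ∫ z, (inner ℝ (Z (z, b z)) (rotJ n z) / 2 - fderiv ℝ b z (Z (z, b z))) := by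
  rw [setIntegral_subgraph_divH (contDiff_component hZ) (hasCompactSupport_component hc) hb]
  refine integral_congr_ae (Filter.Eventually.of_forall fun z => ?_)
  simp only [mul_sub, Finset.sum_sub_distrib, sum_mul_clm_basisVec, inner_eq_sum,
    Finset.sum_div, mul_div_assoc]

theorem ae_snd_ne {n : ℕ} {b : Plane n → ℝ} (hb : Measurable b) :
    ∀ᵐ g : Point n, g.2 ≠ b g.1 := by
  have hm : MeasurableSet {g : Point n | g.2 ≠ b g.1} :=
    (measurableSet_eq_fun measurable_snd (hb.comp measurable_fst)).compl
  rw [Measure.volume_eq_prod]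
  refine (Measure.ae_prod_mem_iff_ae_ae_mem hm).2 (Filter.Eventually.of_forall fun z => ?_)
  exact Measure.ae_ne volume (b z)

/-- The gradient of a profile may blow up at the sphere, as it does for the extremal one. The flux
formulas need functions that are C¹ on the whole plane, so they are applied to a cut-off that agrees
with the profile where the test field lives. -/
theorem exists_contDiff_extension {n : ℕ} {u : Plane n → ℝ}
    (hu : ContDiffOn ℝ 1 u (Metric.ball 0 1)) {r : ℝ} (hr : 0 < r) (hr1 : r < 1) :
    ∃ U : Plane n → ℝ, ContDiff ℝ 1 U ∧ Set.EqOn U u (Metric.ball 0 r) := by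
  let κ : ContDiffBump (0 : Plane n) := ⟨r, (1 + r) / 2, hr, by linarith⟩
  refine ⟨fun z => κ z * u z, ?_, fun z hz => ?_⟩
  · refine contDiff_of_contDiffAt_tsupport fun z hz => ?_
    have h1 : z ∈ Metric.closedBall (0 : Plane n) ((1 + r) / 2) := by
      have := tsupport_mul_subset_left (f := fun z => κ z) (g := u) hz
      rwa [κ.tsupport_eq] at this
    have h2 : z ∈ Metric.ball (0 : Plane n) 1 :=
      Metric.closedBall_subset_ball (by linarith) h1
    exact κ.contDiffAt.mul (hu.contDiffAt (Metric.isOpen_ball.mem_nhds h2))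
  · have : κ z = 1 := κ.one_of_mem_closedBall (Metric.ball_subset_closedBall hz)
    simp [this]

/-- A point at height zero belongs to neither half; openness supplies a point of E just above it
over the same z. -/
theorem IsLens.fst_mem_ball {n : ℕ} {u v : Plane n → ℝ} {E : Set (Point n)} {R : ℝ}
    (h : IsLens R u v E) {g : Point n} (hg : g ∈ E) : g.1 ∈ Metric.ball (0 : Plane n) R := by
  have h1 : ∀ᶠ s in nhdsWithin g.2 (Set.Ioi g.2), ((g.1, s) : Point n) ∈ E := by
    have : ContinuousAt (fun s : ℝ => ((g.1, s) : Point n)) g.2 := by fun_prop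
    exact nhdsWithin_le_nhds (this.eventually_mem (h.isOpen.mem_nhds hg))
  rcases lt_or_ge g.2 0 with h0 | h0
  · exact ((Set.ext_iff.1 h.lower g).1 ⟨hg, h0⟩).1
  · obtain ⟨s, hs, hs'⟩ := (h1.and self_mem_nhdsWithin).exists
    exact ((Set.ext_iff.1 h.upper (g.1, s)).1 ⟨hs, h0.trans_lt hs'⟩).1

theorem IsProfile.exists_bound {n : ℕ} {u : Plane n → ℝ} {R : ℝ} (hu : IsProfile R u) :
    ∃ M, 0 < M ∧ ∀ z ∈ Metric.closedBall (0 : Plane n) R, u z < M := by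
  obtain ⟨M, hM⟩ := (isCompact_closedBall (0 : Plane n) R).exists_bound_of_continuousOn
    hu.continuousOn
  refine ⟨max M 0 + 1, by positivity, fun z hz => ?_⟩
  have h1 := (le_abs_self _).trans (hM z hz)
  have h2 := le_max_left M 0
  linarith

theorem IsLens.exists_height_bound {n : ℕ} {u v : Plane n → ℝ} {E : Set (Point n)} {R : ℝ}
    (h : IsLens R u v E) : ∃ M, 0 < M ∧ (∀ z ∈ Metric.closedBall (0 : Plane n) R, u z < M) ∧
      (∀ z ∈ Metric.closedBall (0 : Plane n) R, v z < M) ∧ ∀ g ∈ E, |g.2| < M := by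
  obtain ⟨M₁, h0, h1⟩ := h.fst.exists_bound
  obtain ⟨M₂, -, h2⟩ := h.snd.exists_bound
  refine ⟨max M₁ M₂, lt_max_of_lt_left h0, fun z hz => lt_max_of_lt_left (h1 z hz),
    fun z hz => lt_max_of_lt_right (h2 z hz), fun g hg => ?_⟩
  rcases lt_trichotomy g.2 0 with h3 | h3 | h3
  · obtain ⟨h4, -, h5⟩ := (Set.ext_iff.1 h.lower g).1 ⟨hg, h3⟩
    rw [abs_of_neg h3]
    have := h2 g.1 (Metric.ball_subset_closedBall h4)
    exact lt_max_of_lt_right (by linarith)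
  · rw [h3, abs_zero]; exact lt_max_of_lt_left h0
  · obtain ⟨h4, -, h5⟩ := (Set.ext_iff.1 h.upper g).1 ⟨hg, h3⟩
    rw [abs_of_pos h3]
    have := h1 g.1 (Metric.ball_subset_closedBall h4)
    exact lt_max_of_lt_left (by linarith)

theorem IsLens.volume_lt_top {n : ℕ} {u v : Plane n → ℝ} {E : Set (Point n)} {R : ℝ}
    (h : IsLens R u v E) : volume E < ⊤ := by
  obtain ⟨M, hM, -, -, hE⟩ := h.exists_height_bound
  have : E ⊆ Metric.closedBall 0 R ×ˢ Set.Icc (-M) M := fun g hg =>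
    ⟨Metric.ball_subset_closedBall (h.fst_mem_ball hg), abs_le.1 (hE g hg).le⟩
  exact (measure_mono this).trans_lt
    ((isCompact_closedBall _ _).prod isCompact_Icc).measure_lt_top

theorem divH_eq_zero_of_eventually {n : ℕ} {ζ : Fin n ⊕ Fin n → Point n → ℝ} {g : Point n}
    (h : ∀ j, ζ j =ᶠ[nhds g] 0) : divH ζ g = 0 := by
  unfold divH
  refine Finset.sum_eq_zero fun j _ => ?_
  rw [(h j).fderiv_eq]; simp

/-- Over the ball of radius `r`, and up to the null sets formed by the graphs and t = 0, E is the
subgraph of U minus the subgraph of -V. Outside that ball the field vanishes. -/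
theorem IsLens.setIntegral_divH {n : ℕ} {u v : Plane n → ℝ} {E : Set (Point n)}
    (h : IsLens 1 u v E) {Z : Point n → Plane n} (hZ : ContDiff ℝ 1 Z)
    (hc : HasCompactSupport Z) {r : ℝ} (hr1 : r < 1)
    (hsupp : ∀ g, r ≤ ‖g.1‖ → Z =ᶠ[nhds g] 0)
    {U V : Plane n → ℝ} (hU : ContDiff ℝ 1 U) (hV : ContDiff ℝ 1 V)
    (hUu : Set.EqOn U u (Metric.ball 0 r)) (hVv : Set.EqOn V v (Metric.ball 0 r)) :
    ∫ g in E, divH (fun j g => Z g j) g =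
      (∫ z, (inner ℝ (Z (z, U z)) (rotJ n z) / 2 - fderiv ℝ U z (Z (z, U z)))) -
      ∫ z, (inner ℝ (Z (z, -V z)) (rotJ n z) / 2 + fderiv ℝ V z (Z (z, -V z))) := by
  have hI : Integrable (divH (fun j g => Z g j)) :=
    integrable_divH' (contDiff_component hZ) (hasCompactSupport_component hc)
  have h1 := setIntegral_subgraph_divH_vec hZ hc hU
  have h2 := setIntegral_subgraph_divH_vec hZ hc hV.neg
  have h3 : ∀ z, fderiv ℝ (fun z => -V z) z = -fderiv ℝ V z := fun z => fderiv_neg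
  simp only [h3, neg_apply, sub_neg_eq_add] at h2
  rw [← h1, ← h2]
  have mU := measurableSet_subgraph hU.continuous
  have mV : MeasurableSet {g : Point n | g.2 ≤ -V g.1} :=
    measurableSet_subgraph hV.continuous.neg
  rw [← integral_indicator mU, ← integral_indicator mV,
    ← integral_indicator h.isOpen.measurableSet, ← integral_sub (hI.indicator mU)
    (hI.indicator mV)]
  refine integral_congr_ae ?_
  filter_upwards [ae_snd_ne hU.continuous.measurable, ae_snd_ne hV.continuous.neg.measurable,
    ae_snd_ne (n := n) (b := fun _ => 0) measurable_const] with g hgU hgV hg0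
  by_cases hgr : r ≤ ‖g.1‖
  · have : divH (fun j g => Z g j) g = 0 := by
      refine divH_eq_zero_of_eventually fun j => ?_
      filter_upwards [hsupp g hgr] with p hp
      simp [hp]
    simp [Set.indicator_apply, this]
  · rw [not_le] at hgr
    have hb : g.1 ∈ Metric.ball (0 : Plane n) r := by simpa using hgr
    have hb1 : g.1 ∈ Metric.ball (0 : Plane n) 1 := Metric.ball_subset_ball hr1.le hb
    have hu0 := h.fst.nonneg _ (Metric.ball_subset_closedBall hb1)
    have hv0 := h.snd.nonneg _ (Metric.ball_subset_closedBall hb1)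
    simp only [Pi.neg_apply] at hgV
    rw [hUu hb] at hgU
    rw [hVv hb] at hgV
    simp only [Set.indicator_apply, Set.mem_ofPred_eq, hUu hb, hVv hb]
    rcases lt_or_gt_of_ne hg0 with hlt | hgt
    · have h4 : g ∈ E ↔ -v g.1 < g.2 := by
        have := Set.ext_iff.1 h.lower g
        simp only [Set.mem_inter_iff, lowerHalf, Set.mem_ofPred_eq, hlt, hb1, and_true,
          true_and] at this
        exact this
      have h5 : g.2 ≤ u g.1 := by linarith
      by_cases h6 : g.2 ≤ -v g.1
      · have : g ∉ E := fun hh => absurd (h4.1 hh) (not_lt.2 h6)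
        simp [h5, h6, this]
      · have : g ∈ E := h4.2 (not_le.1 h6)
        simp [h5, h6, this]
    · have h4 : g ∈ E ↔ g.2 < u g.1 := by
        have := Set.ext_iff.1 h.upper g
        simp only [Set.mem_inter_iff, upperHalf, Set.mem_ofPred_eq, hgt, hb1, and_true,
          true_and] at this
        exact this
      have h5 : ¬ g.2 ≤ -v g.1 := by linarith
      by_cases h6 : g.2 ≤ u g.1
      · have : g ∈ E := h4.2 (lt_of_le_of_ne h6 hgU)
        simp [h5, h6, this]
      · have : g ∉ E := fun hh => h6 (h4.1 hh).le
        simp [h5, h6, this]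

theorem sum_sq_eq_norm_sq {n : ℕ} (z : Plane n) : ∑ j, z j ^ 2 = ‖z‖ ^ 2 := by
  rw [EuclideanSpace.norm_sq_eq]; simp

theorem exists_norm_lt_of_tsupport {n : ℕ} {α : Plane n → Plane n} (hc : HasCompactSupport α)
    (hs : tsupport α ⊆ Metric.ball 0 1) :
    ∃ r, 0 < r ∧ r < 1 ∧ ∀ z ∈ tsupport α, ‖z‖ < r := by
  rcases (tsupport α).eq_empty_or_nonempty with h | h
  · exact ⟨1 / 2, by norm_num, by norm_num, by simp [h]⟩
  · obtain ⟨x, hx, hmax⟩ := hc.isCompact.exists_isMaxOn h continuous_norm.continuousOn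
    have hx1 : ‖x‖ < 1 := by simpa using hs hx
    have hx0 := norm_nonneg x
    refine ⟨(1 + ‖x‖) / 2, by linarith, by linarith, fun z hz => ?_⟩
    have : ‖z‖ ≤ ‖x‖ := hmax hz
    linarith

/-- A horizontal field supported over a smaller ball that equals `α` on the upper graph and `β`
on the lower graph. -/
theorem IsLens.exists_interpolation {n : ℕ} {u v : Plane n → ℝ} {E : Set (Point n)}
    (h : IsLens 1 u v E) {α β : Plane n → Plane n} (hα : ContDiff ℝ 1 α) (hβ : ContDiff ℝ 1 β)
    (hαc : HasCompactSupport α) (hβc : HasCompactSupport β)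
    (hαs : tsupport α ⊆ Metric.ball 0 1) (hβs : tsupport β ⊆ Metric.ball 0 1)
    (hα1 : ∀ z ∈ Metric.ball (0 : Plane n) 1, ‖z + α z‖ ≤ 1)
    (hβ1 : ∀ z ∈ Metric.ball (0 : Plane n) 1, ‖z + β z‖ ≤ 1) :
    ∃ (r : ℝ) (U V : Plane n → ℝ) (W : Point n → Plane n), r < 1 ∧
      ContDiff ℝ 1 U ∧ ContDiff ℝ 1 V ∧ ContDiff ℝ 1 W ∧
      Set.EqOn U u (Metric.ball 0 r) ∧ Set.EqOn V v (Metric.ball 0 r) ∧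
      (∀ z, r ≤ ‖z‖ → α z = 0) ∧ (∀ z, r ≤ ‖z‖ → β z = 0) ∧
      (∀ g : Point n, r ≤ ‖g.1‖ → W =ᶠ[nhds g] 0) ∧
      (∀ z, W (z, U z) = α z) ∧ (∀ z, W (z, -V z) = β z) ∧
      ∀ g : Point n, g.1 ∈ Metric.ball (0 : Plane n) 1 → ‖g.1 + W g‖ ≤ 1 := by
  obtain ⟨r₁, hr₁, hr₁', hαr⟩ := exists_norm_lt_of_tsupport hαc hαs
  obtain ⟨r₂, hr₂, hr₂', hβr⟩ := exists_norm_lt_of_tsupport hβc hβs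
  set r := max r₁ r₂ with hr
  have hr0 : 0 < r := lt_max_of_lt_left hr₁
  have hr1 : r < 1 := max_lt hr₁' hr₂'
  replace hαr : ∀ z ∈ tsupport α, z ∈ Metric.ball (0 : Plane n) r := fun z hz =>
    mem_ball_zero_iff.2 (lt_max_of_lt_left (hαr z hz))
  replace hβr : ∀ z ∈ tsupport β, z ∈ Metric.ball (0 : Plane n) r := fun z hz =>
    mem_ball_zero_iff.2 (lt_max_of_lt_right (hβr z hz))
  obtain ⟨U, hU, hUu⟩ := exists_contDiff_extension (h.fst.contDiffOn.of_le one_le_two) hr0 hr1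
  obtain ⟨V, hV, hVv⟩ := exists_contDiff_extension (h.snd.contDiffOn.of_le one_le_two) hr0 hr1
  -- Normalised height between the graphs: τ is 1 on the upper one and 0 on the lower one. The
  -- denominator is positive over the ball of radius r because u and v have no common zero.
  set τ : Point n → ℝ := fun g => Real.smoothTransition ((g.2 + V g.1) / (U g.1 + V g.1)) with hτ
  have hpos : ∀ z ∈ Metric.ball (0 : Plane n) r, 0 < U z + V z := by
    intro z hz
    rw [hUu hz, hVv hz]
    exact h.add_pos z (Metric.ball_subset_ball hr1.le hz)
  have hτC : ∀ g : Point n, g.1 ∈ Metric.ball (0 : Plane n) r → ContDiffAt ℝ 1 τ g := by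
    intro g hg
    have hU' : ContDiffAt ℝ 1 (fun g : Point n => U g.1) g := (hU.comp contDiff_fst).contDiffAt
    have hV' : ContDiffAt ℝ 1 (fun g : Point n => V g.1) g := (hV.comp contDiff_fst).contDiffAt
    have : ContDiffAt ℝ 1 (fun g : Point n => (g.2 + V g.1) / (U g.1 + V g.1)) g :=
      (contDiffAt_snd.add hV').div (hU'.add hV') (hpos _ hg).ne'
    exact (Real.smoothTransition.contDiff (n := 1)).contDiffAt.comp g this
  set W : Point n → Plane n := fun g => τ g • α g.1 + (1 - τ g) • β g.1 with hW
  have hWC : ContDiff ℝ 1 W := by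
    refine ContDiff.add ?_ ?_
    · refine contDiff_of_contDiffAt_tsupport fun g hg => ?_
      have h1 : g.1 ∈ tsupport α :=
        tsupport_comp_subset_preimage α continuous_fst (tsupport_smul_subset_right _ _ hg)
      exact (hτC g (hαr _ h1)).smul (hα.comp contDiff_fst).contDiffAt
    · refine contDiff_of_contDiffAt_tsupport fun g hg => ?_
      have h1 : g.1 ∈ tsupport β :=
        tsupport_comp_subset_preimage β continuous_fst (tsupport_smul_subset_right _ _ hg)
      exact (contDiffAt_const.sub (hτC g (hβr _ h1))).smul (hβ.comp contDiff_fst).contDiffAt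
  have hα0 : ∀ z, r ≤ ‖z‖ → α z = 0 := fun z hz => by
    refine image_eq_zero_of_notMem_tsupport fun hh => ?_
    exact absurd (mem_ball_zero_iff.1 (hαr z hh)) (not_lt.2 hz)
  have hβ0 : ∀ z, r ≤ ‖z‖ → β z = 0 := fun z hz => by
    refine image_eq_zero_of_notMem_tsupport fun hh => ?_
    exact absurd (mem_ball_zero_iff.1 (hβr z hh)) (not_lt.2 hz)
  have hW0 : ∀ g : Point n, r ≤ ‖g.1‖ → W g = 0 := fun g hg => by
    simp [hW, hα0 _ hg, hβ0 _ hg]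
  have hWloc : ∀ g : Point n, r ≤ ‖g.1‖ → W =ᶠ[nhds g] 0 := by
    intro g hg
    have h1 : ∀ᶠ z in nhds g.1, α z = 0 := by
      have h3 : g.1 ∉ tsupport α := fun hh =>
        absurd (mem_ball_zero_iff.1 (hαr g.1 hh)) (not_lt.2 hg)
      exact notMem_tsupport_iff_eventuallyEq.1 h3
    have h2 : ∀ᶠ z in nhds g.1, β z = 0 := by
      have h3 : g.1 ∉ tsupport β := fun hh =>
        absurd (mem_ball_zero_iff.1 (hβr g.1 hh)) (not_lt.2 hg)
      exact notMem_tsupport_iff_eventuallyEq.1 h3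
    filter_upwards [(continuous_fst.tendsto g).eventually h1,
      (continuous_fst.tendsto g).eventually h2] with p hp1 hp2
    simp [hW, hp1, hp2]
  have hWtop : ∀ z, W (z, U z) = α z := by
    intro z
    by_cases hz : r ≤ ‖z‖
    · rw [hW0 (z, U z) hz, hα0 z hz]
    · have hz' : z ∈ Metric.ball (0 : Plane n) r := mem_ball_zero_iff.2 (not_le.1 hz)
      have : τ (z, U z) = 1 := by
        simp only [hτ]
        rw [div_self (hpos z hz').ne']; exact Real.smoothTransition.one
      simp [hW, this]
  have hWbot : ∀ z, W (z, -V z) = β z := by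
    intro z
    have : τ (z, -V z) = 0 := by simp [hτ]
    simp [hW, this]
  refine ⟨r, U, V, W, hr1, hU, hV, hWC, hUu, hVv, hα0, hβ0, hWloc, hWtop, hWbot, fun g hg => ?_⟩
  -- The interpolated field is a convex combination of z + α and z + β, so the bound by 1 survives.
  have e3 : g.1 + W g = τ g • (g.1 + α g.1) + (1 - τ g) • (g.1 + β g.1) := by
    simp only [hW]; module
  have ht0 : 0 ≤ τ g := Real.smoothTransition.nonneg _
  have ht1 : 0 ≤ 1 - τ g := sub_nonneg.2 (Real.smoothTransition.le_one _)
  rw [e3]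
  refine (norm_add_le _ _).trans ?_
  rw [norm_smul, norm_smul, Real.norm_of_nonneg ht0, Real.norm_of_nonneg ht1]
  have a1 := mul_le_mul_of_nonneg_left (hα1 _ hg) ht0
  have a2 := mul_le_mul_of_nonneg_left (hβ1 _ hg) ht1
  linarith

/-- The test field is z + W, with W equal to α and β on the two graphs. The field z is not compactly
supported in the open ball, but its divergence is 2n throughout E, so it contributes 2n|E| with no
boundary computation. Only W goes through the flux formula, and W lives over a smaller ball where u
and v are regular. -/
theorem IsLens.ofReal_le_perimeterH {n : ℕ} {u v : Plane n → ℝ} {E : Set (Point n)}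
    (h : IsLens 1 u v E) {α β : Plane n → Plane n} (hα : ContDiff ℝ 1 α) (hβ : ContDiff ℝ 1 β)
    (hαc : HasCompactSupport α) (hβc : HasCompactSupport β)
    (hαs : tsupport α ⊆ Metric.ball 0 1) (hβs : tsupport β ⊆ Metric.ball 0 1)
    (hα1 : ∀ z ∈ Metric.ball (0 : Plane n) 1, ‖z + α z‖ ≤ 1)
    (hβ1 : ∀ z ∈ Metric.ball (0 : Plane n) 1, ‖z + β z‖ ≤ 1) :
    ENNReal.ofReal (2 * n * (volume E).toReal +
      ((∫ z, (inner ℝ (α z) (rotJ n z) / 2 - fderiv ℝ u z (α z))) -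
        ∫ z, (inner ℝ (β z) (rotJ n z) / 2 + fderiv ℝ v z (β z)))) ≤ perimeterH E := by
  obtain ⟨M, hM, huM, hvM, hEM⟩ := h.exists_height_bound
  obtain ⟨r, U, V, W, hr1, hU, hV, hWC, hUu, hVv, hα0, hβ0, hWloc, hWtop, hWbot, hWn⟩ :=
    h.exists_interpolation hα hβ hαc hβc hαs hβs hα1 hβ1
  have hW0 : ∀ g : Point n, r ≤ ‖g.1‖ → W g = 0 := fun g hg => (hWloc g hg).eq_of_nhds
  let χ : ContDiffBump (0 : ℝ) := ⟨M, M + 1, hM, by linarith⟩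
  have hχC : ContDiff ℝ 1 (fun g : Point n => χ g.2) := χ.contDiff.comp contDiff_snd
  set Z₂ : Point n → Plane n := fun g => χ g.2 • W g with hZ₂
  have hZ₂C : ContDiff ℝ 1 Z₂ := hχC.smul hWC
  have hbox : ∀ {ρ : ℝ} {Y : Point n → Plane n}, (∀ g : Point n, ρ < ‖g.1‖ → Y g = 0) →
      HasCompactSupport (fun g => χ g.2 • Y g) := by
    intro ρ Y hY
    refine HasCompactSupport.intro
      ((isCompact_closedBall (0 : Plane n) ρ).prod (isCompact_closedBall (0 : ℝ) (M + 1))) ?_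
    intro g hg
    by_cases h1 : ρ < ‖g.1‖
    · rw [hY g h1, smul_zero]
    · have h2 : M + 1 ≤ dist g.2 0 := by
        by_contra h3
        exact hg ⟨mem_closedBall_zero_iff.2 (not_lt.1 h1),
          Metric.mem_closedBall.2 (not_le.1 h3).le⟩
      rw [χ.zero_of_le_dist h2, zero_smul]
  have hZ₂c : HasCompactSupport Z₂ := hbox (ρ := r) fun g hg => hW0 g hg.le
  have hint₂ := h.setIntegral_divH hZ₂C hZ₂c hr1 (fun g hg => by
    filter_upwards [hWloc g hg] with p hp
    simp [hZ₂, hp]) hU hV hUu hVv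
  have hχ1 : ∀ t : ℝ, |t| ≤ M → χ t = 1 := fun t ht =>
    χ.one_of_mem_closedBall (mem_closedBall_zero_iff.2 ht)
  have hTop : ∀ z, inner ℝ (Z₂ (z, U z)) (rotJ n z) / 2 - fderiv ℝ U z (Z₂ (z, U z)) =
      inner ℝ (α z) (rotJ n z) / 2 - fderiv ℝ u z (α z) := by
    intro z
    simp only [hZ₂, hWtop]
    by_cases hz : r ≤ ‖z‖
    · simp [hα0 _ hz]
    · have hz' : z ∈ Metric.ball (0 : Plane n) r := mem_ball_zero_iff.2 (not_le.1 hz)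
      have hz1 := Metric.ball_subset_closedBall (Metric.ball_subset_ball hr1.le hz')
      rw [hχ1, one_smul,
        Filter.EventuallyEq.fderiv_eq (hUu.eventuallyEq_of_mem (Metric.isOpen_ball.mem_nhds hz'))]
      rw [hUu hz', abs_of_nonneg (h.fst.nonneg z hz1)]
      exact (huM z hz1).le
  have hBot : ∀ z, inner ℝ (Z₂ (z, -V z)) (rotJ n z) / 2 + fderiv ℝ V z (Z₂ (z, -V z)) =
      inner ℝ (β z) (rotJ n z) / 2 + fderiv ℝ v z (β z) := by
    intro z
    simp only [hZ₂, hWbot]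
    by_cases hz : r ≤ ‖z‖
    · simp [hβ0 _ hz]
    · have hz' : z ∈ Metric.ball (0 : Plane n) r := mem_ball_zero_iff.2 (not_le.1 hz)
      have hz1 := Metric.ball_subset_closedBall (Metric.ball_subset_ball hr1.le hz')
      rw [hχ1, one_smul,
        Filter.EventuallyEq.fderiv_eq (hVv.eventuallyEq_of_mem (Metric.isOpen_ball.mem_nhds hz'))]
      rw [hVv hz', abs_neg, abs_of_nonneg (h.snd.nonneg z hz1)]
      exact (hvM z hz1).le
  simp only [hTop, hBot] at hint₂
  set X := (∫ z, (inner ℝ (α z) (rotJ n z) / 2 - fderiv ℝ u z (α z))) -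
        ∫ z, (inner ℝ (β z) (rotJ n z) / 2 + fderiv ℝ v z (β z)) with hX
  have key : ∀ δ : ℝ, 0 < δ → δ < 1 →
      ENNReal.ofReal ((1 - δ) * (2 * n * (volume E).toReal + X)) ≤ perimeterH E := by
    intro δ hδ hδ1
    -- Cutting z off between radii 1 and 1 + δ lets the norm grow to 1 + δ; the factor 1 - δ
    -- restores the constraint since (1 - δ)(1 + δ) ≤ 1, and δ → 0 removes the loss.
    let ρ : ContDiffBump (0 : Plane n) := ⟨1, 1 + δ, one_pos, by linarith⟩
    set Z₁ : Point n → Plane n := fun g => χ g.2 • (ρ g.1 • g.1) with hZ₁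
    have hZ₁C : ContDiff ℝ 1 Z₁ :=
      hχC.smul ((ρ.contDiff.comp contDiff_fst).smul contDiff_fst)
    have hρ0 : ∀ z : Plane n, 1 + δ ≤ ‖z‖ → ρ z = 0 := fun z hz =>
      ρ.zero_of_le_dist (by rwa [dist_zero_right])
    have hZ₁c : HasCompactSupport Z₁ := hbox (ρ := 1 + δ) fun g hg => by
      simp [hρ0 _ hg.le]
    have hsum : ∀ j : Fin n ⊕ Fin n, (fun g : Point n => ((1 - δ) • (Z₁ g + Z₂ g)) j) =
        fun g => (1 - δ) * (Z₁ g j + Z₂ g j) := by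
      intro j; ext g; simp [mul_add]
    have hmem : (fun j (g : Point n) => ((1 - δ) • (Z₁ g + Z₂ g)) j) ∈ testFields n := by
      refine ⟨contDiff_component ((hZ₁C.add hZ₂C).const_smul (1 - δ)),
        hasCompactSupport_component ((hZ₁c.add hZ₂c).smul_left (f := fun _ => 1 - δ)), ?_⟩
      intro g
      rw [sum_sq_eq_norm_sq]
      refine pow_le_one₀ (norm_nonneg _) ?_
      have e1 : Z₁ g + Z₂ g = χ g.2 • (ρ g.1 • g.1 + W g) := by simp [hZ₁, hZ₂]
      rw [e1, norm_smul, norm_smul, Real.norm_of_nonneg (by linarith : (0:ℝ) ≤ 1 - δ),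
        Real.norm_of_nonneg χ.nonneg]
      have e2 : ‖ρ g.1 • g.1 + W g‖ ≤ 1 + δ := by
        by_cases hg : g.1 ∈ Metric.ball (0 : Plane n) 1
        · rw [ρ.one_of_mem_closedBall (Metric.ball_subset_closedBall hg), one_smul]
          exact (hWn g hg).trans (by linarith)
        · have hg1 : 1 ≤ ‖g.1‖ := by simpa using hg
          rw [hW0 g (hr1.le.trans hg1), add_zero, norm_smul, Real.norm_of_nonneg ρ.nonneg]
          by_cases hg2 : 1 + δ ≤ ‖g.1‖
          · rw [hρ0 _ hg2, zero_mul]; linarith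
          · rw [not_le] at hg2
            exact (mul_le_of_le_one_left (norm_nonneg _) ρ.le_one).trans hg2.le
      have e4 : χ g.2 * ‖ρ g.1 • g.1 + W g‖ ≤ 1 + δ :=
        (mul_le_of_le_one_left (norm_nonneg _) χ.le_one).trans e2
      calc (1 - δ) * (χ g.2 * ‖ρ g.1 • g.1 + W g‖) ≤ (1 - δ) * (1 + δ) :=
            mul_le_mul_of_nonneg_left e4 (by linarith)
        _ ≤ 1 := by nlinarith
    have hdiv : ∀ g, divH (fun j (g : Point n) => ((1 - δ) • (Z₁ g + Z₂ g)) j) g =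
        (1 - δ) * (divH (fun j g => Z₁ g j) g + divH (fun j g => Z₂ g j) g) := by
      intro g
      unfold divH
      rw [← Finset.sum_add_distrib, Finset.mul_sum]
      refine Finset.sum_congr rfl fun j _ => ?_
      have d1 := (contDiff_component hZ₁C j).differentiable one_ne_zero g
      have d2 := (contDiff_component hZ₂C j).differentiable one_ne_zero g
      simp only [hsum]
      rw [fderiv_const_mul (d1.fun_add d2) (1 - δ), fderiv_fun_add d1 d2]
      simp [mul_add]
    have hdiv₁ : ∀ g ∈ E, divH (fun j g => Z₁ g j) g = 2 * n := by
      intro g hg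
      have hnear : Z₁ =ᶠ[nhds g] fun g => g.1 := by
        have h1 : ∀ᶠ p : Point n in nhds g, p.1 ∈ Metric.ball (0 : Plane n) 1 :=
          (continuous_fst.tendsto g).eventually
            (Metric.isOpen_ball.mem_nhds (h.fst_mem_ball hg))
        have h2 : ∀ᶠ p : Point n in nhds g, |p.2| < M :=
          (continuous_abs.comp continuous_snd).continuousAt.eventually (gt_mem_nhds (hEM g hg))
        filter_upwards [h1, h2] with p hp1 hp2
        simp only [hZ₁]
        rw [hχ1 _ hp2.le, ρ.one_of_mem_closedBall (Metric.ball_subset_closedBall hp1)]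
        simp
      have : ∀ j, fderiv ℝ (fun g => Z₁ g j) g (horizontalField j g) = 1 := by
        intro j
        have h3 : (fun g => Z₁ g j) =ᶠ[nhds g] fun g => g.1 j := by
          filter_upwards [hnear] with p hp
          rw [hp]
        have h4 : HasFDerivAt (fun g : Point n => g.1 j)
            ((EuclideanSpace.proj j : Plane n →L[ℝ] ℝ).comp
              (ContinuousLinearMap.fst ℝ (Plane n) ℝ)) g :=
          ((EuclideanSpace.proj j : Plane n →L[ℝ] ℝ).comp
              (ContinuousLinearMap.fst ℝ (Plane n) ℝ)).hasFDerivAt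
        rw [h3.fderiv_eq, h4.fderiv]
        simp [horizontalField]
      unfold divH
      simp only [this]
      simp; ring
    have hI₁ := integrable_divH' (contDiff_component hZ₁C) (hasCompactSupport_component hZ₁c)
    have hI₂ := integrable_divH' (contDiff_component hZ₂C) (hasCompactSupport_component hZ₂c)
    have hval : ∫ g in E, divH (fun j (g : Point n) => ((1 - δ) • (Z₁ g + Z₂ g)) j) g =
        (1 - δ) * (2 * n * (volume E).toReal + X) := by
      simp only [hdiv]
      rw [integral_const_mul, integral_add hI₁.integrableOn hI₂.integrableOn, hint₂,
        setIntegral_congr_fun h.isOpen.measurableSet hdiv₁]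
      simp [Measure.real, mul_comm]
    rw [← hval]
    exact le_iSup₂ (f := fun ζ (_ : ζ ∈ testFields n) =>
      ENNReal.ofReal (∫ g in E, divH ζ g)) _ hmem
  have hlim : Filter.Tendsto
      (fun δ : ℝ => ENNReal.ofReal ((1 - δ) * (2 * n * (volume E).toReal + X)))
      (nhdsWithin 0 (Set.Ioi 0)) (nhds (ENNReal.ofReal (2 * n * (volume E).toReal + X))) := by
    have : Filter.Tendsto (fun δ : ℝ => (1 - δ) * (2 * n * (volume E).toReal + X))
        (nhds 0) (nhds ((1 - 0) * (2 * n * (volume E).toReal + X))) :=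
      Continuous.tendsto (by fun_prop) 0
    rw [sub_zero, one_mul] at this
    exact (ENNReal.continuous_ofReal.tendsto _).comp (this.mono_left nhdsWithin_le_nhds)
  refine le_of_tendsto hlim ?_
  filter_upwards [Ioo_mem_nhdsGT (zero_lt_one' ℝ)] with δ hδ
  exact key δ hδ.1 hδ.2

/-! ### Calibration by the foliation of the vertical cylinder -/

/-- A smooth truncation of `s ↦ √((1 - s) / s)` to a compact subset of `(0, 1)`. -/
def cutCoeff (k s : ℝ) : ℝ :=
  Real.smoothTransition (k * s - 1) * Real.smoothTransition (k * (1 - s) - 1) *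
    Real.sqrt ((1 - s) / s)

theorem cutCoeff_nonneg (k s : ℝ) : 0 ≤ cutCoeff k s :=
  mul_nonneg (mul_nonneg (Real.smoothTransition.nonneg _) (Real.smoothTransition.nonneg _))
    (Real.sqrt_nonneg _)

theorem cutCoeff_le (k s : ℝ) : cutCoeff k s ≤ Real.sqrt ((1 - s) / s) :=
  mul_le_of_le_one_left (Real.sqrt_nonneg _)
    (mul_le_one₀ (Real.smoothTransition.le_one _) (Real.smoothTransition.nonneg _)
      (Real.smoothTransition.le_one _))

theorem cutCoeff_eq_zero {k s : ℝ} (h : k * s ≤ 1 ∨ k * (1 - s) ≤ 1) : cutCoeff k s = 0 := by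
  unfold cutCoeff
  rcases h with h | h
  · rw [Real.smoothTransition.zero_of_nonpos (by linarith : k * s - 1 ≤ 0)]; simp
  · rw [Real.smoothTransition.zero_of_nonpos (by linarith : k * (1 - s) - 1 ≤ 0)]; simp

theorem cutCoeff_eq {k s : ℝ} (h : 2 ≤ k * s) (h' : 2 ≤ k * (1 - s)) :
    cutCoeff k s = Real.sqrt ((1 - s) / s) := by
  unfold cutCoeff
  rw [Real.smoothTransition.one_of_one_le (by linarith),
    Real.smoothTransition.one_of_one_le (by linarith)]
  simp

theorem contDiff_cutCoeff {k : ℝ} (hk : 0 < k) : ContDiff ℝ 1 (cutCoeff k) := by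
  have hS := Real.smoothTransition.contDiff (n := 1)
  refine contDiff_iff_contDiffAt.2 fun s => ?_
  by_cases h : 0 < s ∧ s < 1
  · refine ContDiffAt.mul (ContDiffAt.mul ?_ ?_) ?_
    · exact (hS.comp (by fun_prop)).contDiffAt
    · exact (hS.comp (by fun_prop)).contDiffAt
    · have : 0 < (1 - s) / s := div_pos (by linarith [h.2]) h.1
      exact ((contDiffAt_const.sub contDiffAt_id).div contDiffAt_id h.1.ne').sqrt this.ne'
  · have hev : cutCoeff k =ᶠ[nhds s] fun _ => 0 := by
      have h' : s ≤ 0 ∨ 1 ≤ s := by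
        by_contra hc; push Not at hc; exact h hc
      rcases h' with h1 | h1
      · have : ∀ᶠ x in nhds s, k * x < 1 := by
          have hc : ContinuousAt (fun x : ℝ => k * x) s := by fun_prop
          exact hc.eventually (gt_mem_nhds (by nlinarith))
        filter_upwards [this] with x hx
        exact cutCoeff_eq_zero (Or.inl hx.le)
      · have : ∀ᶠ x in nhds s, k * (1 - x) < 1 := by
          have hc : ContinuousAt (fun x : ℝ => k * (1 - x)) s := by fun_prop
          exact hc.eventually (gt_mem_nhds (by nlinarith))
        filter_upwards [this] with x hx
        exact cutCoeff_eq_zero (Or.inr hx.le)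
    exact contDiffAt_const.congr_of_eventuallyEq hev

/-- The truncated rotational part of the calibrating field. -/
def cutField {n : ℕ} (k : ℝ) (z : Plane n) : Plane n := cutCoeff k (‖z‖ ^ 2) • rotJ n z

theorem contDiff_cutField {n : ℕ} {k : ℝ} (hk : 0 < k) :
    ContDiff ℝ 1 (cutField k : Plane n → Plane n) :=
  ((contDiff_cutCoeff hk).comp (contDiff_norm_sq ℝ)).smul (rotJ n).contDiff

theorem cutField_eq_zero {n : ℕ} {k : ℝ} {z : Plane n} (h : 1 - k⁻¹ ≤ ‖z‖ ^ 2) (hk : 0 < k) :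
    cutField k z = 0 := by
  unfold cutField
  rw [cutCoeff_eq_zero, zero_smul]
  right
  calc k * (1 - ‖z‖ ^ 2) ≤ k * k⁻¹ := by gcongr; linarith
    _ = 1 := mul_inv_cancel₀ hk.ne'

theorem tsupport_cutField {n : ℕ} {k : ℝ} (hk : 0 < k) :
    tsupport (cutField k : Plane n → Plane n) ⊆ {z | ‖z‖ ^ 2 ≤ 1 - k⁻¹} := by
  refine closure_minimal ?_ (isClosed_le (by fun_prop) continuous_const)
  intro z hz
  by_contra h
  simp only [Set.mem_ofPred_eq, not_le] at h
  exact hz (cutField_eq_zero h.le hk)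

theorem tsupport_cutField_subset_ball {n : ℕ} {k : ℝ} (hk : 0 < k) :
    tsupport (cutField k : Plane n → Plane n) ⊆ Metric.ball 0 1 := by
  intro z hz
  have h := tsupport_cutField hk hz
  have hk' : 0 < k⁻¹ := by positivity
  simp only [Set.mem_ofPred_eq] at h
  rw [mem_ball_zero_iff]
  nlinarith [norm_nonneg z]

theorem hasCompactSupport_of_tsupport_subset_ball {n : ℕ} {W : Type*} [Zero W] {f : Plane n → W}
    {R : ℝ} (h : tsupport f ⊆ Metric.ball 0 R) : HasCompactSupport f :=
  (isCompact_closedBall (0 : Plane n) R).of_isClosed_subset (isClosed_tsupport f)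
    (h.trans Metric.ball_subset_closedBall)

/-- By Pythagoras |z + cJz|² = |z|²(1 + c²), and c = √((1-|z|²)/|z|²) is exactly the coefficient
that makes this 1. Truncation only lowers c. -/
theorem norm_add_cutField_le {n : ℕ} (k : ℝ) {z : Plane n} (hz : z ∈ Metric.ball (0 : Plane n) 1) :
    ‖z + cutField k z‖ ≤ 1 := by
  have hz1 : ‖z‖ < 1 := mem_ball_zero_iff.1 hz
  have h0 := norm_nonneg z
  have hsq : ‖z + cutField k z‖ ^ 2 = ‖z‖ ^ 2 * (1 + cutCoeff k (‖z‖ ^ 2) ^ 2) := by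
    rw [cutField, norm_add_sq_real, real_inner_smul_right, inner_self_rotJ, norm_smul,
      norm_rotJ, mul_pow, Real.norm_eq_abs, sq_abs]
    ring
  refine (sq_le_one_iff₀ (norm_nonneg _)).1 ?_
  rw [hsq]
  rcases h0.eq_or_lt with h | h
  · rw [← h]; simp
  · have h1 : cutCoeff k (‖z‖ ^ 2) ^ 2 ≤ (1 - ‖z‖ ^ 2) / ‖z‖ ^ 2 := by
      have h2 : 0 ≤ (1 - ‖z‖ ^ 2) / ‖z‖ ^ 2 := div_nonneg (by nlinarith) (by positivity)
      rw [← Real.sq_sqrt h2]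
      exact pow_le_pow_left₀ (cutCoeff_nonneg _ _) (cutCoeff_le _ _) 2
    calc ‖z‖ ^ 2 * (1 + cutCoeff k (‖z‖ ^ 2) ^ 2)
        ≤ ‖z‖ ^ 2 * (1 + (1 - ‖z‖ ^ 2) / ‖z‖ ^ 2) := by gcongr
      _ = 1 := by field_simp; ring

/-- The horizontal unit normal of the leaves of the foliation of the upper half cylinder (`σ = 1`)
and of the lower half cylinder (`σ = -1`). -/
def leafNormal {n : ℕ} (σ : ℝ) (z : Plane n) : Plane n :=
  z + (σ * Real.sqrt ((1 - ‖z‖ ^ 2) / ‖z‖ ^ 2)) • rotJ n z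

theorem integrable_fderiv_pairing {n : ℕ} {u : Plane n → ℝ}
    (hu : ContDiffOn ℝ 1 u (Metric.ball 0 1)) {α : Plane n → Plane n} (hα : Continuous α)
    (hs : tsupport α ⊆ Metric.ball 0 1) : Integrable fun z => fderiv ℝ u z (α z) := by
  obtain ⟨r, hr0, hr1, hαr⟩ := exists_norm_lt_of_tsupport
    (hasCompactSupport_of_tsupport_subset_ball hs) hs
  obtain ⟨U, hU, hUu⟩ := exists_contDiff_extension hu hr0 hr1
  have hd := hU.continuous_fderiv one_ne_zero
  have heq : (fun z => fderiv ℝ u z (α z)) = fun z => fderiv ℝ U z (α z) := by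
    ext z
    by_cases hz : z ∈ tsupport α
    · have hz' := mem_ball_zero_iff.2 (hαr z hz)
      rw [Filter.EventuallyEq.fderiv_eq (hUu.eventuallyEq_of_mem (Metric.isOpen_ball.mem_nhds hz'))]
    · simp [image_eq_zero_of_notMem_tsupport hz]
  rw [heq]
  refine Continuous.integrable_of_hasCompactSupport (by fun_prop) ?_
  refine (hasCompactSupport_of_tsupport_subset_ball hs).mono fun z hz h0 => ?_
  simp at hz
  simp [h0] at hz

theorem integrable_inner_rotJ {n : ℕ} {α : Plane n → Plane n} (hα : Continuous α)
    (hc : HasCompactSupport α) : Integrable fun z => inner ℝ (α z) (rotJ n z) / 2 := by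
  refine Continuous.integrable_of_hasCompactSupport (by fun_prop) ?_
  refine hc.mono fun z hz h0 => ?_
  simp at hz
  simp [h0] at hz

/-- A field c(|z|²) Jz is divergence free: J has zero diagonal, and differentiating c yields a
multiple of ⟨z, Jz⟩ = 0. Integration by parts therefore kills the pairing with ∇u, which is why the
shape of the profiles does not enter the lower bound. -/
theorem integral_fderiv_cutField {n : ℕ} {u : Plane n → ℝ}
    (hu : ContDiffOn ℝ 1 u (Metric.ball 0 1)) {k : ℝ} (hk : 0 < k) :
    ∫ z, fderiv ℝ u z (cutField k z) = 0 := by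
  have hs := tsupport_cutField_subset_ball (n := n) hk
  obtain ⟨r, hr0, hr1, hαr⟩ := exists_norm_lt_of_tsupport
    (hasCompactSupport_of_tsupport_subset_ball hs) hs
  obtain ⟨U, hU, hUu⟩ := exists_contDiff_extension hu hr0 hr1
  have hcf := contDiff_cutField (n := n) hk
  have hpt : ∀ z, fderiv ℝ u z (cutField k z) =
      ∑ j, fderiv ℝ (fun z => cutField k z j * U z) z (basisVec j) := by
    intro z
    have h1 : fderiv ℝ u z (cutField k z) = fderiv ℝ U z (cutField k z) := by
      by_cases hz : z ∈ tsupport (cutField k : Plane n → Plane n)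
      · have hz' := mem_ball_zero_iff.2 (hαr z hz)
        rw [Filter.EventuallyEq.fderiv_eq
          (hUu.eventuallyEq_of_mem (Metric.isOpen_ball.mem_nhds hz'))]
      · simp [image_eq_zero_of_notMem_tsupport hz]
    rw [h1]
    have hb := ((contDiff_cutCoeff hk).differentiable one_ne_zero (‖z‖ ^ 2)).hasDerivAt
    have hn : HasFDerivAt (fun z : Plane n => ‖z‖ ^ 2) (2 • innerSL ℝ z) z :=
      (hasStrictFDerivAt_norm_sq z).hasFDerivAt
    have hcomp := hb.comp_hasFDerivAt z hn
    have hUd := (hU.differentiable one_ne_zero z).hasFDerivAt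
    have h2 : ∀ j, fderiv ℝ (fun z => cutField k z j * U z) z (basisVec j) =
        cutField k z j * fderiv ℝ U z (basisVec j) +
          U z * (deriv (cutCoeff k) (‖z‖ ^ 2) * 2 * (z j * rotJ n z j)) := by
      intro j
      have hJ : HasFDerivAt (fun z : Plane n => rotJ n z j)
          ((EuclideanSpace.proj j : Plane n →L[ℝ] ℝ).comp (rotJ n)) z :=
        ((EuclideanSpace.proj j : Plane n →L[ℝ] ℝ).comp (rotJ n)).hasFDerivAt
      have h3 := (hcomp.mul hJ).mul hUd
      have h4 : HasFDerivAt (fun z => cutField k z j * U z) _ z := h3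
      rw [h4.fderiv]
      simp [cutField, EuclideanSpace.inner_single_right]
      left; ring
    simp only [h2]
    rw [Finset.sum_add_distrib, sum_mul_clm_basisVec, ← Finset.mul_sum, ← Finset.mul_sum,
      ← inner_eq_sum, inner_self_rotJ]
    simp
  simp only [hpt]
  have hC : ∀ j, ContDiff ℝ 1 (fun z => cutField k z j * U z) := fun j =>
    (contDiff_component hcf j).mul hU
  have hS : ∀ j, HasCompactSupport (fun z : Plane n => cutField k z j * U z) := fun j =>
    (hasCompactSupport_component (hasCompactSupport_of_tsupport_subset_ball hs) j).mul_right
  rw [integral_finsetSum]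
  · exact Finset.sum_eq_zero fun j _ => integral_fderiv_apply_eq_zero (hC j) (hS j) _
  · intro j _
    exact Continuous.integrable_of_hasCompactSupport
      (((hC j).continuous_fderiv one_ne_zero).clm_apply continuous_const)
      ((hS j).fderiv_apply (𝕜 := ℝ) _)

/-- The flux of the calibrating fields through the unit disc. -/
def discFlux (n : ℕ) : ℝ :=
  ∫ z in Metric.ball (0 : Plane n) 1, ‖z‖ * Real.sqrt (1 - ‖z‖ ^ 2)

theorem inner_cutField_rotJ {n : ℕ} (k : ℝ) (z : Plane n) :
    inner ℝ (cutField k z) (rotJ n z) = cutCoeff k (‖z‖ ^ 2) * ‖z‖ ^ 2 := by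
  rw [cutField, real_inner_smul_left, inner_rotJ_rotJ, real_inner_self_eq_norm_sq]

theorem sqrt_div_mul_sq {s : ℝ} (hs : 0 ≤ s) :
    Real.sqrt ((1 - s ^ 2) / s ^ 2) * s ^ 2 = s * Real.sqrt (1 - s ^ 2) := by
  rcases hs.eq_or_lt with h | h
  · simp [← h]
  · rw [Real.sqrt_div' _ (by positivity), Real.sqrt_sq hs]; field_simp

theorem tendsto_integral_cutField (n : ℕ) :
    Filter.Tendsto (fun k : ℕ => ∫ z : Plane n, inner ℝ (cutField (k + 1) z) (rotJ n z))
      Filter.atTop (nhds (discFlux n)) := by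
  unfold discFlux
  rw [← integral_indicator Metric.isOpen_ball.measurableSet]
  refine tendsto_integral_of_dominated_convergence
    ((Metric.ball (0 : Plane n) 1).indicator fun _ => 1) ?_ ?_ ?_ ?_
  · intro k
    have := (contDiff_cutField (n := n) (k := (k : ℝ) + 1) (by positivity)).continuous
    exact (by fun_prop : Continuous _).aestronglyMeasurable
  · rw [integrable_indicator_iff Metric.isOpen_ball.measurableSet]
    exact integrableOn_const (measure_ball_lt_top.ne)
  · intro k
    refine Filter.Eventually.of_forall fun z => ?_
    have hk : (0 : ℝ) < k + 1 := by positivity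
    by_cases hz : z ∈ Metric.ball (0 : Plane n) 1
    · rw [Set.indicator_of_mem hz, inner_cutField_rotJ,
        Real.norm_of_nonneg (mul_nonneg (cutCoeff_nonneg _ _) (by positivity))]
      have hz1 : ‖z‖ < 1 := mem_ball_zero_iff.1 hz
      calc cutCoeff (k + 1) (‖z‖ ^ 2) * ‖z‖ ^ 2
          ≤ Real.sqrt ((1 - ‖z‖ ^ 2) / ‖z‖ ^ 2) * ‖z‖ ^ 2 := by
            gcongr; exact cutCoeff_le _ _
        _ = ‖z‖ * Real.sqrt (1 - ‖z‖ ^ 2) := sqrt_div_mul_sq (norm_nonneg z)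
        _ ≤ 1 * 1 := by
            refine mul_le_mul hz1.le ?_ (Real.sqrt_nonneg _) zero_le_one
            exact Real.sqrt_le_one.2 (by nlinarith [sq_nonneg ‖z‖])
        _ = 1 := one_mul 1
    · have : cutField ((k : ℝ) + 1) z = 0 :=
        image_eq_zero_of_notMem_tsupport fun hh => hz (tsupport_cutField_subset_ball hk hh)
      rw [this]; simp [hz]
  · refine Filter.Eventually.of_forall fun z => ?_
    by_cases hz : z ∈ Metric.ball (0 : Plane n) 1
    · rw [Set.indicator_of_mem hz]
      have hz1 : ‖z‖ < 1 := mem_ball_zero_iff.1 hz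
      simp only [inner_cutField_rotJ]
      rcases (norm_nonneg z).eq_or_lt with h | h
      · simp [← h]
      · have h1 : 0 < 1 - ‖z‖ ^ 2 := by nlinarith
        have h2 : 0 < ‖z‖ ^ 2 := by positivity
        have ha : ∀ᶠ k : ℕ in Filter.atTop, 2 / ‖z‖ ^ 2 ≤ (k : ℝ) :=
          tendsto_natCast_atTop_atTop.eventually_ge_atTop _
        have hb : ∀ᶠ k : ℕ in Filter.atTop, 2 / (1 - ‖z‖ ^ 2) ≤ (k : ℝ) :=
          tendsto_natCast_atTop_atTop.eventually_ge_atTop _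
        refine tendsto_const_nhds.congr' ?_
        filter_upwards [ha, hb] with k hka hkb
        rw [div_le_iff₀ h2] at hka
        rw [div_le_iff₀ h1] at hkb
        rw [cutCoeff_eq (by linarith) (by linarith), sqrt_div_mul_sq (norm_nonneg z)]
    · rw [Set.indicator_of_notMem hz]
      refine tendsto_const_nhds.congr fun k => ?_
      have : cutField ((k : ℝ) + 1) z = 0 :=
        image_eq_zero_of_notMem_tsupport fun hh =>
          hz (tsupport_cutField_subset_ball (by positivity) hh)
      rw [this]; simp

/-- On a compact set away from the origin and the sphere the truncation is eventually inactive. A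
perturbation supported there can thus be compared with the exact unit normals. -/
theorem eventually_cutField_eq {n : ℕ} {K : Set (Plane n)} (hK : IsCompact K)
    (hKs : K ⊆ Metric.ball 0 1 \ {0}) :
    ∀ᶠ k : ℕ in Filter.atTop, ∀ z ∈ K,
      z + cutField ((k : ℝ) + 1) z = leafNormal 1 z ∧
      z - cutField ((k : ℝ) + 1) z = leafNormal (-1) z := by
  rcases K.eq_empty_or_nonempty with h | h
  · simp [h]
  obtain ⟨x, hx, hmax⟩ := hK.exists_isMaxOn h continuous_norm.continuousOn
  obtain ⟨y, hy, hmin⟩ := hK.exists_isMinOn h continuous_norm.continuousOn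
  have hx1 : ‖x‖ < 1 := mem_ball_zero_iff.1 (hKs hx).1
  have hy0 : 0 < ‖y‖ := norm_pos_iff.2 (hKs hy).2
  have h1 : 0 < 1 - ‖x‖ ^ 2 := by nlinarith [norm_nonneg x]
  have h2 : 0 < ‖y‖ ^ 2 := by positivity
  have ha : ∀ᶠ k : ℕ in Filter.atTop, 2 / ‖y‖ ^ 2 ≤ (k : ℝ) :=
    tendsto_natCast_atTop_atTop.eventually_ge_atTop _
  have hb : ∀ᶠ k : ℕ in Filter.atTop, 2 / (1 - ‖x‖ ^ 2) ≤ (k : ℝ) :=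
    tendsto_natCast_atTop_atTop.eventually_ge_atTop _
  filter_upwards [ha, hb] with k hka hkb z hz
  have hzx : ‖z‖ ≤ ‖x‖ := hmax hz
  have hzy : ‖y‖ ≤ ‖z‖ := hmin hz
  rw [div_le_iff₀ h2] at hka
  rw [div_le_iff₀ h1] at hkb
  have e1 : ‖y‖ ^ 2 ≤ ‖z‖ ^ 2 := by gcongr
  have e2 : ‖z‖ ^ 2 ≤ ‖x‖ ^ 2 := by gcongr
  have hk0 : (0 : ℝ) ≤ k := by positivity
  have := cutCoeff_eq (k := k + 1) (s := ‖z‖ ^ 2) (by nlinarith) (by nlinarith)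
  simp only [cutField, leafNormal, this]
  constructor
  · rw [one_mul]
  · rw [neg_one_mul, neg_smul, sub_eq_add_neg]

/-- Take α = `cutField` + γ₁ above and β = -`cutField` + γ₂ below, the signs following the opposite
orientations of the two graphs. Each rotational part contributes half of the flux, and removing the
truncation turns the sum into `discFlux`. The bound itself needs only γ₁ = γ₂ = 0; the perturbations
are kept for the equality case. -/
theorem IsLens.calibration {n : ℕ} {u v : Plane n → ℝ} {E : Set (Point n)}
    (h : IsLens 1 u v E) {γ₁ γ₂ : Plane n → Plane n} (hγ₁ : ContDiff ℝ 1 γ₁)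
    (hγ₂ : ContDiff ℝ 1 γ₂) (hs₁ : tsupport γ₁ ⊆ Metric.ball 0 1 \ {0})
    (hs₂ : tsupport γ₂ ⊆ Metric.ball 0 1 \ {0})
    (hn₁ : ∀ z ∈ tsupport γ₁, ‖leafNormal 1 z + γ₁ z‖ ≤ 1)
    (hn₂ : ∀ z ∈ tsupport γ₂, ‖leafNormal (-1) z + γ₂ z‖ ≤ 1) :
    ENNReal.ofReal (2 * n * (volume E).toReal + discFlux n +
      ((∫ z, (inner ℝ (γ₁ z) (rotJ n z) / 2 - fderiv ℝ u z (γ₁ z))) -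
        ∫ z, (inner ℝ (γ₂ z) (rotJ n z) / 2 + fderiv ℝ v z (γ₂ z)))) ≤ perimeterH E := by
  have hu := h.fst.contDiffOn.of_le one_le_two
  have hv := h.snd.contDiffOn.of_le one_le_two
  have hb₁ : tsupport γ₁ ⊆ Metric.ball 0 1 := hs₁.trans Set.sdiff_subset
  have hb₂ : tsupport γ₂ ⊆ Metric.ball 0 1 := hs₂.trans Set.sdiff_subset
  have hc₁ := hasCompactSupport_of_tsupport_subset_ball hb₁
  have hc₂ := hasCompactSupport_of_tsupport_subset_ball hb₂
  set G := (∫ z, (inner ℝ (γ₁ z) (rotJ n z) / 2 - fderiv ℝ u z (γ₁ z))) -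
        ∫ z, (inner ℝ (γ₂ z) (rotJ n z) / 2 + fderiv ℝ v z (γ₂ z)) with hG
  have key : ∀ᶠ k : ℕ in Filter.atTop, ENNReal.ofReal (2 * n * (volume E).toReal +
      (∫ z : Plane n, inner ℝ (cutField ((k : ℝ) + 1) z) (rotJ n z)) + G) ≤ perimeterH E := by
    filter_upwards [eventually_cutField_eq hc₁.isCompact hs₁,
      eventually_cutField_eq hc₂.isCompact hs₂] with k hk₁ hk₂
    have hk : (0 : ℝ) < k + 1 := by positivity
    have hcf := contDiff_cutField (n := n) hk
    have hcs := tsupport_cutField_subset_ball (n := n) hk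
    have hcc := hasCompactSupport_of_tsupport_subset_ball hcs
    have hns : tsupport (fun z : Plane n => -cutField ((k : ℝ) + 1) z) ⊆ Metric.ball 0 1 := by
      have : Function.support (fun z : Plane n => -cutField ((k : ℝ) + 1) z) =
          Function.support (cutField ((k : ℝ) + 1) : Plane n → Plane n) := by
        ext z; simp
      rw [tsupport, this]; exact hcs
    have hmain := h.ofReal_le_perimeterH (α := fun z => cutField ((k : ℝ) + 1) z + γ₁ z)
      (β := fun z => -cutField ((k : ℝ) + 1) z + γ₂ z) (hcf.add hγ₁) (hcf.neg.add hγ₂)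
      (hcc.add hc₁) ((hasCompactSupport_of_tsupport_subset_ball hns).add hc₂)
      ((tsupport_add _ _).trans (Set.union_subset hcs hb₁))
      ((tsupport_add _ _).trans (Set.union_subset hns hb₂))
      (fun z hz => by
        by_cases hz₁ : z ∈ tsupport γ₁
        · rw [← add_assoc, (hk₁ z hz₁).1]; exact hn₁ z hz₁
        · rw [image_eq_zero_of_notMem_tsupport hz₁, add_zero]
          exact norm_add_cutField_le _ hz)
      (fun z hz => by
        by_cases hz₂ : z ∈ tsupport γ₂
        · rw [← add_assoc, ← sub_eq_add_neg, (hk₂ z hz₂).2]; exact hn₂ z hz₂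
        · rw [image_eq_zero_of_notMem_tsupport hz₂, add_zero]
          have h1 := norm_add_cutField_le ((k : ℝ) + 1) (z := z) hz
          have h2 : ‖z + -cutField ((k : ℝ) + 1) z‖ ^ 2 = ‖z + cutField ((k : ℝ) + 1) z‖ ^ 2 := by
            rw [norm_add_sq_real, norm_add_sq_real, inner_neg_right, norm_neg, cutField,
              real_inner_smul_right, inner_self_rotJ]
            simp
          rwa [(sq_eq_sq₀ (norm_nonneg _) (norm_nonneg _)).1 h2])
    convert hmain using 2
    rw [add_assoc]
    congr 1
    have i1 := integrable_inner_rotJ hcf.continuous hcc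
    have i2 := integrable_inner_rotJ hγ₁.continuous hc₁
    have i3 := integrable_inner_rotJ hγ₂.continuous hc₂
    have d1 := integrable_fderiv_pairing hu hγ₁.continuous hb₁
    have d2 := integrable_fderiv_pairing hv hγ₂.continuous hb₂
    have d3 := integrable_fderiv_pairing hu hcf.continuous hcs
    have d4 := integrable_fderiv_pairing hv hcf.continuous hcs
    have z1 := integral_fderiv_cutField hu hk
    have z2 := integral_fderiv_cutField hv hk
    have a1 : Integrable fun z => inner ℝ (cutField ((k : ℝ) + 1) z) (rotJ n z) / 2 -
        fderiv ℝ u z (cutField ((k : ℝ) + 1) z) := i1.sub d3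
    have a2 : Integrable fun z => inner ℝ (γ₁ z) (rotJ n z) / 2 - fderiv ℝ u z (γ₁ z) := i2.sub d1
    have a3 : Integrable fun z => -(inner ℝ (cutField ((k : ℝ) + 1) z) (rotJ n z) / 2 +
        fderiv ℝ v z (cutField ((k : ℝ) + 1) z)) := (i1.add d4).neg
    have a4 : Integrable fun z => inner ℝ (γ₂ z) (rotJ n z) / 2 + fderiv ℝ v z (γ₂ z) := i3.add d2
    have s1 : (∫ z, (inner ℝ (cutField ((k : ℝ) + 1) z + γ₁ z) (rotJ n z) / 2 -
        fderiv ℝ u z (cutField ((k : ℝ) + 1) z + γ₁ z))) =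
        (∫ z, inner ℝ (cutField ((k : ℝ) + 1) z) (rotJ n z) / 2) +
          ∫ z, (inner ℝ (γ₁ z) (rotJ n z) / 2 - fderiv ℝ u z (γ₁ z)) := by
      have : ∀ z, inner ℝ (cutField ((k : ℝ) + 1) z + γ₁ z) (rotJ n z) / 2 -
          fderiv ℝ u z (cutField ((k : ℝ) + 1) z + γ₁ z) =
          (inner ℝ (cutField ((k : ℝ) + 1) z) (rotJ n z) / 2 -
            fderiv ℝ u z (cutField ((k : ℝ) + 1) z)) +
          (inner ℝ (γ₁ z) (rotJ n z) / 2 - fderiv ℝ u z (γ₁ z)) := by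
        intro z; rw [inner_add_left, map_add]; ring
      simp only [this]
      rw [integral_add a1 a2, integral_sub i1 d3, z1, sub_zero]
    have s2 : (∫ z, (inner ℝ (-cutField ((k : ℝ) + 1) z + γ₂ z) (rotJ n z) / 2 +
        fderiv ℝ v z (-cutField ((k : ℝ) + 1) z + γ₂ z))) =
        -(∫ z, inner ℝ (cutField ((k : ℝ) + 1) z) (rotJ n z) / 2) +
          ∫ z, (inner ℝ (γ₂ z) (rotJ n z) / 2 + fderiv ℝ v z (γ₂ z)) := by
      have : ∀ z, inner ℝ (-cutField ((k : ℝ) + 1) z + γ₂ z) (rotJ n z) / 2 +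
          fderiv ℝ v z (-cutField ((k : ℝ) + 1) z + γ₂ z) =
          -(inner ℝ (cutField ((k : ℝ) + 1) z) (rotJ n z) / 2 +
            fderiv ℝ v z (cutField ((k : ℝ) + 1) z)) +
          (inner ℝ (γ₂ z) (rotJ n z) / 2 + fderiv ℝ v z (γ₂ z)) := by
        intro z; rw [inner_add_left, map_add, inner_neg_left, map_neg]; ring
      simp only [this]
      rw [integral_add a3 a4, integral_neg, integral_add i1 d4, z2, add_zero]
    rw [s1, s2, hG, integral_div]
    ring
  refine le_of_tendsto ((ENNReal.continuous_ofReal.tendsto _).comp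
    (((tendsto_integral_cutField n).const_add _).add_const G)) key

/-- The unperturbed calibration: a lower bound that is affine in the volume and otherwise blind to u
and v. -/
theorem IsLens.ofReal_volume_add_discFlux_le {n : ℕ} {u v : Plane n → ℝ} {E : Set (Point n)}
    (h : IsLens 1 u v E) :
    ENNReal.ofReal (2 * n * (volume E).toReal + discFlux n) ≤ perimeterH E := by
  have h0 : tsupport (fun _ : Plane n => (0 : Plane n)) = ∅ := by
    rw [tsupport_eq_empty_iff]; rfl
  have := h.calibration (γ₁ := fun _ => 0) (γ₂ := fun _ => 0) contDiff_const contDiff_const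
    (by simp [h0]) (by simp [h0]) (by simp [h0]) (by simp [h0])
  simpa using this

/-! ### Rigidity -/

theorem norm_leafNormal {n : ℕ} {σ : ℝ} (hσ : σ ^ 2 = 1) {z : Plane n}
    (hz : z ∈ Metric.ball (0 : Plane n) 1 \ {0}) : ‖leafNormal σ z‖ = 1 := by
  have hz1 : ‖z‖ < 1 := mem_ball_zero_iff.1 hz.1
  have hz0 : 0 < ‖z‖ := norm_pos_iff.2 hz.2
  have h2 : 0 ≤ (1 - ‖z‖ ^ 2) / ‖z‖ ^ 2 := div_nonneg (by nlinarith) (by positivity)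
  have : ‖leafNormal σ z‖ ^ 2 = 1 := by
    rw [leafNormal, norm_add_sq_real, real_inner_smul_right, inner_self_rotJ, norm_smul,
      norm_rotJ, mul_pow, Real.norm_eq_abs, sq_abs, mul_pow, hσ, Real.sq_sqrt h2]
    field_simp; ring
  have h3 := norm_nonneg (leafNormal σ z)
  nlinarith

theorem contDiffAt_leafNormal {n : ℕ} (σ : ℝ) {z : Plane n}
    (hz : z ∈ Metric.ball (0 : Plane n) 1 \ {0}) : ContDiffAt ℝ 1 (leafNormal σ) z := by
  have hz1 : ‖z‖ < 1 := mem_ball_zero_iff.1 hz.1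
  have hz0 : 0 < ‖z‖ := norm_pos_iff.2 hz.2
  have h2 : 0 < (1 - ‖z‖ ^ 2) / ‖z‖ ^ 2 := div_pos (by nlinarith) (by positivity)
  have hn : ContDiffAt ℝ 1 (fun z : Plane n => ‖z‖ ^ 2) z := (contDiff_norm_sq ℝ).contDiffAt
  have hs : ContDiffAt ℝ 1 (fun z : Plane n => Real.sqrt ((1 - ‖z‖ ^ 2) / ‖z‖ ^ 2)) z :=
    ((contDiffAt_const.sub hn).div hn (by positivity)).sqrt h2.ne'
  exact contDiffAt_id.add ((contDiffAt_const.mul hs).smul (rotJ n).contDiff.contDiffAt)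

/-- If no admissible perturbation of the unit field `ν` increases the pairing with `ℓ`, then `ℓ`
vanishes on the orthogonal complement of `ν`. -/
theorem apply_eq_zero_of_forall_integral_nonpos {n : ℕ} {O : Set (Plane n)} (hO : IsOpen O)
    {ν : Plane n → Plane n} (hν : ∀ z ∈ O, ContDiffAt ℝ 1 ν z) (hν1 : ∀ z ∈ O, ‖ν z‖ = 1)
    {l : Plane n → Plane n →L[ℝ] ℝ} (hl : ContinuousOn l O)
    (h : ∀ γ : Plane n → Plane n, ContDiff ℝ 1 γ → tsupport γ ⊆ O →
      (∀ z ∈ tsupport γ, ‖ν z + γ z‖ ≤ 1) → ∫ z, l z (γ z) ≤ 0)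
    {z₀ : Plane n} (hz₀ : z₀ ∈ O) {T : Plane n} (hT : inner ℝ (ν z₀) T = 0) : l z₀ T = 0 := by
  by_contra hne
  set F := (InnerProductSpace.toDual ℝ (Plane n)).symm (l z₀) with hF
  have hFl : ∀ w, l z₀ w = inner ℝ F w := fun w => by
    rw [hF, InnerProductSpace.toDual_symm_apply]
  have hF0 : F ≠ 0 := by
    intro h0; apply hne; rw [hFl, h0, inner_zero_left]
  have hFn : 0 < ‖F‖ := norm_pos_iff.2 hF0
  -- The unit vector at which ℓ(z₀) is largest. Moving ν towards e stays in the unit ball by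
  -- convexity and increases ℓ unless ν(z₀) already equals e.
  set e := ‖F‖⁻¹ • F with he
  have he1 : ‖e‖ = 1 := norm_smul_inv_norm hF0
  have hgap : 0 < l z₀ (e - ν z₀) := by
    rw [hFl, inner_sub_right, sub_pos, he, real_inner_smul_right, real_inner_self_eq_norm_sq]
    have h1 : ‖F‖⁻¹ * ‖F‖ ^ 2 = ‖F‖ * ‖ν z₀‖ := by rw [hν1 z₀ hz₀]; field_simp
    rw [h1]
    -- Equality in Cauchy-Schwarz would make F a multiple of ν(z₀), hence orthogonal to T, and ℓ(T)
    -- would vanish after all.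
    refine lt_of_le_of_ne (real_inner_le_norm _ _) fun h2 => ?_
    rw [inner_eq_norm_mul_iff_real, hν1 z₀ hz₀, one_smul] at h2
    apply hne
    rw [hFl, h2, real_inner_smul_left, hT, mul_zero]
  have hcont : ContinuousOn (fun z => l z (e - ν z)) O :=
    hl.clm_apply (continuousOn_const.sub fun z hz => (hν z hz).continuousAt.continuousWithinAt)
  have hev : ∀ᶠ z in nhds z₀, z ∈ O ∧ 0 < l z (e - ν z) :=
    Filter.Eventually.and (hO.mem_nhds hz₀)
      ((hcont.continuousAt (hO.mem_nhds hz₀)).eventually (lt_mem_nhds hgap))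
  obtain ⟨ε, hε, hball⟩ := Metric.eventually_nhds_iff_ball.1 hev
  let η : ContDiffBump z₀ := ⟨ε / 4, ε / 2, by linarith, by linarith⟩
  have hclosed : Metric.closedBall z₀ (ε / 2) ⊆ Metric.ball z₀ ε :=
    Metric.closedBall_subset_ball (by linarith)
  set γ : Plane n → Plane n := fun z => η z • (e - ν z) with hγ
  have hts : tsupport γ ⊆ Metric.closedBall z₀ (ε / 2) := by
    have := tsupport_smul_subset_left (fun z => η z) (fun z => e - ν z)
    rwa [η.tsupport_eq] at this
  have hγC : ContDiff ℝ 1 γ := by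
    refine contDiff_of_contDiffAt_tsupport fun z hz => ?_
    exact η.contDiffAt.smul (contDiffAt_const.sub (hν z (hball z (hclosed (hts hz))).1))
  have hγn : ∀ z ∈ tsupport γ, ‖ν z + γ z‖ ≤ 1 := by
    intro z hz
    have h1 : ν z + γ z = (1 - η z) • ν z + η z • e := by simp only [hγ]; module
    rw [h1]
    refine (norm_add_le _ _).trans ?_
    rw [norm_smul, norm_smul, he1, hν1 z (hball z (hclosed (hts hz))).1,
      Real.norm_of_nonneg η.nonneg, Real.norm_of_nonneg (sub_nonneg.2 η.le_one)]
    linarith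
  have hle := h γ hγC (fun z hz => (hball z (hclosed (hts hz))).1) hγn
  have hval : ∀ z, l z (γ z) = η z * l z (e - ν z) := fun z => by
    simp only [hγ, map_smul, smul_eq_mul]
  have hsub : Function.support (fun z => l z (γ z)) ⊆ Metric.closedBall z₀ (ε / 2) := by
    intro z hz
    refine hts (subset_tsupport _ fun h0 => hz ?_)
    simp [h0]
  have hint : Integrable fun z => l z (γ z) := by
    rw [← integrableOn_iff_integrable_of_support_subset hsub]
    refine ContinuousOn.integrableOn_compact (isCompact_closedBall _ _) ?_
    exact (hl.mono fun z hz => (hball z (hclosed hz)).1).clm_apply hγC.continuous.continuousOn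
  have hnonneg : 0 ≤ fun z => l z (γ z) := by
    intro z
    by_cases hz : z ∈ Metric.ball z₀ ε
    · simp only [hval]
      exact mul_nonneg η.nonneg (hball z hz).2.le
    · have : z ∉ Function.support (fun z => l z (γ z)) := fun hh => hz (hclosed (hsub hh))
      rw [Function.notMem_support] at this
      simp [this]
  have hpos : 0 < ∫ z, l z (γ z) := by
    rw [integral_pos_iff_support_of_nonneg hnonneg hint]
    refine (Metric.measure_ball_pos volume z₀ (by linarith : (0:ℝ) < ε / 4)).trans_le
      (measure_mono ?_)
    intro z hz
    have h1 : η z = 1 := η.one_of_mem_closedBall (Metric.ball_subset_closedBall hz)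
    simp only [Function.mem_support, hval, h1, one_mul]
    exact (hball z (Metric.ball_subset_ball (by linarith) hz)).2.ne'
  linarith

theorem isOpen_punctured (n : ℕ) : IsOpen (Metric.ball (0 : Plane n) 1 \ {0}) :=
  Metric.isOpen_ball.sdiff isClosed_singleton

/-- The direction of the characteristic curves of the leaves. -/
def leafTangent {n : ℕ} (σ : ℝ) (z : Plane n) : Plane n :=
  Real.sqrt ((1 - ‖z‖ ^ 2) / ‖z‖ ^ 2) • z - σ • rotJ n z

theorem inner_leafNormal_leafTangent {n : ℕ} {σ : ℝ} (hσ : σ ^ 2 = 1) (z : Plane n) :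
    inner ℝ (leafNormal σ z) (leafTangent σ z) = 0 := by
  simp only [leafNormal, leafTangent, inner_add_left, inner_sub_right, real_inner_smul_left,
    real_inner_smul_right, inner_self_rotJ, inner_rotJ_self, inner_rotJ_rotJ]
  linear_combination (-(Real.sqrt ((1 - ‖z‖ ^ 2) / ‖z‖ ^ 2)) * inner ℝ z z) * hσ

/-- If the affine bound is attained, γ = 0 is optimal in the calibration, so the flux densities Jz/2
- ∇u and -(Jz/2 + ∇v) annihilate the orthogonal complements of the leaf normals. Pairing them with
the leaf tangents, for which ⟨Jz, T⟩ = -|z|² above and |z|² below, gives the two transport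
equations. -/
theorem IsLens.fderiv_leafTangent {n : ℕ} {u v : Plane n → ℝ} {E : Set (Point n)}
    (h : IsLens 1 u v E)
    (heq : perimeterH E = ENNReal.ofReal (2 * n * (volume E).toReal + discFlux n)) :
    (∀ z ∈ Metric.ball (0 : Plane n) 1 \ {0}, fderiv ℝ u z (leafTangent 1 z) = -‖z‖ ^ 2 / 2) ∧
      ∀ z ∈ Metric.ball (0 : Plane n) 1 \ {0},
        fderiv ℝ v z (leafTangent (-1) z) = -‖z‖ ^ 2 / 2 := by
  have h0 : tsupport (fun _ : Plane n => (0 : Plane n)) = ∅ := by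
    rw [tsupport_eq_empty_iff]; rfl
  have hX : 0 ≤ 2 * n * (volume E).toReal + discFlux n := by
    refine add_nonneg (by positivity) (setIntegral_nonneg Metric.isOpen_ball.measurableSet ?_)
    intro z _; positivity
  have hu := h.fst.contDiffOn.of_le one_le_two
  have hv := h.snd.contDiffOn.of_le one_le_two
  have hJ : Continuous fun z : Plane n => innerSL ℝ (rotJ n z) := by fun_prop
  constructor
  · intro z hz
    have := apply_eq_zero_of_forall_integral_nonpos (isOpen_punctured n)
      (ν := leafNormal 1) (fun z hz => contDiffAt_leafNormal 1 hz)
      (fun z hz => norm_leafNormal (one_pow 2) hz)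
      (l := fun z => (1 / 2 : ℝ) • innerSL ℝ (rotJ n z) - fderiv ℝ u z)
      ((hJ.const_smul (1 / 2 : ℝ)).continuousOn.sub
        ((hu.continuousOn_fderiv_of_isOpen Metric.isOpen_ball le_rfl).mono Set.sdiff_subset))
      (fun γ hγ hγs hγn => by
        have hc := h.calibration (γ₁ := γ) (γ₂ := fun _ => 0) hγ contDiff_const hγs
          (by simp [h0]) hγn (by simp [h0])
        rw [heq, ENNReal.ofReal_le_ofReal_iff hX] at hc
        simp only [inner_zero_left, map_zero, zero_div, add_zero, integral_zero, sub_zero] at hc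
        have : ∀ z, ((1 / 2 : ℝ) • innerSL ℝ (rotJ n z) - fderiv ℝ u z) (γ z) =
            inner ℝ (γ z) (rotJ n z) / 2 - fderiv ℝ u z (γ z) := by
          intro z; simp [real_inner_comm]; ring
        simp only [this]
        linarith) hz (T := leafTangent 1 z) (inner_leafNormal_leafTangent (one_pow 2) z)
    have h2 : inner ℝ (rotJ n z) (leafTangent 1 z) = -‖z‖ ^ 2 := by
      simp [leafTangent, inner_sub_right, real_inner_smul_right]
    simp [h2] at this
    linarith
  · intro z hz
    have := apply_eq_zero_of_forall_integral_nonpos (isOpen_punctured n)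
      (ν := leafNormal (-1)) (fun z hz => contDiffAt_leafNormal (-1) hz)
      (fun z hz => norm_leafNormal (by norm_num) hz)
      (l := fun z => -((1 / 2 : ℝ) • innerSL ℝ (rotJ n z) + fderiv ℝ v z))
      ((hJ.const_smul (1 / 2 : ℝ)).continuousOn.add
        ((hv.continuousOn_fderiv_of_isOpen Metric.isOpen_ball le_rfl).mono Set.sdiff_subset)).neg
      (fun γ hγ hγs hγn => by
        have hc := h.calibration (γ₁ := fun _ => 0) (γ₂ := γ) contDiff_const hγ
          (by simp [h0]) hγs (by simp [h0]) hγn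
        rw [heq, ENNReal.ofReal_le_ofReal_iff hX] at hc
        simp only [inner_zero_left, map_zero, zero_div, sub_zero, integral_zero, zero_sub] at hc
        have : ∀ z, (-((1 / 2 : ℝ) • innerSL ℝ (rotJ n z) + fderiv ℝ v z)) (γ z) =
            -(inner ℝ (γ z) (rotJ n z) / 2 + fderiv ℝ v z (γ z)) := by
          intro z; simp [real_inner_comm]; ring
        simp only [this, integral_neg]
        linarith) hz (T := leafTangent (-1) z)
        (inner_leafNormal_leafTangent (by norm_num) z)
    have h2 : inner ℝ (rotJ n z) (leafTangent (-1) z) = ‖z‖ ^ 2 := by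
      simp [leafTangent, inner_add_right, real_inner_smul_right]
    simp [h2] at this
    linarith

/-- The characteristic curve that starts at the origin in the direction `e`. -/
def characteristic {n : ℕ} (σ : ℝ) (e : Plane n) (s : ℝ) : Plane n :=
  Real.sin s • (Real.cos s • e - (σ * Real.sin s) • rotJ n e)

theorem norm_characteristic {n : ℕ} {σ : ℝ} (hσ : σ ^ 2 = 1) {e : Plane n} (he : ‖e‖ = 1)
    {s : ℝ} (hs : 0 ≤ Real.sin s) : ‖characteristic σ e s‖ = Real.sin s := by
  have : ‖Real.cos s • e - (σ * Real.sin s) • rotJ n e‖ ^ 2 = 1 := by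
    rw [norm_sub_sq_real, real_inner_smul_left, real_inner_smul_right, inner_self_rotJ, norm_smul,
      norm_smul, norm_rotJ, he, Real.norm_eq_abs, Real.norm_eq_abs]
    simp only [mul_one, mul_zero, sub_zero, sq_abs, mul_pow, hσ, one_mul]
    linarith [Real.sin_sq_add_cos_sq s]
  have h1 : ‖Real.cos s • e - (σ * Real.sin s) • rotJ n e‖ = 1 := by
    have := norm_nonneg (Real.cos s • e - (σ * Real.sin s) • rotJ n e)
    nlinarith
  rw [characteristic, norm_smul, h1, Real.norm_of_nonneg hs, mul_one]

/-- Since |z| = sin s along the curve, the coefficient √((1-|z|²)/|z|²) is cot s. The curves are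
arcs of circles of radius 1/2 through the origin, and they reach the unit sphere at s = π/2. -/
theorem hasDerivAt_characteristic {n : ℕ} {σ : ℝ} (hσ : σ ^ 2 = 1) {e : Plane n} (he : ‖e‖ = 1)
    {s : ℝ} (hs : s ∈ Set.Ioo 0 (Real.pi / 2)) :
    HasDerivAt (characteristic σ e) (leafTangent σ (characteristic σ e s)) s := by
  have hsin : 0 < Real.sin s := Real.sin_pos_of_pos_of_lt_pi hs.1 (by linarith [hs.2, Real.pi_pos])
  have hcos : 0 < Real.cos s := Real.cos_pos_of_mem_Ioo ⟨by linarith [hs.1, Real.pi_pos], hs.2⟩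
  have h1 : HasDerivAt (characteristic σ e)
      (Real.sin s • (-Real.sin s • e - (σ * Real.cos s) • rotJ n e) +
        Real.cos s • (Real.cos s • e - (σ * Real.sin s) • rotJ n e)) s :=
    (Real.hasDerivAt_sin s).smul (((Real.hasDerivAt_cos s).smul_const e).sub
      (((Real.hasDerivAt_sin s).const_mul σ).smul_const (rotJ n e)))
  convert h1 using 1
  have h2 : Real.sqrt ((1 - ‖characteristic σ e s‖ ^ 2) / ‖characteristic σ e s‖ ^ 2) =
      Real.cos s / Real.sin s := by
    rw [norm_characteristic hσ he hsin.le]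
    have : (1 - Real.sin s ^ 2) / Real.sin s ^ 2 = (Real.cos s / Real.sin s) ^ 2 := by
      rw [div_pow, Real.cos_sq']
    rw [this, Real.sqrt_sq (by positivity)]
  rw [leafTangent, h2]
  have h3 : rotJ n (characteristic σ e s) =
      Real.sin s • (Real.cos s • rotJ n e + (σ * Real.sin s) • e) := by
    simp [characteristic]
  have h4 : (Real.cos s / Real.sin s) • characteristic σ e s =
      Real.cos s • (Real.cos s • e - (σ * Real.sin s) • rotJ n e) := by
    rw [characteristic, smul_smul, div_mul_cancel₀ _ hsin.ne']
  rw [h3, h4]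
  have h5 : σ • Real.sin s • (Real.cos s • rotJ n e + (σ * Real.sin s) • e) =
      (σ * Real.sin s * Real.cos s) • rotJ n e + (σ ^ 2 * Real.sin s ^ 2) • e := by module
  rw [h5, hσ]
  module

/-- Along a characteristic curve u has derivative -(sin² s)/2, as does π/8 + (sin s cos s)/4 - s/4,
and both functions vanish at s = π/2. At the parameter s₀ = arcsin |z₀| the second one is the
extremal profile at z₀. -/
theorem eq_profile_of_fderiv_leafTangent {n : ℕ} (hn : 1 ≤ n) {σ : ℝ} (hσ : σ ^ 2 = 1)
    {u : Plane n → ℝ} (hu : IsProfile 1 u)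
    (h : ∀ z ∈ Metric.ball (0 : Plane n) 1 \ {0},
      fderiv ℝ u z (leafTangent σ z) = -‖z‖ ^ 2 / 2)
    {z₀ : Plane n} (hz₀ : z₀ ∈ Metric.ball (0 : Plane n) 1) : u z₀ = profile z₀ := by
  have hz1 : ‖z₀‖ < 1 := mem_ball_zero_iff.1 hz₀
  set s₀ := Real.arcsin ‖z₀‖ with hs₀
  have hsin0 : Real.sin s₀ = ‖z₀‖ :=
    Real.sin_arcsin (by linarith [norm_nonneg z₀]) hz1.le
  have hs0 : 0 ≤ s₀ := Real.arcsin_nonneg.2 (norm_nonneg _)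
  have hs1 : s₀ < Real.pi / 2 := Real.arcsin_lt_pi_div_two.2 hz1
  -- At z₀ = 0 every unit direction serves, and one exists because n ≥ 1.
  obtain ⟨d, hd, hzd⟩ : ∃ d : Plane n, ‖d‖ = 1 ∧ z₀ = ‖z₀‖ • d := by
    by_cases h0 : z₀ = 0
    · exact ⟨basisVec (Sum.inl ⟨0, hn⟩), by simp, by simp [h0]⟩
    · exact ⟨‖z₀‖⁻¹ • z₀, norm_smul_inv_norm h0, by
        rw [smul_smul, mul_inv_cancel₀ (norm_ne_zero_iff.2 h0), one_smul]⟩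
  -- The initial direction is d turned by the angle s₀, so that the curve issuing from 0 in
  -- direction e reaches z₀ at time s₀.
  set e := Real.cos s₀ • d + (σ * Real.sin s₀) • rotJ n d with he
  have he1 : ‖e‖ = 1 := by
    have : ‖e‖ ^ 2 = 1 := by
      rw [he, norm_add_sq_real, real_inner_smul_left, real_inner_smul_right, inner_self_rotJ,
        norm_smul, norm_smul, norm_rotJ, hd, Real.norm_eq_abs, Real.norm_eq_abs]
      simp only [mul_one, mul_zero, add_zero, sq_abs, mul_pow, hσ, one_mul]
      linarith [Real.sin_sq_add_cos_sq s₀]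
    have := norm_nonneg e
    nlinarith
  have hstart : characteristic σ e s₀ = z₀ := by
    have h1 : rotJ n e = Real.cos s₀ • rotJ n d - (σ * Real.sin s₀) • d := by
      simp [he, sub_eq_add_neg]
    have h2 : Real.cos s₀ • e - (σ * Real.sin s₀) • rotJ n e =
        (Real.cos s₀ ^ 2 + σ ^ 2 * Real.sin s₀ ^ 2) • d := by
      rw [h1, he]; module
    rw [characteristic, h2, hσ, one_mul, add_comm, Real.sin_sq_add_cos_sq, one_smul, hsin0]
    exact hzd.symm
  set f : ℝ → ℝ := fun s => u (characteristic σ e s) -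
    (Real.pi / 8 + Real.sin s * Real.cos s / 4 - s / 4) with hf
  have hsinpos : ∀ s ∈ Set.Icc s₀ (Real.pi / 2), 0 ≤ Real.sin s := fun s hs =>
    Real.sin_nonneg_of_nonneg_of_le_pi (hs0.trans hs.1) (by linarith [hs.2, Real.pi_pos])
  have hcc : Continuous (characteristic σ e) := by unfold characteristic; fun_prop
  have hcont : ContinuousOn f (Set.Icc s₀ (Real.pi / 2)) := by
    refine ContinuousOn.sub ?_ (by fun_prop)
    refine hu.continuousOn.comp hcc.continuousOn fun s hs => ?_
    rw [mem_closedBall_zero_iff, norm_characteristic hσ he1 (hsinpos s hs)]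
    exact Real.sin_le_one s
  -- The equation is known only in the punctured open ball. The open interval avoids the sphere, and
  -- also the origin when s₀ = 0; continuity takes care of the endpoints.
  have hderiv : ∀ s ∈ Set.Ioo s₀ (Real.pi / 2), HasDerivAt f 0 s := by
    intro s hs
    have hs' : s ∈ Set.Ioo 0 (Real.pi / 2) := ⟨hs0.trans_lt hs.1, hs.2⟩
    have hsin : 0 < Real.sin s :=
      Real.sin_pos_of_pos_of_lt_pi hs'.1 (by linarith [hs.2, Real.pi_pos])
    have hcos : 0 < Real.cos s :=
      Real.cos_pos_of_mem_Ioo ⟨by linarith [hs'.1, Real.pi_pos], hs.2⟩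
    have hnorm := norm_characteristic hσ he1 hsin.le
    have hlt : Real.sin s < 1 := by nlinarith [Real.sin_sq_add_cos_sq s]
    have hmem : characteristic σ e s ∈ Metric.ball (0 : Plane n) 1 \ {0} := by
      refine ⟨by rw [mem_ball_zero_iff, hnorm]; exact hlt, ?_⟩
      rw [Set.mem_singleton_iff, ← norm_eq_zero, hnorm]; exact hsin.ne'
    have hd1 := (((hu.contDiffOn.contDiffAt (Metric.isOpen_ball.mem_nhds
      hmem.1)).differentiableAt two_ne_zero).hasFDerivAt).comp_hasDerivAt s
        (hasDerivAt_characteristic hσ he1 hs')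
    rw [h _ hmem, hnorm] at hd1
    have hd2 : HasDerivAt (fun s : ℝ => Real.pi / 8 + Real.sin s * Real.cos s / 4 - s / 4)
        ((Real.cos s * Real.cos s + Real.sin s * -Real.sin s) / 4 - 1 / 4) s :=
      ((((Real.hasDerivAt_sin s).mul (Real.hasDerivAt_cos s)).div_const 4).const_add _).sub
        ((hasDerivAt_id s).div_const 4)
    have hzero : -Real.sin s ^ 2 / 2 -
        ((Real.cos s * Real.cos s + Real.sin s * -Real.sin s) / 4 - 1 / 4) = 0 := by
      linear_combination (-1 / 4) * Real.sin_sq_add_cos_sq s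
    have hd3 := hd1.sub hd2
    rw [hzero] at hd3
    exact hd3
  obtain ⟨c, -, hc⟩ := exists_hasDerivAt_eq_slope f (fun _ => 0) hs1 hcont hderiv
  have hconst : f (Real.pi / 2) = f s₀ := by
    have h1 : Real.pi / 2 - s₀ ≠ 0 := by linarith
    exact sub_eq_zero.1 ((div_eq_zero_iff.1 hc.symm).resolve_right h1)
  have hend : u (characteristic σ e (Real.pi / 2)) = 0 := by
    refine hu.eq_zero _ ?_
    rw [mem_sphere_zero_iff_norm, norm_characteristic hσ he1 (by simp), Real.sin_pi_div_two]
  simp only [hf, hend, hstart, Real.sin_pi_div_two, Real.cos_pi_div_two] at hconst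
  have hcos0 : Real.cos s₀ = Real.sqrt (1 - ‖z₀‖ ^ 2) := Real.cos_arcsin _
  rw [hsin0, hcos0] at hconst
  rw [profile, ← hs₀]
  linarith

/-! ### The extremal profile -/

/-- The extremal profile has gradient -(2√(1-|z|²))⁻¹ |z| z. Although |z| is not differentiable at
0, the map |z| z is C¹ there, and this makes the profile C² across the origin. -/
theorem contDiff_norm_smul_self {V : Type*} [NormedAddCommGroup V] [InnerProductSpace ℝ V] :
    ContDiff ℝ 1 (fun z : V => ‖z‖ • z) := by
  have hd : ∀ z : V, HasFDerivAt (fun z : V => ‖z‖ • z)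
      (‖z‖ • ContinuousLinearMap.id ℝ V + (‖z‖⁻¹ • innerSL ℝ z).smulRight z) z := by
    intro z
    by_cases h : z = 0
    · subst h
      have h0 : (‖(0 : V)‖ • ContinuousLinearMap.id ℝ V +
          (‖(0 : V)‖⁻¹ • innerSL ℝ (0 : V)).smulRight 0) = 0 := by
        ext; simp
      rw [h0, hasFDerivAt_iff_isLittleO_nhds_zero]
      have hid : Filter.Tendsto (fun h : V => ‖h‖) (nhds 0) (nhds 0) := by
        simpa using (continuous_norm (E := V)).tendsto 0
      have := (Asymptotics.isLittleO_one_iff ℝ).2 hid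
      have h2 := this.smul_isBigO (Asymptotics.isBigO_refl (fun h : V => h) (nhds 0))
      simpa using h2
    · have hz : 0 < ‖z‖ := norm_pos_iff.2 h
      have h1 : HasFDerivAt (fun z : V => Real.sqrt (‖z‖ ^ 2))
          ((1 / (2 * Real.sqrt (‖z‖ ^ 2))) • (2 • innerSL ℝ z)) z :=
        (hasStrictFDerivAt_norm_sq z).hasFDerivAt.sqrt (by positivity)
      simp only [Real.sqrt_sq (norm_nonneg _)] at h1
      have h2 := h1.smul (hasFDerivAt_id z)
      have h3 : (1 / (2 * ‖z‖)) • (2 • innerSL ℝ z) = ‖z‖⁻¹ • innerSL ℝ z := by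
        ext w; simp; field_simp
      rw [h3] at h2
      exact h2
  refine contDiff_one_iff_fderiv.2 ⟨fun z => (hd z).differentiableAt, ?_⟩
  have hf : fderiv ℝ (fun z : V => ‖z‖ • z) = fun z =>
      ‖z‖ • ContinuousLinearMap.id ℝ V + (‖z‖⁻¹ • innerSL ℝ z).smulRight z :=
    funext fun z => (hd z).fderiv
  rw [hf]
  refine (continuous_norm.smul continuous_const).add (continuous_iff_continuousAt.2 fun z => ?_)
  by_cases h : z = 0
  · subst h
    rw [ContinuousAt, ContinuousLinearMap.smulRight_zero]
    refine squeeze_zero_norm (a := fun z => ‖z‖) (fun z => ?_)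
      (by simpa using (continuous_norm (E := V)).tendsto 0)
    rw [ContinuousLinearMap.norm_smulRight_apply, norm_smul, innerSL_apply_norm, norm_inv,
      norm_norm]
    by_cases hz : ‖z‖ = 0
    · simp [hz]
    · rw [inv_mul_cancel₀ hz, one_mul]
  · have hz : ‖z‖ ≠ 0 := norm_ne_zero_iff.2 h
    have h1 : ContinuousAt (fun z : V => ‖z‖⁻¹ • innerSL ℝ z) z :=
      (continuous_norm.continuousAt.inv₀ hz).smul (innerSL ℝ).continuous.continuousAt
    have h2 : Continuous fun p : (V →L[ℝ] ℝ) × V => p.1.smulRight p.2 :=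
      (ContinuousLinearMap.smulRightL ℝ V V).continuous₂
    exact h2.continuousAt.comp (h1.prodMk continuousAt_id)

/-- The profile as a function of the radius. -/
def radialProfile (r : ℝ) : ℝ :=
  Real.pi / 8 + r / 4 * Real.sqrt (1 - r ^ 2) - 1 / 4 * Real.arcsin r

theorem profile_eq {n : ℕ} (z : Plane n) : profile z = radialProfile ‖z‖ := rfl

theorem hasDerivAt_radialProfile {r : ℝ} (hr : |r| < 1) :
    HasDerivAt radialProfile (-(r ^ 2 / (2 * Real.sqrt (1 - r ^ 2)))) r := by
  have h1 : 0 < 1 - r ^ 2 := by nlinarith [sq_abs r, abs_nonneg r]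
  have hs : 0 < Real.sqrt (1 - r ^ 2) := Real.sqrt_pos.2 h1
  rw [abs_lt] at hr
  have d1 : HasDerivAt (fun r : ℝ => Real.sqrt (1 - r ^ 2))
      (-(2 * r) / (2 * Real.sqrt (1 - r ^ 2))) r := by
    have : HasDerivAt (fun r : ℝ => 1 - r ^ 2) (-(2 * r)) r := by
      simpa using (hasDerivAt_pow 2 r).const_sub 1
    exact this.sqrt h1.ne'
  have d2 := Real.hasDerivAt_arcsin (by linarith : r ≠ -1) (by linarith : r ≠ 1)
  have d3 := (((hasDerivAt_id r).div_const 4).mul d1).const_add (Real.pi / 8)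
  have d4 := d3.sub (d2.const_mul (1 / 4))
  refine d4.congr_deriv ?_
  simp only [id]
  have hsq := Real.sq_sqrt h1.le
  field_simp
  rw [hsq]; ring

theorem continuous_profile (n : ℕ) : Continuous (profile : Plane n → ℝ) := by
  unfold profile
  have := Real.continuous_arcsin
  fun_prop

theorem profile_of_one_le {n : ℕ} {z : Plane n} (hz : 1 ≤ ‖z‖) : profile z = 0 := by
  rw [profile, Real.arcsin_of_one_le hz, Real.sqrt_eq_zero_of_nonpos (by nlinarith)]
  ring

theorem profile_pos {n : ℕ} {z : Plane n} (hz : ‖z‖ < 1) : 0 < profile z := by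
  have h1 := Real.arcsin_lt_pi_div_two.2 hz
  have h2 : 0 ≤ ‖z‖ / 4 * Real.sqrt (1 - ‖z‖ ^ 2) := by positivity
  rw [profile]; linarith

theorem profile_nonneg {n : ℕ} (z : Plane n) : 0 ≤ profile z := by
  rcases lt_or_ge ‖z‖ 1 with h | h
  · exact (profile_pos h).le
  · rw [profile_of_one_le h]

theorem hasFDerivAt_profile {n : ℕ} {z : Plane n} (hz : ‖z‖ < 1) :
    HasFDerivAt (profile : Plane n → ℝ)
      (-(2 * Real.sqrt (1 - ‖z‖ ^ 2))⁻¹ • innerSL ℝ (‖z‖ • z)) z := by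
  by_cases h : z = 0
  · subst h
    have h1 := hasDerivAt_radialProfile (r := 0) (by simp)
    have h2 : -(2 * Real.sqrt (1 - ‖(0 : Plane n)‖ ^ 2))⁻¹ •
        innerSL ℝ (‖(0 : Plane n)‖ • (0 : Plane n)) = 0 := by simp
    rw [h2, hasFDerivAt_iff_isLittleO_nhds_zero]
    rw [hasDerivAt_iff_isLittleO_nhds_zero] at h1
    have hid : Filter.Tendsto (fun h : Plane n => ‖h‖) (nhds 0) (nhds 0) := by
      simpa using (continuous_norm (E := Plane n)).tendsto 0
    have h3 := h1.comp_tendsto hid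
    refine (Asymptotics.isLittleO_norm_right.1 ?_)
    simpa [Function.comp_def, profile_eq] using h3
  · have hz0 : 0 < ‖z‖ := norm_pos_iff.2 h
    have h1 : HasFDerivAt (fun z : Plane n => Real.sqrt (‖z‖ ^ 2))
        ((1 / (2 * Real.sqrt (‖z‖ ^ 2))) • (2 • innerSL ℝ z)) z :=
      (hasStrictFDerivAt_norm_sq z).hasFDerivAt.sqrt (by positivity)
    simp only [Real.sqrt_sq (norm_nonneg _)] at h1
    have h2 := (hasDerivAt_radialProfile (r := ‖z‖) (by simpa using hz)).comp_hasFDerivAt z h1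
    have h3 : HasFDerivAt (profile : Plane n → ℝ) _ z := h2
    refine h3.congr_fderiv ?_
    have : 0 < Real.sqrt (1 - ‖z‖ ^ 2) := Real.sqrt_pos.2 (by nlinarith)
    have h5 : (-(‖z‖ ^ 2 / (2 * Real.sqrt (1 - ‖z‖ ^ 2)))) * (1 / (2 * ‖z‖) * 2) =
        -(2 * Real.sqrt (1 - ‖z‖ ^ 2))⁻¹ * ‖z‖ := by field_simp
    ext w
    simp only [smul_apply, map_smul, innerSL_apply_apply, smul_eq_mul, nsmul_eq_mul, Nat.cast_ofNat]
    linear_combination (inner ℝ z w) * h5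

theorem contDiffOn_profile (n : ℕ) :
    ContDiffOn ℝ 2 (profile : Plane n → ℝ) (Metric.ball 0 1) := by
  rw [show (2 : WithTop ℕ∞) = 1 + 1 from one_add_one_eq_two.symm,
    contDiffOn_succ_iff_fderiv_of_isOpen Metric.isOpen_ball]
  refine ⟨fun z hz => (hasFDerivAt_profile
    (mem_ball_zero_iff.1 hz)).differentiableAt.differentiableWithinAt, by simp, ?_⟩
  have h1 : ContDiffOn ℝ 1 (fun z : Plane n => -(2 * Real.sqrt (1 - ‖z‖ ^ 2))⁻¹ •
      innerSL ℝ (‖z‖ • z)) (Metric.ball 0 1) := by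
    intro z hz
    have hz1 := mem_ball_zero_iff.1 hz
    have h2 : 0 < 1 - ‖z‖ ^ 2 := by nlinarith [norm_nonneg z]
    have h3 : 0 < Real.sqrt (1 - ‖z‖ ^ 2) := Real.sqrt_pos.2 h2
    have hn : ContDiffAt ℝ 1 (fun z : Plane n => ‖z‖ ^ 2) z := (contDiff_norm_sq ℝ).contDiffAt
    have h4 : ContDiffAt ℝ 1 (fun z : Plane n => 2 * Real.sqrt (1 - ‖z‖ ^ 2)) z :=
      contDiffAt_const.mul ((contDiffAt_const.sub hn).sqrt h2.ne')
    exact ((h4.inv (by positivity)).neg.smul ((innerSL ℝ).contDiff.comp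
      contDiff_norm_smul_self).contDiffAt).contDiffWithinAt
  exact h1.congr fun z hz => (hasFDerivAt_profile (mem_ball_zero_iff.1 hz)).fderiv

theorem isProfile_profile (n : ℕ) : IsProfile 1 (profile : Plane n → ℝ) where
  nonneg _ _ := profile_nonneg _
  contDiffOn := contDiffOn_profile n
  continuousOn := (continuous_profile n).continuousOn
  eq_zero _ hz := profile_of_one_le (mem_sphere_zero_iff_norm.1 hz).ge

/-! ### The extremal set is admissible -/

theorem isOpen_isoperimetricSet (n : ℕ) : IsOpen (isoperimetricSet n) := by
  have h := (continuous_profile n).comp (continuous_fst (Y := ℝ))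
  have h1 : Continuous fun g : Point n => ‖g.1‖ := by fun_prop
  have h2 : Continuous fun g : Point n => |g.2| := by fun_prop
  exact (isOpen_lt h1 continuous_const).inter (isOpen_lt h2 h)

theorem closure_isoperimetricSet_subset (n : ℕ) :
    closure (isoperimetricSet n) ⊆ {g | ‖g.1‖ ≤ 1 ∧ |g.2| ≤ profile g.1} := by
  have h := (continuous_profile n).comp (continuous_fst (Y := ℝ))
  have h1 : Continuous fun g : Point n => ‖g.1‖ := by fun_prop
  have h2 : Continuous fun g : Point n => |g.2| := by fun_prop
  exact closure_minimal (fun _ hg => ⟨hg.1.le, hg.2.le⟩)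
    ((isClosed_le h1 continuous_const).inter (isClosed_le h2 h))

/-- The projection to the plane is open, so it sends the interior of the closure into the open ball.
Each vertical slice of that interior is an open subset of [-u_o, u_o], hence of its interior. -/
theorem interior_closure_isoperimetricSet (n : ℕ) :
    interior (closure (isoperimetricSet n)) = isoperimetricSet n := by
  refine subset_antisymm (fun g hg => ?_)
    (interior_maximal subset_closure (isOpen_isoperimetricSet n))
  have hsub := closure_isoperimetricSet_subset n
  constructor
  · have h1 : interior (closure (isoperimetricSet n)) ⊆
        Prod.fst ⁻¹' interior (Metric.closedBall (0 : Plane n) 1) := by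
      rw [isOpenMap_fst.preimage_interior_eq_interior_preimage continuous_fst]
      exact interior_mono fun p hp => mem_closedBall_zero_iff.2 (hsub hp).1
    have h2 := h1 hg
    rw [interior_closedBall _ one_ne_zero] at h2
    exact mem_ball_zero_iff.1 h2
  · have hO : IsOpen ((fun s : ℝ => ((g.1, s) : Point n)) ⁻¹'
        interior (closure (isoperimetricSet n))) :=
      isOpen_interior.preimage (by fun_prop)
    have h1 := interior_maximal (s := Set.Icc (-profile g.1) (profile g.1))
      (fun s hs => abs_le.1 (hsub (interior_subset hs)).2) hO
    rw [interior_Icc] at h1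
    exact abs_lt.2 (h1 (show (g.1, g.2) ∈ _ from hg))

theorem mem_closure_isoperimetricSet {n : ℕ} {z : Plane n} (hz : ‖z‖ < 1) {t : ℝ}
    (ht : |t| ≤ profile z) : (z, t) ∈ closure (isoperimetricSet n) := by
  have hp := profile_pos hz
  have hc : Continuous (fun s : ℝ => ((z, s) : Point n)) := by fun_prop
  have h1 : (fun s : ℝ => ((z, s) : Point n)) '' Set.Ioo (-profile z) (profile z) ⊆
      isoperimetricSet n := by
    rintro _ ⟨s, hs, rfl⟩
    exact ⟨hz, abs_lt.2 hs⟩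
  have h2 : t ∈ closure (Set.Ioo (-profile z) (profile z)) := by
    rw [closure_Ioo (by linarith)]; exact abs_le.1 ht
  exact closure_mono h1 (image_closure_subset_closure_image hc ⟨t, h2, rfl⟩)

theorem mem_frontier_isoperimetricSet {n : ℕ} {g : Point n} (hg : g.2 ≠ 0) :
    g ∈ frontier (isoperimetricSet n) ↔ ‖g.1‖ < 1 ∧ |g.2| = profile g.1 := by
  rw [(isOpen_isoperimetricSet n).frontier_eq]
  constructor
  · rintro ⟨h1, h2⟩
    have h3 := closure_isoperimetricSet_subset n h1
    have h4 : ‖g.1‖ < 1 := by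
      refine lt_of_le_of_ne h3.1 fun h5 => ?_
      have := h3.2
      rw [profile_of_one_le h5.ge] at this
      exact hg (abs_nonpos_iff.1 this)
    exact ⟨h4, le_antisymm h3.2 (not_lt.1 fun h5 => h2 ⟨h4, h5⟩)⟩
  · rintro ⟨h1, h2⟩
    exact ⟨mem_closure_isoperimetricSet h1 h2.le, fun h3 => h3.2.ne h2⟩

theorem isLens_isoperimetricSet (n : ℕ) :
    IsLens 1 (profile : Plane n → ℝ) profile (isoperimetricSet n) where
  isOpen := isOpen_isoperimetricSet n
  interior_closure := interior_closure_isoperimetricSet n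
  fst := isProfile_profile n
  snd := isProfile_profile n
  add_pos _ hz := add_pos (profile_pos (mem_ball_zero_iff.1 hz))
    (profile_pos (mem_ball_zero_iff.1 hz))
  upper := by
    ext g
    simp only [isoperimetricSet, upperHalf, Set.mem_inter_iff, Set.mem_ofPred_eq,
      mem_ball_zero_iff, and_assoc]
    refine and_congr_right fun _ => ⟨fun h => ⟨h.2, (abs_of_pos h.2).symm ▸ h.1⟩,
      fun h => ⟨by rw [abs_of_pos h.1]; exact h.2, h.1⟩⟩
  lower := by
    ext g
    simp only [isoperimetricSet, lowerHalf, Set.mem_inter_iff, Set.mem_ofPred_eq,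
      mem_ball_zero_iff, and_assoc]
    refine and_congr_right fun _ => ⟨fun h => ⟨h.2, ?_⟩, fun h => ⟨?_, h.1⟩⟩
    · have := h.1; rw [abs_of_neg h.2] at this; linarith
    · rw [abs_of_neg h.1]; linarith [h.2]

theorem isAdmissible_isoperimetricSet (n : ℕ) : IsAdmissible (isoperimetricSet n) where
  isOpen := isOpen_isoperimetricSet n
  isBounded := by
    obtain ⟨M, -, -, -, hM⟩ := (isLens_isoperimetricSet n).exists_height_bound
    refine ((isCompact_closedBall (0 : Plane n) 1).prod
      (isCompact_Icc (a := -M) (b := M))).isBounded.subset fun g hg => ?_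
    exact ⟨mem_closedBall_zero_iff.2 hg.1.le, abs_le.1 (hM g hg).le⟩
  interior_closure := interior_closure_isoperimetricSet n
  volume_eq := by
    have hm : MeasurePreserving (reflectHomeo n) volume volume :=
      (MeasurePreserving.id (volume : Measure (Plane n))).prod
        (Measure.measurePreserving_neg (volume : Measure ℝ))
    have h1 := hm.measure_preimage_emb (reflectHomeo n).measurableEmbedding
      (isoperimetricSet n ∩ upperHalf n)
    rw [← h1]
    congr 1
    ext g
    simp [isoperimetricSet, upperHalf, lowerHalf]
  exists_profiles := by
    refine ⟨1, one_pos, profile, profile, isProfile_profile n, isProfile_profile n, ?_, ?_, ?_⟩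
    · ext g
      simp only [upperHalf, Set.mem_inter_iff, Set.mem_ofPred_eq, mem_ball_zero_iff]
      constructor
      · rintro ⟨h1, h2⟩
        have := (mem_frontier_isoperimetricSet h2.ne').1 h1
        exact ⟨h2, this.1, by rw [← this.2, abs_of_pos h2]⟩
      · rintro ⟨h1, h2, h3⟩
        exact ⟨(mem_frontier_isoperimetricSet h1.ne').2 ⟨h2, by rw [abs_of_pos h1, h3]⟩, h1⟩
    · ext g
      simp only [lowerHalf, Set.mem_inter_iff, Set.mem_ofPred_eq, mem_ball_zero_iff]
      constructor
      · rintro ⟨h1, h2⟩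
        have := (mem_frontier_isoperimetricSet h2.ne).1 h1
        exact ⟨h2, this.1, by rw [← this.2, abs_of_neg h2, neg_neg]⟩
      · rintro ⟨h1, h2, h3⟩
        exact ⟨(mem_frontier_isoperimetricSet h1.ne).2
          ⟨h2, by rw [abs_of_neg h1, h3, neg_neg]⟩, h1⟩
    · ext z
      simp only [Set.mem_inter_iff, Set.mem_ofPred_eq, Set.mem_empty_iff_false, iff_false]
      rintro ⟨⟨h1, h2⟩, -⟩
      exact (profile_pos (mem_ball_zero_iff.1 h1)).ne' h2

theorem IsLens.eq_isoperimetricSet {n : ℕ} (hn : 1 ≤ n) {u v : Plane n → ℝ} {E : Set (Point n)}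
    (h : IsLens 1 u v E)
    (heq : perimeterH E = ENNReal.ofReal (2 * n * (volume E).toReal + discFlux n)) :
    E = isoperimetricSet n := by
  obtain ⟨h1, h2⟩ := h.fderiv_leafTangent heq
  have hu := fun z hz => eq_profile_of_fderiv_leafTangent hn (one_pow 2) h.fst h1 (z₀ := z) hz
  have hv := fun z hz =>
    eq_profile_of_fderiv_leafTangent hn (by norm_num) h.snd h2 (z₀ := z) hz
  refine eq_of_inter_halves_eq h.isOpen h.interior_closure (isOpen_isoperimetricSet n)
    (interior_closure_isoperimetricSet n) ?_ ?_
  · rw [h.upper, (isLens_isoperimetricSet n).upper]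
    ext g
    refine and_congr_right fun hg => ?_
    rw [hu g.1 hg]
  · rw [h.lower, (isLens_isoperimetricSet n).lower]
    ext g
    refine and_congr_right fun hg => ?_
    rw [hv g.1 hg]

/-! ### Upper bound for the perimeter of the extremal set -/

theorem hasDerivAt_max_zero_sq (x : ℝ) :
    HasDerivAt (fun x : ℝ => max x 0 ^ 2) (2 * max x 0) x := by
  rcases lt_trichotomy x 0 with h | h | h
  · rw [max_eq_right h.le, mul_zero]
    refine (hasDerivAt_const x (0 : ℝ)).congr_of_eventuallyEq ?_
    filter_upwards [gt_mem_nhds h] with y hy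
    rw [max_eq_right hy.le]; norm_num
  · subst h
    rw [max_self, mul_zero, hasDerivAt_iff_isLittleO_nhds_zero]
    simp only [zero_add, max_self, smul_zero, sub_zero]
    refine Asymptotics.IsBigO.trans_isLittleO (g := fun h : ℝ => h ^ 2) ?_ ?_
    · refine Asymptotics.IsBigO.of_bound 1 (Filter.Eventually.of_forall fun y => ?_)
      simp only [one_mul, norm_pow, Real.norm_eq_abs]
      have : |max y 0| ≤ |y| := by
        rw [abs_of_nonneg (le_max_right _ _)]
        exact max_le (le_abs_self y) (abs_nonneg y)
      rw [zero_pow two_ne_zero, sub_zero, abs_pow]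
      gcongr
    · exact Asymptotics.isLittleO_pow_id one_lt_two
  · rw [max_eq_left h.le]
    have h1 : HasDerivAt (fun x : ℝ => x ^ 2) (2 * x) x := by simpa using hasDerivAt_pow 2 x
    refine h1.congr_of_eventuallyEq ?_
    filter_upwards [lt_mem_nhds h] with y hy
    rw [max_eq_left hy.le]

theorem contDiff_max_zero_sq : ContDiff ℝ 1 (fun x : ℝ => max x 0 ^ 2) := by
  rw [contDiff_one_iff_deriv]
  refine ⟨fun x => (hasDerivAt_max_zero_sq x).differentiableAt, ?_⟩
  rw [funext fun x => (hasDerivAt_max_zero_sq x).deriv]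
  fun_prop

/-- A compactly supported `C¹` approximation of the profile from below. -/
def innerProfile {n : ℕ} (ε : ℝ) (z : Plane n) : ℝ := max (profile z - ε) 0 ^ 2 / profile z

theorem innerProfile_eq_zero {n : ℕ} {ε : ℝ} {z : Plane n} (h : profile z ≤ ε) :
    innerProfile ε z = 0 := by
  rw [innerProfile, max_eq_right (by linarith)]; simp

theorem innerProfile_of_one_le {n : ℕ} {ε : ℝ} (hε : 0 < ε) {z : Plane n} (hz : 1 ≤ ‖z‖) :
    innerProfile ε z = 0 :=
  innerProfile_eq_zero (by rw [profile_of_one_le hz]; exact hε.le)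

theorem innerProfile_nonneg {n : ℕ} (ε : ℝ) (z : Plane n) : 0 ≤ innerProfile ε z :=
  div_nonneg (by positivity) (profile_nonneg z)

theorem max_sub_le {s ε : ℝ} (hs : 0 ≤ s) (hε : 0 ≤ ε) : max (s - ε) 0 ≤ s :=
  max_le (by linarith) hs

theorem innerProfile_le {n : ℕ} {ε : ℝ} (hε : 0 ≤ ε) (z : Plane n) :
    innerProfile ε z ≤ profile z := by
  rcases (profile_nonneg z).eq_or_lt with h | h
  · rw [innerProfile, ← h]; simp
  · rw [innerProfile, div_le_iff₀ h, ← sq]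
    exact pow_le_pow_left₀ (le_max_right _ _) (max_sub_le h.le hε) 2

theorem tsupport_innerProfile {n : ℕ} {ε : ℝ} (hε : 0 < ε) :
    tsupport (innerProfile ε : Plane n → ℝ) ⊆ Metric.ball 0 1 := by
  have h1 : tsupport (innerProfile ε : Plane n → ℝ) ⊆ {z | ε ≤ profile z} := by
    refine closure_minimal (fun z hz => ?_)
      (isClosed_le continuous_const (continuous_profile n))
    by_contra h
    exact hz (innerProfile_eq_zero (not_le.1 h).le)
  intro z hz
  rw [mem_ball_zero_iff]
  by_contra h
  have h2 : ε ≤ profile z := h1 hz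
  rw [profile_of_one_le (not_lt.1 h)] at h2
  linarith

theorem contDiff_innerProfile {n : ℕ} {ε : ℝ} (hε : 0 < ε) :
    ContDiff ℝ 1 (innerProfile ε : Plane n → ℝ) := by
  refine contDiff_of_contDiffAt_tsupport fun z hz => ?_
  have hz1 := tsupport_innerProfile hε hz
  have hp : ContDiffAt ℝ 1 (profile : Plane n → ℝ) z :=
    ((contDiffOn_profile n).contDiffAt (Metric.isOpen_ball.mem_nhds hz1)).of_le one_le_two
  exact (contDiff_max_zero_sq.contDiffAt.comp z (hp.sub contDiffAt_const)).div hp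
    (profile_pos (mem_ball_zero_iff.1 hz1)).ne'

/-- The inner profile is φ(u_o) with φ(s) = ((s - ε)₊)²/s, and φ' = 1 - (1 - (s - ε)₊/s)² lies in
[0, 1]. The approximating graphs are therefore never steeper than the extremal one. -/
theorem fderiv_innerProfile {n : ℕ} {ε : ℝ} (hε : 0 ≤ ε) {z : Plane n} (hz : ‖z‖ < 1) :
    ∃ c : ℝ, 0 ≤ c ∧ c ≤ 1 ∧ ∀ w, fderiv ℝ (innerProfile ε) z w =
      -(c * (‖z‖ / (2 * Real.sqrt (1 - ‖z‖ ^ 2)))) * inner ℝ w z := by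
  have hp := profile_pos hz
  set m := max (profile z - ε) 0 with hm
  have hm0 : 0 ≤ m := le_max_right _ _
  have hm1 : m ≤ profile z := max_sub_le hp.le hε
  have h1 : HasDerivAt (fun s : ℝ => max (s - ε) 0 ^ 2 / s)
      ((2 * m * profile z - m ^ 2 * 1) / profile z ^ 2) (profile z) := by
    have h2 : HasDerivAt (fun s : ℝ => max (s - ε) 0 ^ 2) (2 * m) (profile z) := by
      have := (hasDerivAt_max_zero_sq (profile z - ε)).comp (profile z)
        ((hasDerivAt_id (profile z)).sub_const ε)
      rw [mul_one] at this
      exact this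
    exact h2.div (hasDerivAt_id _) hp.ne'
  have h3 : HasFDerivAt (innerProfile ε : Plane n → ℝ) _ z :=
    h1.comp_hasFDerivAt z (hasFDerivAt_profile hz)
  refine ⟨(2 * m * profile z - m ^ 2 * 1) / profile z ^ 2, ?_, ?_, fun w => ?_⟩
  · exact div_nonneg (by nlinarith) (by positivity)
  · rw [div_le_one (by positivity)]; nlinarith [sq_nonneg (profile z - m)]
  · rw [h3.fderiv]
    simp [real_inner_comm]
    ring

/-- Cauchy-Schwarz with Jz/2 orthogonal to kz. At the largest allowed k the squared norm is |z|²/4 +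
|z|⁴/(4(1-|z|²)) = |z|²/(4(1-|z|²)). -/
theorem abs_inner_le {n : ℕ} {z w : Plane n} (hz : ‖z‖ < 1) (hw : ‖w‖ ≤ 1) {k : ℝ}
    (hk : |k| ≤ ‖z‖ / (2 * Real.sqrt (1 - ‖z‖ ^ 2))) :
    |inner ℝ w (rotJ n z) / 2 + k * inner ℝ w z| ≤ ‖z‖ / (2 * Real.sqrt (1 - ‖z‖ ^ 2)) := by
  have h1 : 0 < 1 - ‖z‖ ^ 2 := by nlinarith [norm_nonneg z]
  have hs : 0 < Real.sqrt (1 - ‖z‖ ^ 2) := Real.sqrt_pos.2 h1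
  have h2 : inner ℝ w (rotJ n z) / 2 + k * inner ℝ w z =
      inner ℝ w ((1 / 2 : ℝ) • rotJ n z + k • z) := by
    rw [inner_add_right, real_inner_smul_right, real_inner_smul_right]; ring
  rw [h2]
  refine (abs_real_inner_le_norm _ _).trans ?_
  refine (mul_le_of_le_one_left (norm_nonneg _) hw).trans ?_
  refine le_of_sq_le_sq ?_ (by positivity)
  have h3 : ‖(1 / 2 : ℝ) • rotJ n z + k • z‖ ^ 2 = ‖z‖ ^ 2 / 4 + k ^ 2 * ‖z‖ ^ 2 := by
    rw [norm_add_sq_real, real_inner_smul_left, real_inner_smul_right, inner_rotJ_self,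
      norm_smul, norm_smul, norm_rotJ, mul_pow, mul_pow, Real.norm_eq_abs, Real.norm_eq_abs,
      sq_abs, sq_abs]
    ring
  have h4 : k ^ 2 ≤ (‖z‖ / (2 * Real.sqrt (1 - ‖z‖ ^ 2))) ^ 2 := by
    rw [← sq_abs k]; exact pow_le_pow_left₀ (abs_nonneg _) hk 2
  rw [div_pow, mul_pow, Real.sq_sqrt h1.le] at h4 ⊢
  rw [h3]
  calc ‖z‖ ^ 2 / 4 + k ^ 2 * ‖z‖ ^ 2
      ≤ ‖z‖ ^ 2 / 4 + ‖z‖ ^ 2 / (2 ^ 2 * (1 - ‖z‖ ^ 2)) * ‖z‖ ^ 2 := by gcongr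
    _ = ‖z‖ ^ 2 / (2 ^ 2 * (1 - ‖z‖ ^ 2)) := by field_simp; ring

/-- The value of the perimeter of the extremal set. -/
def extremalPerimeter (n : ℕ) : ℝ :=
  ∫ z in Metric.ball (0 : Plane n) 1, ‖z‖ / Real.sqrt (1 - ‖z‖ ^ 2)

/-- Each of the two graphs has flux density at most |z|/(2√(1-|z|²)) in absolute value. The
resulting bound does not depend on ε. -/
theorem integral_divH_innerProfile_le {n : ℕ}
    (hA : IntegrableOn (fun z : Plane n => ‖z‖ / Real.sqrt (1 - ‖z‖ ^ 2)) (Metric.ball 0 1))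
    {Z : Point n → Plane n} (hZ : ContDiff ℝ 1 Z) (hc : HasCompactSupport Z)
    (hZ1 : ∀ g, ‖Z g‖ ≤ 1) {ε : ℝ} (hε : 0 < ε) :
    (∫ g in {g : Point n | g.2 ≤ innerProfile ε g.1}, divH (fun j g => Z g j) g) -
      ∫ g in {g : Point n | g.2 ≤ -innerProfile ε g.1}, divH (fun j g => Z g j) g ≤
        extremalPerimeter n := by
  have hb := contDiff_innerProfile (n := n) hε
  have h1 := setIntegral_subgraph_divH_vec hZ hc hb
  have h2 := setIntegral_subgraph_divH_vec hZ hc hb.neg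
  have i1 := integrable_graph_pairing hZ hc hb
  have i2 := integrable_graph_pairing hZ hc hb.neg
  rw [h1, h2, ← integral_sub i1 i2, extremalPerimeter,
    ← integral_indicator Metric.isOpen_ball.measurableSet]
  refine integral_mono (i1.sub i2)
    ((integrable_indicator_iff Metric.isOpen_ball.measurableSet).2 hA) fun z => ?_
  have h3 : fderiv ℝ (fun x : Plane n => -innerProfile ε x) z = -fderiv ℝ (innerProfile ε) z :=
    fderiv_neg
  simp only [h3, neg_apply, sub_neg_eq_add]
  by_cases hz : ‖z‖ < 1
  · rw [Set.indicator_of_mem (mem_ball_zero_iff.2 hz)]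
    obtain ⟨c, hc0, hc1, hfd⟩ := fderiv_innerProfile hε.le hz
    simp only [hfd]
    set k := ‖z‖ / (2 * Real.sqrt (1 - ‖z‖ ^ 2)) with hk
    have hk0 : 0 ≤ k := by positivity
    have hck : |c * k| ≤ k := by
      rw [abs_of_nonneg (by positivity)]; exact mul_le_of_le_one_left hk0 hc1
    have a1 := abs_inner_le hz (hZ1 (z, innerProfile ε z)) (k := c * k) hck
    have a2 := abs_inner_le hz (hZ1 (z, -innerProfile ε z)) (k := -(c * k)) (by rwa [abs_neg])
    have a3 : ‖z‖ / Real.sqrt (1 - ‖z‖ ^ 2) = k + k := by rw [hk]; field_simp; ring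
    rw [a3]
    have b1 := (abs_le.1 a1).2
    have b2 := (abs_le.1 a2).1
    linarith
  · have hz' : z ∉ Metric.ball (0 : Plane n) 1 := fun h => hz (mem_ball_zero_iff.1 h)
    have h4 : z ∉ tsupport (innerProfile ε : Plane n → ℝ) := fun h =>
      hz' (tsupport_innerProfile hε h)
    have h5 : innerProfile ε z = 0 := image_eq_zero_of_notMem_tsupport h4
    have h6 : fderiv ℝ (innerProfile ε : Plane n → ℝ) z = 0 := by
      rw [(notMem_tsupport_iff_eventuallyEq.1 h4).fderiv_eq]; simp
    rw [Set.indicator_of_notMem hz', h5, neg_zero]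
    simp only [h6]
    simp

theorem tendsto_innerProfile {n : ℕ} (z : Plane n) :
    Filter.Tendsto (fun k : ℕ => innerProfile (1 / ((k : ℝ) + 1)) z) Filter.atTop
      (nhds (profile z)) := by
  rcases (profile_nonneg z).eq_or_lt with h | h
  · have : ∀ k : ℕ, innerProfile (1 / ((k : ℝ) + 1)) z = 0 := fun k => by
      rw [innerProfile, ← h, div_zero]
    simp only [this, ← h]
    exact tendsto_const_nhds
  · have h1 : Continuous fun ε : ℝ => max (profile z - ε) 0 ^ 2 / profile z := by fun_prop
    have h2 := (h1.tendsto 0).comp (tendsto_one_div_add_atTop_nhds_zero_nat (𝕜 := ℝ))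
    have h3 : max (profile z - 0) 0 ^ 2 / profile z = profile z := by
      rw [sub_zero, max_eq_left h.le]; field_simp
    rw [h3] at h2
    exact h2

/-- The flux formula cannot be used on E_o itself, because ∇u_o is unbounded near the sphere. The
regions between ± the inner profiles converge to E_o almost everywhere, and dominated convergence
passes to the limit. -/
theorem tendsto_setIntegral_innerProfile {n : ℕ} {F : Point n → ℝ} (hF : Integrable F) :
    Filter.Tendsto (fun k : ℕ =>
      (∫ g in {g : Point n | g.2 ≤ innerProfile (1 / ((k : ℝ) + 1)) g.1}, F g) -
        ∫ g in {g : Point n | g.2 ≤ -innerProfile (1 / ((k : ℝ) + 1)) g.1}, F g)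
      Filter.atTop (nhds (∫ g in isoperimetricSet n, F g)) := by
  have hε : ∀ k : ℕ, (0 : ℝ) < 1 / ((k : ℝ) + 1) := fun k => by positivity
  have m1 : ∀ k : ℕ, MeasurableSet {g : Point n | g.2 ≤ innerProfile (1 / ((k : ℝ) + 1)) g.1} :=
    fun k => measurableSet_subgraph (contDiff_innerProfile (hε k)).continuous
  have m2 : ∀ k : ℕ, MeasurableSet {g : Point n | g.2 ≤ -innerProfile (1 / ((k : ℝ) + 1)) g.1} :=
    fun k => measurableSet_subgraph (contDiff_innerProfile (hε k)).continuous.neg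
  have e1 : ∀ k : ℕ,
      (∫ g in {g : Point n | g.2 ≤ innerProfile (1 / ((k : ℝ) + 1)) g.1}, F g) -
        (∫ g in {g : Point n | g.2 ≤ -innerProfile (1 / ((k : ℝ) + 1)) g.1}, F g) =
      ∫ g, ({g : Point n | g.2 ≤ innerProfile (1 / ((k : ℝ) + 1)) g.1}.indicator F g -
        {g : Point n | g.2 ≤ -innerProfile (1 / ((k : ℝ) + 1)) g.1}.indicator F g) := fun k => by
    rw [integral_sub (hF.indicator (m1 k)) (hF.indicator (m2 k)), integral_indicator (m1 k),
      integral_indicator (m2 k)]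
  simp only [e1]
  rw [← integral_indicator (isOpen_isoperimetricSet n).measurableSet]
  refine tendsto_integral_of_dominated_convergence (fun g => ‖F g‖)
    (fun k => ((hF.indicator (m1 k)).sub (hF.indicator (m2 k))).aestronglyMeasurable) hF.norm
    (fun k => Filter.Eventually.of_forall fun g => ?_) ?_
  · simp only [Set.indicator_apply, Set.mem_ofPred_eq]
    split_ifs with h1 h2
    · simp
    · simp
    · have := innerProfile_nonneg (1 / ((k : ℝ) + 1)) g.1
      exfalso; linarith
    · simp
  · filter_upwards [ae_snd_ne (continuous_profile n).measurable,
      ae_snd_ne (continuous_profile n).neg.measurable] with g hg1 hg2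
    simp only [Pi.neg_apply] at hg2
    by_cases hg : g ∈ isoperimetricSet n
    · rw [Set.indicator_of_mem hg]
      have h1 : ∀ᶠ k : ℕ in Filter.atTop, |g.2| < innerProfile (1 / ((k : ℝ) + 1)) g.1 :=
        (tendsto_innerProfile g.1).eventually (lt_mem_nhds hg.2)
      refine tendsto_const_nhds.congr' ?_
      filter_upwards [h1] with k hk
      rw [abs_lt] at hk
      simp only [Set.indicator_apply, Set.mem_ofPred_eq]
      rw [if_pos hk.2.le, if_neg (by linarith), sub_zero]
    · rw [Set.indicator_of_notMem hg]
      refine tendsto_const_nhds.congr fun k => ?_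
      have hle := innerProfile_le (hε k).le g.1
      simp only [Set.indicator_apply, Set.mem_ofPred_eq]
      by_cases hz : ‖g.1‖ < 1
      · have h1 : profile g.1 ≤ |g.2| := not_lt.1 fun h => hg ⟨hz, h⟩
        rcases le_abs.1 h1 with h2 | h2
        · have h3 : profile g.1 < g.2 := lt_of_le_of_ne h2 (Ne.symm hg1)
          have h4 := profile_nonneg g.1
          have h5 := innerProfile_nonneg (1 / ((k : ℝ) + 1)) g.1
          rw [if_neg (by linarith), if_neg (by linarith), sub_zero]
        · have h5 := innerProfile_nonneg (1 / ((k : ℝ) + 1)) g.1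
          rw [if_pos (by linarith), if_pos (by linarith), sub_self]
      · simp only [innerProfile_of_one_le (hε k) (not_lt.1 hz), neg_zero, sub_self]

theorem perimeterH_isoperimetricSet_le {n : ℕ}
    (hA : IntegrableOn (fun z : Plane n => ‖z‖ / Real.sqrt (1 - ‖z‖ ^ 2)) (Metric.ball 0 1)) :
    perimeterH (isoperimetricSet n) ≤ ENNReal.ofReal (extremalPerimeter n) := by
  refine iSup₂_le fun ζ hζ => ENNReal.ofReal_le_ofReal ?_
  set Z : Point n → Plane n := fun g => WithLp.toLp 2 fun j => ζ j g with hZ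
  have hZC : ContDiff ℝ 1 Z := contDiff_euclidean.2 fun j => hζ.1 j
  have hZc : HasCompactSupport Z := by
    refine HasCompactSupport.intro (isCompact_iUnion fun j => (hζ.2.1 j).isCompact) fun g hg => ?_
    ext j
    exact image_eq_zero_of_notMem_tsupport (f := ζ j) fun h => hg (Set.mem_iUnion.2 ⟨j, h⟩)
  have hZ1 : ∀ g, ‖Z g‖ ≤ 1 := fun g => by
    have := hζ.2.2 g
    refine (sq_le_one_iff₀ (norm_nonneg _)).1 ?_
    rw [← sum_sq_eq_norm_sq]
    exact this
  have hlim := tendsto_setIntegral_innerProfile (integrable_divH' hζ.1 hζ.2.1)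
  exact le_of_tendsto hlim (Filter.Eventually.of_forall fun k =>
    integral_divH_innerProfile_le hA hZC hZc hZ1 (by positivity))

/-! ### Polar coordinates -/

theorem finrank_plane (n : ℕ) : Module.finrank ℝ (Plane n) = 2 * n := by
  simp [two_mul]

theorem nontrivial_plane {n : ℕ} (hn : 1 ≤ n) : Nontrivial (Plane n) :=
  Module.nontrivial_of_finrank_pos (R := ℝ) (by rw [finrank_plane]; omega)

theorem setIntegral_ball_norm {n : ℕ} (hn : 1 ≤ n) (f : ℝ → ℝ) :
    ∫ z in Metric.ball (0 : Plane n) 1, f ‖z‖ =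
      2 * n * volume.real (Metric.ball (0 : Plane n) 1) *
        ∫ r in Set.Ioo 0 1, r ^ (2 * n - 1) * f r := by
  have := nontrivial_plane hn
  have h1 : ∀ z : Plane n, (Metric.ball (0 : Plane n) 1).indicator (fun z => f ‖z‖) z =
      (Set.Iio 1).indicator f ‖z‖ := fun z => by
    by_cases hz : ‖z‖ < 1
    · rw [Set.indicator_of_mem (mem_ball_zero_iff.2 hz), Set.indicator_of_mem (Set.mem_Iio.2 hz)]
    · rw [Set.indicator_of_notMem (fun h => hz (mem_ball_zero_iff.1 h)),
        Set.indicator_of_notMem (fun h => hz (Set.mem_Iio.1 h))]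
  rw [← integral_indicator Metric.isOpen_ball.measurableSet]
  simp only [h1]
  rw [integral_fun_norm_addHaar, finrank_plane]
  have h2 : (fun r : ℝ => r ^ (2 * n - 1) • (Set.Iio 1).indicator f r) =
      (Set.Iio 1).indicator fun r => r ^ (2 * n - 1) * f r := by
    ext r
    simp only [Set.indicator_apply]
    split_ifs <;> simp
  rw [h2, setIntegral_indicator measurableSet_Iio, Set.Ioi_inter_Iio]
  simp [nsmul_eq_mul, mul_assoc]

theorem image_sin_Ioo : Real.sin '' Set.Ioo 0 (Real.pi / 2) = Set.Ioo 0 1 := by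
  ext r
  constructor
  · rintro ⟨s, hs, rfl⟩
    refine ⟨Real.sin_pos_of_pos_of_lt_pi hs.1 (by linarith [hs.2, Real.pi_pos]), ?_⟩
    rw [← Real.sin_pi_div_two]
    exact Real.sin_lt_sin_of_lt_of_le_pi_div_two (by linarith [hs.1, Real.pi_pos]) le_rfl hs.2
  · rintro ⟨h0, h1⟩
    exact ⟨Real.arcsin r, ⟨Real.arcsin_pos.2 h0, Real.arcsin_lt_pi_div_two.2 h1⟩,
      Real.sin_arcsin (by linarith) h1.le⟩

theorem injOn_sin_Ioo : Set.InjOn Real.sin (Set.Ioo 0 (Real.pi / 2)) :=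
  Real.injOn_sin.mono fun s hs =>
    Set.mem_Icc.2 ⟨by linarith [hs.1, Real.pi_pos], hs.2.le⟩

/-- The substitution r = sin s removes both √(1-r²) and arcsin r, so that flux, perimeter and volume
all become Wallis integrals. -/
theorem setIntegral_sin_subst (g : ℝ → ℝ) :
    ∫ r in Set.Ioo 0 1, g r = ∫ s in Set.Ioo 0 (Real.pi / 2), Real.cos s * g (Real.sin s) := by
  rw [← image_sin_Ioo, integral_image_eq_integral_abs_deriv_smul measurableSet_Ioo
    (fun s _ => (Real.hasDerivAt_sin s).hasDerivWithinAt) injOn_sin_Ioo]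
  refine setIntegral_congr_fun measurableSet_Ioo fun s hs => ?_
  simp only [smul_eq_mul]
  rw [abs_of_pos (Real.cos_pos_of_mem_Ioo ⟨by linarith [hs.1, Real.pi_pos], hs.2⟩)]

theorem cos_pos_of_mem {s : ℝ} (hs : s ∈ Set.Ioo 0 (Real.pi / 2)) : 0 < Real.cos s :=
  Real.cos_pos_of_mem_Ioo ⟨by linarith [hs.1, Real.pi_pos], hs.2⟩

theorem sqrt_one_sub_sin_sq {s : ℝ} (hs : s ∈ Set.Ioo 0 (Real.pi / 2)) :
    Real.sqrt (1 - Real.sin s ^ 2) = Real.cos s := by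
  rw [← Real.cos_sq', Real.sqrt_sq (cos_pos_of_mem hs).le]

/-- The Wallis integral over a quarter period. -/
def wallis (k : ℕ) : ℝ := ∫ s in (0 : ℝ)..(Real.pi / 2), Real.sin s ^ k

theorem wallis_add_two (k : ℕ) : wallis (k + 2) = (k + 1) / (k + 2) * wallis k := by
  unfold wallis
  rw [integral_sin_pow]
  simp

theorem setIntegral_Ioo_eq (g : ℝ → ℝ) :
    ∫ s in Set.Ioo 0 (Real.pi / 2), g s = ∫ s in (0 : ℝ)..(Real.pi / 2), g s := by
  rw [intervalIntegral.integral_of_le (by positivity), integral_Ioc_eq_integral_Ioo]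

theorem extremalPerimeter_eq {n : ℕ} (hn : 1 ≤ n) :
    extremalPerimeter n =
      2 * n * volume.real (Metric.ball (0 : Plane n) 1) * wallis (2 * n) := by
  rw [extremalPerimeter, setIntegral_ball_norm hn (fun r => r / Real.sqrt (1 - r ^ 2)),
    setIntegral_sin_subst, wallis, ← setIntegral_Ioo_eq]
  congr 1
  refine setIntegral_congr_fun measurableSet_Ioo fun s hs => ?_
  have hc := cos_pos_of_mem hs
  simp only [sqrt_one_sub_sin_sq hs]
  obtain ⟨m, rfl⟩ : ∃ m, n = m + 1 := ⟨n - 1, by omega⟩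
  rw [show 2 * (m + 1) - 1 = 2 * m + 1 by omega, show 2 * (m + 1) = 2 * m + 1 + 1 by ring,
    pow_succ _ (2 * m + 1)]
  field_simp

theorem integrableOn_extremalPerimeter {n : ℕ} (hn : 1 ≤ n) :
    IntegrableOn (fun z : Plane n => ‖z‖ / Real.sqrt (1 - ‖z‖ ^ 2)) (Metric.ball 0 1) := by
  have := nontrivial_plane hn
  rw [integrableOn_fun_norm_addHaar volume (f := fun r => r / Real.sqrt (1 - r ^ 2)),
    ← image_sin_Ioo, integrableOn_image_iff_integrableOn_abs_deriv_smul measurableSet_Ioo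
    (fun s _ => (Real.hasDerivAt_sin s).hasDerivWithinAt) injOn_sin_Ioo]
  have h1 : IntegrableOn
      (fun s => Real.sin s ^ (Module.finrank ℝ (Plane n) - 1) * Real.sin s)
      (Set.Ioo 0 (Real.pi / 2)) :=
    (Continuous.integrableOn_Icc (a := 0) (b := Real.pi / 2) (by fun_prop)).mono_set
      Set.Ioo_subset_Icc_self
  refine h1.congr_fun (fun s hs => ?_) measurableSet_Ioo
  have hc := cos_pos_of_mem hs
  simp only [smul_eq_mul, sqrt_one_sub_sin_sq hs, abs_of_pos hc]
  field_simp

theorem discFlux_eq {n : ℕ} (hn : 1 ≤ n) :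
    discFlux n = 2 * n * volume.real (Metric.ball (0 : Plane n) 1) *
      (wallis (2 * n) - wallis (2 * n + 2)) := by
  rw [discFlux, setIntegral_ball_norm hn (fun r => r * Real.sqrt (1 - r ^ 2)),
    setIntegral_sin_subst, wallis, wallis, ← intervalIntegral.integral_sub
      ((by fun_prop : Continuous _).intervalIntegrable _ _)
      ((by fun_prop : Continuous _).intervalIntegrable _ _), ← setIntegral_Ioo_eq]
  congr 1
  refine setIntegral_congr_fun measurableSet_Ioo fun s hs => ?_
  simp only [sqrt_one_sub_sin_sq hs]
  obtain ⟨m, rfl⟩ : ∃ m, n = m + 1 := ⟨n - 1, by omega⟩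
  rw [show 2 * (m + 1) - 1 = 2 * m + 1 by omega, show 2 * (m + 1) = 2 * m + 1 + 1 by ring]
  have h := Real.cos_sq' s
  linear_combination (Real.sin s ^ (2 * m + 1) * Real.sin s) * h

theorem volume_isoperimetricSet {n : ℕ} :
    volume (isoperimetricSet n) =
      ENNReal.ofReal (∫ z in Metric.ball (0 : Plane n) 1, 2 * radialProfile ‖z‖) := by
  have h1 : isoperimetricSet n =
      regionBetween (fun z : Plane n => -profile z) profile (Metric.ball 0 1) := by
    ext g
    simp [isoperimetricSet, regionBetween, abs_lt]
  have hi : IntegrableOn (profile : Plane n → ℝ) (Metric.ball 0 1) :=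
    ((continuous_profile n).continuousOn.integrableOn_compact
      (isCompact_closedBall (0 : Plane n) 1)).mono_set Metric.ball_subset_closedBall
  have hi' : IntegrableOn (fun z : Plane n => -profile z) (Metric.ball 0 1) := hi.neg
  rw [h1, Measure.volume_eq_prod, volume_regionBetween_eq_integral hi' hi
    Metric.isOpen_ball.measurableSet fun z _ => by linarith [profile_nonneg z]]
  congr 2
  ext z
  simp [profile_eq]; ring

/-- Integration by parts: in the variable s the profile is G with G' = -(sin² s)/2, and sin^(2n) s ·
G vanishes at both ends. -/
theorem integral_radialProfile {n : ℕ} (hn : 1 ≤ n) :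
    ∫ r in Set.Ioo 0 1, r ^ (2 * n - 1) * (2 * radialProfile r) =
      wallis (2 * n + 2) / (2 * n) := by
  obtain ⟨m, rfl⟩ : ∃ m, n = m + 1 := ⟨n - 1, by omega⟩
  rw [setIntegral_sin_subst]
  set G : ℝ → ℝ := fun s => Real.pi / 8 + Real.sin s * Real.cos s / 4 - s / 4 with hG
  have h1 : ∀ s ∈ Set.Ioo 0 (Real.pi / 2), Real.cos s * (Real.sin s ^ (2 * (m + 1) - 1) *
      (2 * radialProfile (Real.sin s))) =
      Real.cos s * (Real.sin s ^ (2 * m + 1) * (2 * G s)) := by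
    intro s hs
    rw [radialProfile, sqrt_one_sub_sin_sq hs,
      Real.arcsin_sin (by linarith [hs.1, Real.pi_pos]) hs.2.le, hG,
      show 2 * (m + 1) - 1 = 2 * m + 1 by omega]
    ring
  rw [setIntegral_congr_fun measurableSet_Ioo h1, setIntegral_Ioo_eq]
  have hGd : ∀ s, HasDerivAt G (-(Real.sin s ^ 2 / 2)) s := by
    intro s
    have := ((((Real.hasDerivAt_sin s).mul (Real.hasDerivAt_cos s)).div_const 4).const_add
      (Real.pi / 8)).sub ((hasDerivAt_id s).div_const 4)
    refine this.congr_deriv ?_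
    linear_combination (1 / 4) * Real.sin_sq_add_cos_sq s
  have hd : ∀ s ∈ Set.uIcc 0 (Real.pi / 2),
      HasDerivAt (fun s => Real.sin s ^ (2 * m + 2) * G s)
        ((m + 1) * (Real.cos s * (Real.sin s ^ (2 * m + 1) * (2 * G s))) -
          Real.sin s ^ (2 * (m + 1) + 2) / 2) s := by
    intro s _
    refine (((Real.hasDerivAt_sin s).pow (2 * m + 2)).mul (hGd s)).congr_deriv ?_
    simp
    ring
  have c3 : Continuous fun s =>
      ((m : ℝ) + 1) * (Real.cos s * (Real.sin s ^ (2 * m + 1) * (2 * G s))) := by fun_prop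
  have c4 : Continuous fun s => Real.sin s ^ (2 * (m + 1) + 2) / 2 := by fun_prop
  have hftc := intervalIntegral.integral_eq_sub_of_hasDerivAt hd
    ((c3.sub c4).intervalIntegrable _ _)
  rw [intervalIntegral.integral_sub (c3.intervalIntegrable _ _)
    (c4.intervalIntegrable _ _), intervalIntegral.integral_const_mul,
    intervalIntegral.integral_div] at hftc
  have hend : G (Real.pi / 2) = 0 := by simp [hG]; ring
  rw [hend] at hftc
  simp only [Real.sin_zero, mul_zero, zero_mul, sub_zero, ne_eq, Nat.add_eq_zero_iff,
    OfNat.ofNat_ne_zero, and_false, not_false_eq_true, zero_pow] at hftc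
  rw [wallis, eq_div_iff (by positivity)]
  push_cast
  linarith

theorem volume_real_isoperimetricSet {n : ℕ} (hn : 1 ≤ n) :
    volume.real (isoperimetricSet n) =
      volume.real (Metric.ball (0 : Plane n) 1) * wallis (2 * n + 2) := by
  rw [Measure.real, volume_isoperimetricSet, ENNReal.toReal_ofReal]
  · rw [setIntegral_ball_norm hn (fun r => 2 * radialProfile r), integral_radialProfile hn]
    have : (n : ℝ) ≠ 0 := by positivity
    field_simp
  · refine setIntegral_nonneg Metric.isOpen_ball.measurableSet fun z _ => ?_
    have := profile_nonneg z
    rw [profile_eq] at this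
    linarith

theorem wallis_two_mul (n : ℕ) :
    wallis (2 * n) = Real.sqrt Real.pi / 2 * (Real.Gamma (n + 1 / 2) / Real.Gamma (n + 1)) := by
  induction n with
  | zero =>
    simp only [wallis, mul_zero, pow_zero, Nat.cast_zero, zero_add]
    rw [Real.Gamma_one_half_eq, Real.Gamma_one, intervalIntegral.integral_const]
    simp only [sub_zero, smul_eq_mul, mul_one, div_one]
    linarith [Real.mul_self_sqrt Real.pi_pos.le]
  | succ k ih =>
    rw [show 2 * (k + 1) = 2 * k + 2 by ring, wallis_add_two, ih]
    have h1 : Real.Gamma ((k + 1 : ℕ) + 1 / 2) = (k + 1 / 2) * Real.Gamma (k + 1 / 2) := by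
      rw [← Real.Gamma_add_one (by positivity)]; congr 1; push_cast; ring
    have h2 : Real.Gamma ((k + 1 : ℕ) + 1) = (k + 1) * Real.Gamma (k + 1) := by
      rw [← Real.Gamma_add_one (by positivity)]; congr 1; push_cast; ring
    rw [h1, h2]
    have : Real.Gamma ((k : ℝ) + 1) ≠ 0 := (Real.Gamma_pos_of_pos (by positivity)).ne'
    push_cast
    field_simp

theorem volume_real_ball (n : ℕ) (hn : 1 ≤ n) :
    volume.real (Metric.ball (0 : Plane n) 1) = Real.pi ^ n / Real.Gamma (n + 1) := by
  have : Nonempty (Fin n ⊕ Fin n) := ⟨Sum.inl ⟨0, hn⟩⟩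
  rw [Measure.real, EuclideanSpace.volume_ball]
  simp only [ENNReal.ofReal_one, one_pow, one_mul, Fintype.card_sum, Fintype.card_fin]
  rw [ENNReal.toReal_ofReal (div_nonneg (by positivity) (Real.Gamma_pos_of_pos (by positivity)).le)]
  congr 1
  · rw [← two_mul, pow_mul, Real.sq_sqrt Real.pi_pos.le]
  · congr 1; push_cast; ring

/-! ### The optimal constant -/

theorem wallis_pos (n : ℕ) : 0 < wallis (2 * n) := by
  rw [wallis_two_mul]
  have h1 : 0 < Real.Gamma ((n : ℝ) + 1 / 2) := Real.Gamma_pos_of_pos (by positivity)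
  have h2 : 0 < Real.Gamma ((n : ℝ) + 1) := Real.Gamma_pos_of_pos (by positivity)
  have := Real.pi_pos
  positivity

theorem volume_real_ball_pos {n : ℕ} (hn : 1 ≤ n) :
    0 < volume.real (Metric.ball (0 : Plane n) 1) := by
  rw [volume_real_ball n hn]
  have h2 : 0 < Real.Gamma ((n : ℝ) + 1) := Real.Gamma_pos_of_pos (by positivity)
  have := Real.pi_pos
  positivity

theorem volume_real_isoperimetricSet_pos {n : ℕ} (hn : 1 ≤ n) :
    0 < volume.real (isoperimetricSet n) := by
  rw [volume_real_isoperimetricSet hn]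
  exact mul_pos (volume_real_ball_pos hn) (wallis_pos (n + 1))

/-- The Wallis recursion reads W_{2n} - W_{2n+2} = W_{2n+2}/(2n+1). In terms of Q this is (Q-1)D =
(Q-2)|E_o|, exactly the condition for the line 2nV + D, suitably scaled, to be tangent to
V^((Q-1)/Q) at |E_o|. -/
theorem discFlux_eq_volume {n : ℕ} (hn : 1 ≤ n) :
    (2 * n + 1) * discFlux n = 2 * n * volume.real (isoperimetricSet n) := by
  rw [discFlux_eq hn, volume_real_isoperimetricSet hn, wallis_add_two]
  push_cast
  field_simp
  ring

/-- The upper bound for the perimeter of E_o coincides with the calibration bound, so both are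
attained there. -/
theorem extremalPerimeter_eq_volume {n : ℕ} (hn : 1 ≤ n) :
    extremalPerimeter n = 2 * n * volume.real (isoperimetricSet n) + discFlux n := by
  rw [discFlux_eq hn, volume_real_isoperimetricSet hn, extremalPerimeter_eq hn]
  ring

theorem volume_real_isoperimetricSet_eq_Gamma {n : ℕ} (hn : 1 ≤ n) :
    volume.real (isoperimetricSet n) = Real.pi ^ ((n : ℝ) + 1 / 2) * Real.Gamma (n + 3 / 2) /
      ((2 * n + 2) * Real.Gamma (n + 1) ^ 2) := by
  have h1 : Real.Gamma ((n : ℝ) + 3 / 2) = (n + 1 / 2) * Real.Gamma (n + 1 / 2) := by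
    rw [← Real.Gamma_add_one (by positivity)]; congr 1; ring
  have h2 : Real.Gamma ((n : ℝ) + 1) ≠ 0 := (Real.Gamma_pos_of_pos (by positivity)).ne'
  rw [volume_real_isoperimetricSet hn, wallis_add_two, wallis_two_mul, volume_real_ball n hn, h1,
    Real.rpow_add Real.pi_pos, Real.rpow_natCast, ← Real.sqrt_eq_rpow]
  push_cast
  field_simp

/-- C_Q is the isoperimetric ratio of E_o. With the value of D, it equals (Q-1)/(Q(Q-2)) ·
|E_o|^(-1/Q), and the Gamma function formula for |E_o| turns this into the stated constant. -/
theorem isoConst_mul {n : ℕ} (hn : 1 ≤ n) :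
    isoConst (homDim n) * (2 * n * volume.real (isoperimetricSet n) + discFlux n) =
      volume.real (isoperimetricSet n) ^ (((homDim n : ℝ) - 1) / homDim n) := by
  have hV := volume_real_isoperimetricSet_pos hn
  have hn' : (0 : ℝ) < n := by exact_mod_cast hn
  have hd := discFlux_eq_volume hn
  have hQ : (homDim n : ℝ) = 2 * n + 2 := by simp [homDim]
  have h1 : 2 * n * volume.real (isoperimetricSet n) + discFlux n =
      volume.real (isoperimetricSet n) * (2 * n * (2 * n + 2) / (2 * n + 1)) := by
    field_simp
    linarith
  have h2 : ((homDim n : ℝ) - 1) / homDim n = 1 - 1 / homDim n := by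
    rw [hQ]; field_simp
  have hG : 0 < Real.Gamma ((n : ℝ) + 1) := Real.Gamma_pos_of_pos (by positivity)
  have hG' : 0 < Real.Gamma ((n : ℝ) + 3 / 2) := Real.Gamma_pos_of_pos (by positivity)
  have hp := Real.pi_pos
  have h3 : volume.real (isoperimetricSet n) ^ (1 / (homDim n : ℝ)) =
      Real.pi ^ (((homDim n : ℝ) - 1) / (2 * homDim n)) *
        Real.Gamma (n + 3 / 2) ^ (1 / (homDim n : ℝ)) /
        ((homDim n : ℝ) ^ (1 / (homDim n : ℝ)) *
          Real.Gamma (n + 1) ^ (2 / (homDim n : ℝ))) := by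
    rw [volume_real_isoperimetricSet_eq_Gamma hn, Real.div_rpow (by positivity) (by positivity),
      Real.mul_rpow (by positivity) hG'.le, Real.mul_rpow (by positivity) (by positivity),
      ← Real.rpow_mul hp.le, ← Real.rpow_natCast, ← Real.rpow_mul hG.le, ← hQ]
    congr 3
    · rw [hQ]; field_simp; ring
    · congr 1; ring
  rw [h1, h2, Real.rpow_sub hV, Real.rpow_one, h3, isoConst, h2,
    Real.rpow_sub (by rw [hQ]; positivity), Real.rpow_one,
    show (homDim n : ℝ) / 2 = n + 1 by rw [hQ]; ring,
    show ((homDim n : ℝ) + 1) / 2 = n + 3 / 2 by rw [hQ]; ring]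
  have e1 : 0 < (homDim n : ℝ) ^ (1 / (homDim n : ℝ)) :=
    Real.rpow_pos_of_pos (by rw [hQ]; positivity) _
  have e2 : 0 < Real.Gamma ((n : ℝ) + 3 / 2) ^ (1 / (homDim n : ℝ)) := Real.rpow_pos_of_pos hG' _
  have e3 : 0 < Real.pi ^ (((homDim n : ℝ) - 1) / (2 * homDim n)) := Real.rpow_pos_of_pos hp _
  have e4 : 0 < Real.Gamma ((n : ℝ) + 1) ^ (2 / (homDim n : ℝ)) := Real.rpow_pos_of_pos hG _
  generalize (homDim n : ℝ) ^ (1 / (homDim n : ℝ)) = a at *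
  generalize Real.Gamma ((n : ℝ) + 3 / 2) ^ (1 / (homDim n : ℝ)) = b at *
  generalize Real.pi ^ (((homDim n : ℝ) - 1) / (2 * homDim n)) = c at *
  generalize Real.Gamma ((n : ℝ) + 1) ^ (2 / (homDim n : ℝ)) = d at *
  rw [hQ, show 2 * (n : ℝ) + 2 - 2 = 2 * n by ring, show 2 * (n : ℝ) + 2 - 1 = 2 * n + 1 by ring]
  field_simp

theorem isoConst_pos {n : ℕ} (hn : 1 ≤ n) : 0 < isoConst (homDim n) := by
  have hV := volume_real_isoperimetricSet_pos hn
  have hn' : (0 : ℝ) < n := by exact_mod_cast hn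
  have hd : 0 < discFlux n := by
    have := discFlux_eq_volume hn
    have h : 0 < (2 * (n : ℝ) + 1) * discFlux n := by rw [this]; positivity
    exact pos_of_mul_pos_right h (by positivity)
  refine pos_of_mul_pos_left (b := 2 * n * volume.real (isoperimetricSet n) + discFlux n) ?_
    (by positivity)
  rw [isoConst_mul hn]
  positivity

/-- The tangent line of the concave function `V ↦ V ^ ((Q - 1) / Q)` at the volume of the
isoperimetric set. -/
theorem rpow_le_isoConst_mul {n : ℕ} (hn : 1 ≤ n) {V : ℝ} (hV : 0 ≤ V) :
    V ^ (((homDim n : ℝ) - 1) / homDim n) ≤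
      isoConst (homDim n) * (2 * n * V + discFlux n) := by
  have hVo := volume_real_isoperimetricSet_pos hn
  have hn' : (0 : ℝ) < n := by exact_mod_cast hn
  have hQ : (homDim n : ℝ) = 2 * n + 2 := by simp [homDim]
  have hd := discFlux_eq_volume hn
  have hC := isoConst_mul hn
  set W := volume.real (isoperimetricSet n)
  have h0 : 0 ≤ ((homDim n : ℝ) - 1) / homDim n :=
    div_nonneg (by linarith) (by linarith)
  -- Weighted AM-GM for V/|E_o| and 1 with weights (Q-1)/Q and 1/Q is the tangent line inequality at
  -- V = |E_o|.
  have key := Real.geom_mean_le_arith_mean2_weighted (w₁ := ((homDim n : ℝ) - 1) / homDim n)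
    (w₂ := 1 / homDim n) (p₁ := V / W) (p₂ := 1) h0 (by positivity) (by positivity) zero_le_one (by rw [hQ]; field_simp; ring)
  rw [Real.one_rpow, mul_one, mul_one, Real.div_rpow hV hVo.le,
    div_le_iff₀ (Real.rpow_pos_of_pos hVo _), ← hC] at key
  refine key.trans (le_of_eq ?_)
  have hd' : discFlux n = 2 * n * W / (2 * n + 1) := by
    rw [eq_div_iff (by positivity)]; linarith
  rw [hQ, hd']
  field_simp
  ring

/-! ### Invariance of the isoperimetric inequality -/

theorem volume_rpow_dilation {n : ℕ} {lam : ℝ} (h : 0 < lam) (E : Set (Point n)) :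
    volume (dilation lam '' E) ^ (((homDim n : ℝ) - 1) / homDim n) =
      ENNReal.ofReal (lam ^ (2 * n + 1)) * volume E ^ (((homDim n : ℝ) - 1) / homDim n) := by
  have hQ : (homDim n : ℝ) = 2 * n + 2 := by simp [homDim]
  have h0 : 0 ≤ ((homDim n : ℝ) - 1) / homDim n := by
    rw [hQ]; exact div_nonneg (by linarith [n.cast_nonneg (α := ℝ)]) (by positivity)
  rw [volume_dilation h, ENNReal.mul_rpow_of_nonneg _ _ h0,
    ENNReal.ofReal_rpow_of_nonneg (by positivity) h0, ← Real.rpow_natCast, ← Real.rpow_mul h.le,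
    ← Real.rpow_natCast lam (2 * n + 1)]
  congr 4
  rw [hQ]
  push_cast
  field_simp
  ring

theorem isoperimetric_le_dilation {n : ℕ} {lam : ℝ} (h : 0 < lam) (E : Set (Point n)) :
    volume (dilation lam '' E) ^ (((homDim n : ℝ) - 1) / homDim n) ≤
        ENNReal.ofReal (isoConst (homDim n)) * perimeterH (dilation lam '' E) ↔
      volume E ^ (((homDim n : ℝ) - 1) / homDim n) ≤
        ENNReal.ofReal (isoConst (homDim n)) * perimeterH E := by
  rw [volume_rpow_dilation h, perimeterH_dilation h, mul_left_comm]
  exact ENNReal.mul_le_mul_iff_right (by simpa using pow_pos h _) ENNReal.ofReal_ne_top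

theorem isoperimetric_eq_dilation {n : ℕ} {lam : ℝ} (h : 0 < lam) (E : Set (Point n)) :
    volume (dilation lam '' E) ^ (((homDim n : ℝ) - 1) / homDim n) =
        ENNReal.ofReal (isoConst (homDim n)) * perimeterH (dilation lam '' E) ↔
      volume E ^ (((homDim n : ℝ) - 1) / homDim n) =
        ENNReal.ofReal (isoConst (homDim n)) * perimeterH E := by
  rw [volume_rpow_dilation h, perimeterH_dilation h, mul_left_comm]
  exact ENNReal.mul_right_inj (by simpa using pow_pos h _) ENNReal.ofReal_ne_top

/-! ### The isoperimetric inequality for normalized sets -/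

theorem IsLens.volume_rpow_le {n : ℕ} (hn : 1 ≤ n) {u v : Plane n → ℝ} {E : Set (Point n)}
    (h : IsLens 1 u v E) :
    volume E ^ (((homDim n : ℝ) - 1) / homDim n) ≤ ENNReal.ofReal (isoConst (homDim n)) *
      ENNReal.ofReal (2 * n * (volume E).toReal + discFlux n) := by
  have h0 : 0 ≤ ((homDim n : ℝ) - 1) / homDim n := by
    simp only [homDim]; push_cast
    exact div_nonneg (by linarith [n.cast_nonneg (α := ℝ)]) (by positivity)
  rw [← ENNReal.ofReal_mul (isoConst_pos hn).le]
  nth_rw 1 [← ENNReal.ofReal_toReal h.volume_lt_top.ne]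
  rw [ENNReal.ofReal_rpow_of_nonneg ENNReal.toReal_nonneg h0]
  exact ENNReal.ofReal_le_ofReal (rpow_le_isoConst_mul hn ENNReal.toReal_nonneg)

theorem IsLens.isoperimetric_le {n : ℕ} (hn : 1 ≤ n) {u v : Plane n → ℝ} {E : Set (Point n)}
    (h : IsLens 1 u v E) :
    volume E ^ (((homDim n : ℝ) - 1) / homDim n) ≤
      ENNReal.ofReal (isoConst (homDim n)) * perimeterH E :=
  (h.volume_rpow_le hn).trans (mul_le_mul_right h.ofReal_volume_add_discFlux_le _)

/-- Equality places P_H(E) below 2n|E| + D, while the calibration places it above. The perimeter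
bound is thus attained and rigidity applies; the equality case of the tangent line inequality is not
needed. -/
theorem IsLens.eq_isoperimetricSet_of_eq {n : ℕ} (hn : 1 ≤ n) {u v : Plane n → ℝ}
    {E : Set (Point n)} (h : IsLens 1 u v E)
    (heq : volume E ^ (((homDim n : ℝ) - 1) / homDim n) =
      ENNReal.ofReal (isoConst (homDim n)) * perimeterH E) : E = isoperimetricSet n := by
  refine h.eq_isoperimetricSet hn (le_antisymm ?_ h.ofReal_volume_add_discFlux_le)
  have := h.volume_rpow_le hn
  rw [heq] at this
  exact (ENNReal.mul_le_mul_iff_right (by simpa using isoConst_pos hn) ENNReal.ofReal_ne_top).1 this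

theorem isoperimetric_eq_isoperimetricSet {n : ℕ} (hn : 1 ≤ n) :
    volume (isoperimetricSet n) ^ (((homDim n : ℝ) - 1) / homDim n) =
      ENNReal.ofReal (isoConst (homDim n)) * perimeterH (isoperimetricSet n) := by
  have hl := isLens_isoperimetricSet n
  refine le_antisymm (hl.isoperimetric_le hn) ?_
  refine (mul_le_mul_right (perimeterH_isoperimetricSet_le (integrableOn_extremalPerimeter hn))
    _).trans (le_of_eq ?_)
  have h0 : 0 ≤ ((homDim n : ℝ) - 1) / homDim n := by
    simp only [homDim]; push_cast
    exact div_nonneg (by linarith [n.cast_nonneg (α := ℝ)]) (by positivity)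
  rw [extremalPerimeter_eq_volume hn, ← ENNReal.ofReal_mul (isoConst_pos hn).le, isoConst_mul hn,
    ← ENNReal.ofReal_rpow_of_nonneg measureReal_nonneg h0, Measure.real,
    ENNReal.ofReal_toReal hl.volume_lt_top.ne]

/-! ### Composition of dilations and translations, and assembly of the theorem. -/

theorem dilation_image_dilation_image {n : ℕ} (a b : ℝ) (E : Set (Point n)) :
    dilation a '' (dilation b '' E) = dilation (a * b) '' E := by
  rw [Set.image_image]
  congr 1
  ext1 g
  simp only [dilation, smul_smul]
  congr 1
  ring

theorem dilation_image_leftTranslation_image {n : ℕ} (lam : ℝ) (g : Point n) (E : Set (Point n)) :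
    dilation lam '' (leftTranslation g '' E) =
      leftTranslation (dilation lam g) '' (dilation lam '' E) := by
  simp only [Set.image_image, dilation_leftTranslation]

end Heisenberg

theorem theorem1p2 (n : ℕ) (hn : 1 ≤ n) :
    (∀ E ∈ Heisenberg.admissibleOrbit n,
      volume E ^ (((Heisenberg.homDim n : ℝ) - 1) / (Heisenberg.homDim n : ℝ)) ≤
        ENNReal.ofReal (Heisenberg.isoConst (Heisenberg.homDim n : ℝ)) *
          Heisenberg.perimeterH E) ∧
    ∀ E : Set (Heisenberg.Point n),
      (E ∈ Heisenberg.admissibleOrbit n ∧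
        volume E ^ (((Heisenberg.homDim n : ℝ) - 1) / (Heisenberg.homDim n : ℝ)) =
          ENNReal.ofReal (Heisenberg.isoConst (Heisenberg.homDim n : ℝ)) *
            Heisenberg.perimeterH E) ↔
      ∃ lam : ℝ, 0 < lam ∧ ∃ g : Heisenberg.Point n,
        E = Heisenberg.leftTranslation g ''
          (Heisenberg.dilation lam '' Heisenberg.isoperimetricSet n) := by
  refine ⟨?_, fun E => ⟨?_, ?_⟩⟩
  · rintro E ⟨F, hF, lam, hlam, g, rfl⟩
    obtain ⟨R, hR, u, v, hl⟩ := hF.exists_isLens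
    rw [Heisenberg.isoperimetric_le_dilation hlam, Heisenberg.volume_leftTranslation,
      Heisenberg.perimeterH_leftTranslation,
      ← Heisenberg.isoperimetric_le_dilation (inv_pos.2 hR) F]
    exact (hl.dilate hR).isoperimetric_le hn
  · rintro ⟨⟨F, hF, lam, hlam, g, rfl⟩, heq⟩
    obtain ⟨R, hR, u, v, hl⟩ := hF.exists_isLens
    rw [Heisenberg.isoperimetric_eq_dilation hlam, Heisenberg.volume_leftTranslation,
      Heisenberg.perimeterH_leftTranslation,
      ← Heisenberg.isoperimetric_eq_dilation (inv_pos.2 hR) F] at heq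
    have hE := (hl.dilate hR).eq_isoperimetricSet_of_eq hn heq
    have hF' : F = Heisenberg.dilation R '' Heisenberg.isoperimetricSet n := by
      rw [← hE]
      simpa using (Heisenberg.dilation_inv_image (inv_pos.2 hR) F).symm
    -- F is the extremal set dilated by its own radius R. Moving the outer dilation past the
    -- translation turns the base point g into δ_lam(g).
    refine ⟨lam * R, mul_pos hlam hR, Heisenberg.dilation lam g, ?_⟩
    rw [Heisenberg.dilation_image_leftTranslation_image, hF',
      Heisenberg.dilation_image_dilation_image]
  · rintro ⟨lam, hlam, g, rfl⟩
    -- The orbit is written with the dilation outermost. As δ_lam is an automorphism, the order is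
    -- exchanged by replacing g with δ_{1/lam}(g).
    have hg : Heisenberg.leftTranslation g ''
        (Heisenberg.dilation lam '' Heisenberg.isoperimetricSet n) = Heisenberg.dilation lam ''
          (Heisenberg.leftTranslation (Heisenberg.dilation lam⁻¹ g) ''
            Heisenberg.isoperimetricSet n) := by
      rw [Heisenberg.dilation_image_leftTranslation_image]
      congr 2
      simp [Heisenberg.dilation, hlam.ne']
    refine ⟨⟨_, Heisenberg.isAdmissible_isoperimetricSet n, lam, hlam, _, hg⟩, ?_⟩
    rw [Heisenberg.volume_leftTranslation, Heisenberg.perimeterH_leftTranslation,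
      Heisenberg.isoperimetric_eq_dilation hlam]
    exact Heisenberg.isoperimetric_eq_isoperimetricSet hn

end
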